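/- Let $G\subset\mathbb C$ be a bounded simply connected domain whose boundary $\Gamma=\partial G$ is a piecewise analytic Jordan curve without cusps (i.e. without interior angles $0$ or $2\pi$), let $\Omega=\overline{\mathbb C}\setminus\overline G$, and let $z_0\in G$. Let $f_0$ be the conformal map of $G$ onto a disk $\{|w|<r_0\}$ with $f_0(z_0)=0$, $f_0'(z_0)=1$, and let $\Phi$ be the conformal map of $\Omega$ onto $\{|w|>1\}$ with $\Phi(z)=\gamma z+\gamma_0+\gamma_1/z+\cdots$ near $\infty$, $\gamma>0$. For $\rho>1$ let $G_\rho$ be the interior of the level curve $\{z:|\Phi(z)|=\rho\}$. Let $K(\cdot,z_0)$ be the Bergman kernel function of $G$: the function in $L^2_a(G)$ (the analytic functions on $G$ that are square integrable with respect to area measure) such that $\langle g,K(\cdot,z_0)\rangle_{L^2(G)}=g(z_0)$ for all $g\in L^2_a(G)$. Let $z_1,\dots,z_\kappa\in\Omega\setminus\{\infty\}$ be distinct, let $k_j,m_j\ge1$ be integers, let $z_{\kappa+1}\in\Omega\setminus\{\infty\}$, and put $\varrho:=|\Phi(z_{\kappa+1})|$; assume $|\Phi(z_j)|<\varrho$ for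 $1\le j\le\kappa$. Assume that $f_0$ has no singularities in $G_\varrho$ other than $z_1,\dots,z_\kappa$, i.e. $f_0$ can be continued analytically along every path in $G_\varrho\setminus\{z_1,\dots,z_\kappa\}$ that starts in $G$, and that at each $z_j$ the singularity is a (rational) pole of the form $(z-z_j)^{-k_j/m_j}$, i.e. on some punctured neighbourhood of $z_j$ every germ of this continuation is locally of the form $c\,(z-z_j)^{-k_j/m_j}+h(z)$, with a constant $c\ne0$, some branch of the power, and $h$ analytic on the full neighbourhood. Consider the augmented system $$\eta_j(z)=\Big[\Big(\frac1{z-z_j}\Big)^{k_j/m_j}\Big]'\quad(1\le j\le\kappa),\qquad \eta_{\kappa+j}(z)=(z^j)'\quad (j\ge1),$$ where any holomorphic branches on $G$ of the powers are used. Let $\{\widetilde P_j\}$ be the orthonormal system obtained from $\{\eta_j\}$ by the Gram--Schmidt process in $L^2(G)$, $\widetilde P_j=\sum_{i\le j}b_{j,i}\eta_i$, $b_{j,j}>0$, and let $$\widetilde K_n(z,z_0)=\sum_{j=1}^{\kappa+n}\overline{\widetilde P_j(z_0)}\,\widetilde P_j(z)$$ be the augmented kernel polynomials. Then for every $R$ with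 $1<R<\varrho$ there is a constant $c>0$, independent of $n$, such that for all integers $n\ge0$ $$\|K(\cdot,z_0)-\widetilde K_n(\cdot,z_0)\|_{L^2(G)}\le \frac{c}{R^{n}}.$$ -/

import Mathlib

open Set Filter Topology MeasureTheory

/-- `Γ` is a piecewise analytic Jordan curve without cusps: it is the cyclic concatenation of
finitely many regular analytic arcs `σ i : [0,1] → ℂ` (analytic up to and including the end points,
with non-vanishing derivative), without self-intersections, and at no junction do the two one-sided
tangents form an interior angle `0` or `2π`. -/
def IsPiecewiseAnalyticJordanCurveWithoutCusps (Γ : Set ℂ) : Prop :=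
  ∃ (N : ℕ) (σ : Fin (N + 1) → ℝ → ℂ),
    (∀ i, AnalyticOnNhd ℝ (σ i) (Icc 0 1)) ∧
    (∀ i, ∀ t ∈ Icc (0 : ℝ) 1, deriv (σ i) t ≠ 0) ∧
    -- the addition `i + 1` in `Fin (N + 1)` is cyclic
    (∀ i, σ i 1 = σ (i + 1) 0) ∧
    InjOn (fun p : Fin (N + 1) × ℝ => σ p.1 p.2) (univ ×ˢ Ico 0 1) ∧
    Γ = ⋃ i, σ i '' Icc 0 1 ∧
    -- a cusp: the outgoing tangent points exactly opposite to the incoming one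
    (∀ i, ¬ SameRay ℝ (deriv (σ (i + 1)) 0) (-(deriv (σ i) 1)))

/-- `G` is a bounded simply connected domain whose boundary is a piecewise analytic Jordan curve
without cusps. -/
structure IsPiecewiseAnalyticJordanDomain (G : Set ℂ) : Prop where
  isOpen : IsOpen G
  bounded : Bornology.IsBounded G
  simplyConnected : IsSimplyConnected G
  boundary : IsPiecewiseAnalyticJordanCurveWithoutCusps (frontier G)

/-- `f₀` is the conformal map of `G` onto a disk `|w| < r₀` with `f₀(z₀) = 0`, `f₀'(z₀) = 1`. -/
structure IsInteriorConformalMap (G : Set ℂ) (z₀ : ℂ) (r₀ : ℝ) (f₀ : ℂ → ℂ) : Prop where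
  holomorphic : DifferentiableOn ℂ f₀ G
  bijective : BijOn f₀ G (Metric.ball 0 r₀)
  map_base : f₀ z₀ = 0
  deriv_base : deriv f₀ z₀ = 1

/-- `Φ` is the conformal map of `Ω = (ℂ ∪ {∞}) \ closure G` onto `|w| > 1` with
`Φ(z) = γ z + γ₀ + γ₁ / z + ⋯` near `∞`, `γ > 0` (written on the finite part of `Ω`; for `Φ` analytic
near `∞` the expansion is equivalent to `Φ(z) / z → γ`). -/
structure IsExteriorConformalMap (G : Set ℂ) (Φ : ℂ → ℂ) : Prop where
  holomorphic : DifferentiableOn ℂ Φ (closure G)ᶜ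
  bijective : BijOn Φ (closure G)ᶜ {w : ℂ | 1 < ‖w‖}
  normalized : ∃ γ : ℝ, 0 < γ ∧
    Tendsto (fun z : ℂ => Φ z / z) (Bornology.cobounded ℂ) (𝓝 (γ : ℂ))

/-- `G_ρ`, the interior of the level curve `{z ∈ Ω : |Φ(z)| = ρ}`, for `ρ > 1`. -/
def levelInterior (G : Set ℂ) (Φ : ℂ → ℂ) (ρ : ℝ) : Set ℂ :=
  closure G ∪ {z : ℂ | z ∉ closure G ∧ ‖Φ z‖ < ρ}

/-- `K` is the Bergman kernel function `K(·, z₀)` of `G`: the element of `L²ₐ(G)` such that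
`⟨g, K⟩ = g(z₀)` for all `g ∈ L²ₐ(G)`. -/
structure IsBergmanKernel (G : Set ℂ) (z₀ : ℂ) (K : ℂ → ℂ) : Prop where
  holomorphic : DifferentiableOn ℂ K G
  memLp : MemLp K 2 (volume.restrict G)
  reproducing : ∀ g : ℂ → ℂ, DifferentiableOn ℂ g G → MemLp g 2 (volume.restrict G) →
    ∫ z in G, g z * (starRingEnd ℂ) (K z) = g z₀

/-- The family of germs `g t` (of `g t` at `γ t`) is an analytic continuation of `f` along the
path `γ`. -/
structure IsContinuationAlong (f : ℂ → ℂ) (γ : C(unitInterval, ℂ)) (g : unitInterval → ℂ → ℂ) :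
    Prop where
  start : g 0 =ᶠ[𝓝 (γ 0)] f
  analytic : ∀ t, AnalyticAt ℂ (g t) (γ t)
  compatible : ∀ t, ∀ᶠ s in 𝓝 t, g s =ᶠ[𝓝 (γ s)] g t

/-- `γ` is a path in `D` that starts in `G`. -/
def IsPathFrom (G D : Set ℂ) (γ : C(unitInterval, ℂ)) : Prop :=
  γ 0 ∈ G ∧ ∀ t, γ t ∈ D

/-- `φ` is a holomorphic branch of `(1 / (z - a)) ^ (k / m)` on `V`. -/
def IsPowerBranch (a : ℂ) (k m : ℕ) (φ : ℂ → ℂ) (V : Set ℂ) : Prop :=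
  DifferentiableOn ℂ φ V ∧ ∀ z ∈ V, φ z ^ m * (z - a) ^ k = 1

/-- The function `f`, continued analytically from `G` along the paths in `D`, has at `a` a singularity
of the form `(z - a) ^ (-k / m)`: on a punctured neighbourhood of `a`, every germ of the continuation
is a non-zero multiple of a branch of `(z - a) ^ (-k / m)` plus a function analytic at `a`. -/
def HasRationalPole (f : ℂ → ℂ) (G D : Set ℂ) (a : ℂ) (k m : ℕ) : Prop :=
  ∃ r : ℝ, 0 < r ∧ ∀ (γ : C(unitInterval, ℂ)) (g : unitInterval → ℂ → ℂ),
    IsPathFrom G D γ → IsContinuationAlong f γ g → γ 1 ∈ Metric.ball a r \ {a} →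
    ∃ c : ℂ, c ≠ 0 ∧ ∃ h : ℂ → ℂ, DifferentiableOn ℂ h (Metric.ball a r) ∧
      ∃ V ∈ 𝓝 (γ 1), ∃ φ : ℂ → ℂ, IsPowerBranch a k m φ V ∧
        ∀ z ∈ V, g 1 z = c * φ z + h z

/-- In the domain `U ⊇ G` the only singularities of (the analytic continuation of) `f` are
the points `z j`, and at `z j` it has a singularity of the form `(z - z j) ^ (-k j / m j)`. -/
structure HasOnlyRationalPoles (f : ℂ → ℂ) (G U : Set ℂ) {κ : ℕ} (z : Fin κ → ℂ)
    (k m : Fin κ → ℕ) : Prop where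
  continues : ∀ γ : C(unitInterval, ℂ), IsPathFrom G (U \ range z) γ →
    ∃ g, IsContinuationAlong f γ g
  poles : ∀ j, HasRationalPole f G (U \ range z) (z j) (k j) (m j)

/-- The augmented system (counted from `0`): the derivatives of the `κ` singular functions `φ j`,
followed by the derivatives of the monomials `z, z², z³, …`. -/
noncomputable def augmentedSystem {κ : ℕ} (φ : Fin κ → ℂ → ℂ) (i : ℕ) : ℂ → ℂ :=
  if h : i < κ then deriv (φ ⟨i, h⟩) else deriv (fun z : ℂ => z ^ (i - κ + 1))

/-- The inner product of `L²(G)` (linear in the first argument). -/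
noncomputable def areaInner (G : Set ℂ) (f g : ℂ → ℂ) : ℂ :=
  ∫ z in G, f z * (starRingEnd ℂ) (g z)

/-- The (not yet normalized) Gram-Schmidt process for a sequence of functions in `L²(G)`. -/
noncomputable def orthogonalized (G : Set ℂ) (η : ℕ → ℂ → ℂ) (j : ℕ) : ℂ → ℂ := fun z =>
  η j z - ∑ i : Fin j,
    areaInner G (η j) (orthogonalized G η i) /
      areaInner G (orthogonalized G η i) (orthogonalized G η i) * orthogonalized G η i z
termination_by j
decreasing_by all_goals exact i.2

/-- The orthonormal functions `P̃_j = ∑_{i ≤ j} b_{j,i} η_i`, `b_{j,j} > 0`, of the Gram-Schmidt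
process in `L²(G)`. -/
noncomputable def augmentedBergman (G : Set ℂ) (η : ℕ → ℂ → ℂ) (j : ℕ) : ℂ → ℂ := fun z =>
  orthogonalized G η j z /
    (Real.sqrt (areaInner G (orthogonalized G η j) (orthogonalized G η j)).re : ℂ)

/-- The augmented kernel polynomial `K̃_n(·, z₀)`, built from the `κ` singular functions and the
first `n` monomials. -/
noncomputable def augmentedKernel (G : Set ℂ) (z₀ : ℂ) {κ : ℕ} (φ : Fin κ → ℂ → ℂ) (n : ℕ) :
    ℂ → ℂ := fun z =>
  ∑ j ∈ Finset.range (κ + n),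
    (starRingEnd ℂ) (augmentedBergman G (augmentedSystem φ) j z₀) *
      augmentedBergman G (augmentedSystem φ) j z

/-!
The Bergman kernel of `G` is `K(·, z₀) = f₀' / (π r₀²)`
(`IsInteriorConformalMap.bergmanKernel_ae_eq`): after the substitution `w = f₀(z)` this is the area
mean value property on a disc. The augmented kernel polynomial is the orthogonal projection of
`K(·, z₀)` on the span of the first `κ + n` functions of the augmented system, hence the best
approximation in this span (`IsBergmanKernel.eLpNorm_sub_augmentedKernel_le`). It is therefore
enough to approximate `f₀'` on `G`, uniformly and with an error `O(R ^ (-n))`, by linear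
combinations of the derivatives of the singular functions `φ j` and of a polynomial of degree at
most `n`.

On `G` one has `f₀ = ∑ j, c j * φ j + h`, with constants `c j` and a function `h` that is
holomorphic in the whole domain `G_ϱ` (`HasOnlyRationalPoles.exists_decomposition`). The hypothesis
on `f₀` concerns germs of the continuation along paths only, and this continuation may be
multivalued around the poles. So the domain of `h` is enlarged along the domains `G_ρ`: once
`f₀ - ∑ j, c j * φ j` has been extended from `G` to `G_ρ`, it is continued across every point of
the boundary of `G_ρ`, hence to a larger `G_ρ'` by compactness (`exists_extension_filledDomain`). When
the level `ρ` reaches that of a pole `z j`, the coefficient `c j` is read off from a germ at `z j`.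
Each extension step needs that a boundary point of `G_ρ` is the end point of a path in `G_ρ` and
that `G_ρ` is connected near it (`IsAccessibleBoundaryPoint`). For `ρ > 1` the exterior map
provides this; for `ρ = 1` it follows from the local structure of the curve `∂G`, which near each
of its points consists of two arcs that bound two sectors, and here the exclusion of cusps is used
(`IsPiecewiseAnalyticJordanDomain.isAccessibleBoundaryPoint`).

The function `h` is approximated by the partial sums of its Faber series
(`IsExteriorInverse.exists_polynomial_approx`). With `ψ` the inverse of the exterior map, Cauchy's
integral over the level curve `|Φ| = R'` represents `h` by the kernel `ψ'(w) / (ψ(w) - z)`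
(`IsExteriorInverse.circleIntegral_eq`). The coefficients of this kernel in powers of `1 / w` are
polynomials in `z`, bounded by Cauchy's estimates, and the resulting error for `h` near `closure G`
gives that for `h'`.
-/

/-! ### Holomorphic inverses, gluing, and punctured domains -/

/-- An injective holomorphic function is open, has non-vanishing derivative, and its inverse is
holomorphic. The inverse is continuous by the open mapping theorem, hence holomorphic away from the
isolated critical values; these singularities are removable, and then the chain rule shows that
there are no critical points. -/
theorem Set.InjOn.exists_holomorphic_inverse {f : ℂ → ℂ} {U : Set ℂ} (hinj : InjOn f U)
    (hU : IsOpen U) (hf : DifferentiableOn ℂ f U) :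
    IsOpen (f '' U) ∧ (∀ z ∈ U, deriv f z ≠ 0) ∧
      ∃ g : ℂ → ℂ, DifferentiableOn ℂ g (f '' U) ∧ ∀ z ∈ U, g (f z) = z := by
  have hg : ∀ z ∈ U, Function.invFunOn f U (f z) = z := fun z hz => hinj.leftInvOn_invFunOn hz
  set g := Function.invFunOn f U
  have han : ∀ z ∈ U, AnalyticAt ℂ f z := fun z hz => hf.analyticAt (hU.mem_nhds hz)
  have hconst : ∀ z ∈ U, ¬ ∀ᶠ w in 𝓝 z, f w = f z := by
    intro z hz h
    have h1 : ∀ᶠ w in 𝓝 z, w = z := by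
      filter_upwards [h, hU.mem_nhds hz] with w hw hwU using hinj hwU hz hw
    have h2 : ∀ᶠ w in 𝓝[≠] z, w = z := h1.filter_mono nhdsWithin_le_nhds
    obtain ⟨w, hw, hw'⟩ := (h2.and self_mem_nhdsWithin).exists
    exact hw' hw
  have hle : ∀ z ∈ U, 𝓝 (f z) ≤ map f (𝓝 z) := fun z hz =>
    (han z hz).eventually_constant_or_nhds_le_map_nhds.resolve_left (hconst z hz)
  have himg : ∀ z ∈ U, f '' U ∈ 𝓝 (f z) := fun z hz =>
    hle z hz (image_mem_map (hU.mem_nhds hz))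
  have hopen : IsOpen (f '' U) := by
    rw [isOpen_iff_mem_nhds]
    rintro _ ⟨z, hz, rfl⟩
    exact himg z hz
  have hright : ∀ w ∈ f '' U, f (g w) = w := by
    rintro _ ⟨z, hz, rfl⟩
    rw [hg z hz]
  have hcont : ∀ z ∈ U, Tendsto g (𝓝 (f z)) (𝓝 z) := by
    intro z hz
    have h1 : Tendsto g (map f (𝓝 z)) (𝓝 z) := by
      rw [tendsto_map'_iff]
      refine tendsto_id.congr' ?_
      filter_upwards [hU.mem_nhds hz] with w hw using (hg w hw).symm
    exact h1.mono_left (hle z hz)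
  have hcontAt : ∀ z ∈ U, ContinuousAt g (f z) := by
    intro z hz
    rw [ContinuousAt, hg z hz]
    exact hcont z hz
  have hd : ∀ z ∈ U, deriv f z ≠ 0 → DifferentiableAt ℂ g (f z) := by
    intro z hz h0
    refine (HasDerivAt.of_local_left_inverse (f := f) (f' := deriv f z) (hcontAt z hz) ?_ h0
      ?_).differentiableAt
    · rw [hg z hz]
      exact (han z hz).differentiableAt.hasDerivAt
    · filter_upwards [himg z hz] with w hw using hright w hw
  have hgan : ∀ z ∈ U, AnalyticAt ℂ g (f z) := by
    intro z hz
    refine Complex.analyticAt_of_differentiable_on_punctured_nhds_of_continuousAt ?_ (hcontAt z hz)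
    have hcrit : ∀ᶠ w in 𝓝[≠] z, deriv f w ≠ 0 := by
      refine (han z hz).deriv.eventually_eq_zero_or_eventually_ne_zero.resolve_left fun h0 => ?_
      obtain ⟨r, hr, hball⟩ := Metric.eventually_nhds_iff_ball.1 (h0.and (hU.mem_nhds hz))
      refine hconst z hz ?_
      filter_upwards [Metric.ball_mem_nhds z hr] with w hw
      refine Metric.isOpen_ball.is_const_of_deriv_eq_zero Metric.isPreconnected_ball
        (fun x hx => (han x (hball x hx).2).differentiableAt.differentiableWithinAt)
        (fun x hx => (hball x hx).1) hw (Metric.mem_ball_self hr)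
    have ht : Tendsto g (𝓝[≠] (f z)) (𝓝[≠] z) := by
      refine tendsto_nhdsWithin_iff.2 ⟨(hcont z hz).mono_left nhdsWithin_le_nhds, ?_⟩
      filter_upwards [mem_nhdsWithin_of_mem_nhds (himg z hz), self_mem_nhdsWithin] with w hw hne h
      exact hne (by rw [← hright w hw, mem_singleton_iff.1 h]; rfl)
    filter_upwards [ht.eventually hcrit, mem_nhdsWithin_of_mem_nhds (himg z hz)] with w hw hwU
    obtain ⟨x, hx, rfl⟩ := hwU
    rw [hg x hx] at hw
    exact hd x hx hw
  refine ⟨hopen, ?_, g, ?_, hg⟩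
  · intro z hz h0
    have h1 : HasDerivAt (g ∘ f) (deriv g (f z) * deriv f z) z :=
      (hgan z hz).differentiableAt.hasDerivAt.comp z (han z hz).differentiableAt.hasDerivAt
    have h2 : HasDerivAt (g ∘ f) 1 z := by
      refine (hasDerivAt_id z).congr_of_eventuallyEq ?_
      filter_upwards [hU.mem_nhds hz] with w hw using hg w hw
    have h3 := h1.unique h2
    rw [h0, mul_zero] at h3
    exact zero_ne_one h3
  · rintro _ ⟨z, hz, rfl⟩
    exact (hgan z hz).differentiableAt.differentiableWithinAt

/-- On a neighbourhood of `p`, the function `h` on `S` is the restriction of a holomorphic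
function. -/
def LocallyExtends (S : Set ℂ) (h : ℂ → ℂ) (p : ℂ) : Prop :=
  ∃ ε : ℝ, 0 < ε ∧ ∃ e : ℂ → ℂ, DifferentiableOn ℂ e (Metric.ball p ε) ∧
    EqOn e h (S ∩ Metric.ball p ε)

/-- Local holomorphic extensions across the points of a set `T` of boundary points glue, without any
assumption on `S`: shrinking the balls to a third makes one of any two centers lie in the ball
around the other as soon as the shrunken balls meet, so that the intersection of the two original
balls is a convex set that meets `S`. -/
theorem exists_extension_of_locallyExtends {S T : Set ℂ} (hS : IsOpen S) {h : ℂ → ℂ}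
    (hh : DifferentiableOn ℂ h S) (hT : T ⊆ closure S) (hloc : ∀ p ∈ T, LocallyExtends S h p) :
    ∃ (W : Set ℂ) (F : ℂ → ℂ), IsOpen W ∧ S ⊆ W ∧ T ⊆ W ∧ DifferentiableOn ℂ F W ∧ EqOn F h S := by
  classical
  choose! ε hε e he heq using hloc
  have key : ∀ p ∈ T, ∀ q ∈ T, ∀ w ∈ Metric.ball p (ε p / 3), w ∈ Metric.ball q (ε q / 3) →
      e p w = e q w := by
    have main : ∀ p ∈ T, ∀ q ∈ T, ε q ≤ ε p → ∀ w ∈ Metric.ball p (ε p / 3),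
        w ∈ Metric.ball q (ε q / 3) → e p w = e q w := by
      intro p hp q hq hle w hwp hwq
      have hp0 := hε p hp
      have hq0 := hε q hq
      rw [Metric.mem_ball] at hwp hwq
      have hqp : q ∈ Metric.ball p (ε p) := by
        rw [Metric.mem_ball]
        have := dist_triangle_left q p w
        linarith
      set V := Metric.ball p (ε p) ∩ Metric.ball q (ε q)
      have hVo : IsOpen V := Metric.isOpen_ball.inter Metric.isOpen_ball
      have hqV : q ∈ V := ⟨hqp, Metric.mem_ball_self hq0⟩
      obtain ⟨x, hxV, hxS⟩ := mem_closure_iff.1 (hT hq) V hVo hqV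
      have hVc : IsPreconnected V :=
        ((convex_ball p (ε p)).inter (convex_ball q (ε q))).isPreconnected
      have h1 : AnalyticOnNhd ℂ (e p) V :=
        ((he p hp).mono inter_subset_left).analyticOnNhd hVo
      have h2 : AnalyticOnNhd ℂ (e q) V :=
        ((he q hq).mono inter_subset_right).analyticOnNhd hVo
      refine h1.eqOn_of_preconnected_of_eventuallyEq h2 hVc hxV ?_ ⟨?_, ?_⟩
      · filter_upwards [hVo.mem_nhds hxV, hS.mem_nhds hxS] with y hyV hyS
        rw [heq p hp ⟨hyS, hyV.1⟩, heq q hq ⟨hyS, hyV.2⟩]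
      · rw [Metric.mem_ball]; linarith
      · rw [Metric.mem_ball]; linarith
    intro p hp q hq w hwp hwq
    rcases le_total (ε q) (ε p) with hle | hle
    · exact main p hp q hq hle w hwp hwq
    · exact (main q hq p hp hle w hwq hwp).symm
  let F : ℂ → ℂ := fun w => if w ∈ S then h w else
    if hw : ∃ p ∈ T, w ∈ Metric.ball p (ε p / 3) then e hw.choose w else 0
  have hFS : EqOn F h S := fun w hw => if_pos hw
  have hFT : ∀ p ∈ T, EqOn F (e p) (Metric.ball p (ε p / 3)) := by
    intro p hp w hw
    have hp0 := hε p hp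
    by_cases hwS : w ∈ S
    · rw [hFS hwS, heq p hp ⟨hwS, Metric.ball_subset_ball (by linarith) hw⟩]
    · have hex : ∃ p ∈ T, w ∈ Metric.ball p (ε p / 3) := ⟨p, hp, hw⟩
      have : F w = e hex.choose w := by simp only [F, if_neg hwS, dif_pos hex]
      rw [this]
      exact key _ hex.choose_spec.1 p hp w hex.choose_spec.2 hw
  refine ⟨S ∪ ⋃ p ∈ T, Metric.ball p (ε p / 3), F,
    hS.union (isOpen_biUnion fun p _ => Metric.isOpen_ball), subset_union_left, ?_, ?_, hFS⟩
  · intro p hp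
    exact Or.inr (mem_biUnion hp (Metric.mem_ball_self (by have := hε p hp; linarith)))
  · rintro w (hw | hw)
    · have h1 : F =ᶠ[𝓝 w] h := hFS.eventuallyEq_of_mem (hS.mem_nhds hw)
      exact ((hh.differentiableAt (hS.mem_nhds hw)).congr_of_eventuallyEq h1).differentiableWithinAt
    · obtain ⟨p, hp, hw⟩ := mem_iUnion₂.1 hw
      have hp0 := hε p hp
      have h1 : F =ᶠ[𝓝 w] e p :=
        (hFT p hp).eventuallyEq_of_mem (Metric.isOpen_ball.mem_nhds hw)
      have h2 : DifferentiableAt ℂ (e p) w := (he p hp).differentiableAt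
        (Metric.isOpen_ball.mem_nhds (Metric.ball_subset_ball (by linarith) hw))
      exact (h2.congr_of_eventuallyEq h1).differentiableWithinAt

theorem isPreconnected_ball_diff_center (a : ℂ) (r : ℝ) :
    IsPreconnected (Metric.ball a r \ {a}) := by
  rcases le_or_gt r 0 with hr | hr
  · simp [Metric.ball_eq_empty.2 hr, isPreconnected_empty]
  have h1 : IsPreconnected {w : ℂ | w.re < Real.log r} :=
    (convex_halfSpace_re_lt _).isPreconnected
  have h2 := h1.image (fun w => a + Complex.exp w) (by fun_prop)
  convert h2 using 1
  ext z
  simp only [Set.mem_sdiff, Metric.mem_ball, mem_singleton_iff, mem_image, mem_ofPred_eq]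
  constructor
  · rintro ⟨hz, hza⟩
    have hne : z - a ≠ 0 := sub_ne_zero.2 hza
    refine ⟨Complex.log (z - a), ?_, ?_⟩
    · rw [Complex.log_re]
      exact Real.log_lt_log (norm_pos_iff.2 hne) (by rwa [← dist_eq_norm])
    · rw [Complex.exp_log hne]; ring
  · rintro ⟨w, hw, rfl⟩
    refine ⟨?_, ?_⟩
    · rw [dist_eq_norm, add_sub_cancel_left, Complex.norm_exp]
      calc Real.exp w.re < Real.exp (Real.log r) := Real.exp_lt_exp.2 hw
        _ = r := Real.exp_log hr
    · simp [Complex.exp_ne_zero]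

theorem IsPreconnected.diff_singleton_of_isOpen {S : Set ℂ} (hc : IsPreconnected S)
    (hS : IsOpen S) (a : ℂ) : IsPreconnected (S \ {a}) := by
  by_cases ha : a ∈ S
  swap
  · rwa [sdiff_singleton_eq_self ha]
  obtain ⟨r, hr, hball⟩ := Metric.isOpen_iff.1 hS a ha
  rw [isPreconnected_iff_subset_of_disjoint]
  have main : ∀ u v : Set ℂ, IsOpen u → IsOpen v → S \ {a} ⊆ u ∪ v → S \ {a} ∩ (u ∩ v) = ∅ →
      Metric.ball a r \ {a} ⊆ u → S \ {a} ⊆ u := by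
    intro u v hu hv hsub hdisj hbu
    have hd : ∀ x ∈ S, x ≠ a → x ∈ u → x ∉ v := fun x hx hxa hxu hxv =>
      (hdisj ▸ (⟨⟨hx, hxa⟩, hxu, hxv⟩ : x ∈ S \ {a} ∩ (u ∩ v)) : x ∈ (∅ : Set ℂ))
    have h1 := isPreconnected_iff_subset_of_disjoint.1 hc ((S ∩ u) ∪ Metric.ball a r)
      (v \ {a}) ((hS.inter hu).union Metric.isOpen_ball) (hv.sdiff isClosed_singleton) ?_ ?_
    · rcases h1 with h1 | h1
      · rintro x ⟨hx, hxa⟩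
        rcases h1 hx with h | h
        · exact h.2
        · exact hbu ⟨h, hxa⟩
      · exact absurd rfl (h1 ha).2
    · intro x hx
      by_cases hxa : x = a
      · left; right; rw [hxa]; exact Metric.mem_ball_self hr
      · rcases hsub ⟨hx, hxa⟩ with h | h
        · exact Or.inl (Or.inl ⟨hx, h⟩)
        · exact Or.inr ⟨h, hxa⟩
    · rw [eq_empty_iff_forall_notMem]
      rintro x ⟨hx, h, hxv, hxa⟩
      rcases h with h | h
      · exact hd x hx hxa h.2 hxv
      · exact hd x hx hxa (hbu ⟨h, hxa⟩) hxv
  intro u v hu hv hsub hdisj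
  rcases isPreconnected_iff_subset_of_disjoint.1 (isPreconnected_ball_diff_center a r) u v hu hv
    ((sdiff_subset_sdiff_left hball).trans hsub)
    (subset_empty_iff.1 (hdisj ▸ inter_subset_inter_left _ (sdiff_subset_sdiff_left hball)))
    with h | h
  · exact Or.inl (main u v hu hv hsub hdisj h)
  · exact Or.inr (main v u hv hu (by rwa [union_comm]) (by rwa [inter_comm v u]) h)

theorem IsPreconnected.diff_finite_of_isOpen {S F : Set ℂ} (hc : IsPreconnected S)
    (hS : IsOpen S) (hF : F.Finite) : IsPreconnected (S \ F) := by
  induction F, hF using Set.Finite.induction_on with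
  | empty => simpa using hc
  | @insert a s _ hs ih =>
    have : S \ insert a s = (S \ s) \ {a} := by
      ext x; simp only [Set.mem_sdiff, mem_insert_iff, mem_singleton_iff]; tauto
    rw [this]
    exact ih.diff_singleton_of_isOpen (hS.sdiff hs.isClosed) a

/-! ### The exterior conformal map and the domains bounded by its level curves -/

/-- `ψ : {|w| > 1} → ℂ \ closure G` is the holomorphic inverse of the exterior map `Φ`; both maps
tend to `∞` at `∞`, where `ψ(w) / w` has a finite non-zero limit. -/
structure IsExteriorInverse (G : Set ℂ) (Φ ψ : ℂ → ℂ) : Prop where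
  differentiableOn_map : DifferentiableOn ℂ Φ (closure G)ᶜ
  one_lt_norm : ∀ z ∉ closure G, 1 < ‖Φ z‖
  differentiableOn : DifferentiableOn ℂ ψ {w | 1 < ‖w‖}
  notMem : ∀ w, 1 < ‖w‖ → ψ w ∉ closure G
  left_inv : ∀ z ∉ closure G, ψ (Φ z) = z
  right_inv : ∀ w, 1 < ‖w‖ → Φ (ψ w) = w
  deriv_ne_zero : ∀ w, 1 < ‖w‖ → deriv ψ w ≠ 0
  tendsto_map : Tendsto Φ (Bornology.cobounded ℂ) (Bornology.cobounded ℂ)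
  tendsto : Tendsto ψ (Bornology.cobounded ℂ) (Bornology.cobounded ℂ)
  tendsto_div : ∃ β : ℂ, β ≠ 0 ∧ Tendsto (fun w => ψ w / w) (Bornology.cobounded ℂ) (𝓝 β)

theorem isOpen_one_lt_norm : IsOpen {w : ℂ | 1 < ‖w‖} := isOpen_lt continuous_const continuous_norm

theorem eventually_cobounded_iff_norm {P : ℂ → Prop} :
    (∀ᶠ z in Bornology.cobounded ℂ, P z) ↔ ∃ M : ℝ, 0 < M ∧ ∀ z : ℂ, M < ‖z‖ → P z := by
  rw [← comap_norm_atTop, eventually_comap]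
  constructor
  · intro h
    obtain ⟨M, hM⟩ := eventually_atTop.1 h
    exact ⟨max M 1, by positivity, fun z hz => hM ‖z‖ ((le_max_left _ _).trans hz.le) z rfl⟩
  · rintro ⟨M, -, hM⟩
    filter_upwards [eventually_gt_atTop M] with x hx z hz
    exact hM z (hz ▸ hx)

/-- The inverse of the exterior map tends to `∞` at `∞`: in the coordinate `1 / z` the map `Φ` is
holomorphic with non-zero derivative at the point corresponding to `∞`, hence open there. -/
theorem IsExteriorConformalMap.tendsto_inverse {G : Set ℂ} {Φ ψ : ℂ → ℂ}
    (hGb : Bornology.IsBounded G) (hΦ : IsExteriorConformalMap G Φ)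
    (hψ : ∀ z ∉ closure G, ψ (Φ z) = z) :
    Tendsto ψ (Bornology.cobounded ℂ) (Bornology.cobounded ℂ) := by
  obtain ⟨γ, hγ, hlim⟩ := hΦ.normalized
  have hγ' : (γ : ℂ) ≠ 0 := by exact_mod_cast hγ.ne'
  obtain ⟨M₀, hM₀⟩ := hGb.closure.subset_closedBall 0
  have hext : ∀ z : ℂ, M₀ < ‖z‖ → z ∉ closure G := fun z hz h => by
    have := hM₀ h
    rw [mem_closedBall_zero_iff] at this
    linarith
  obtain ⟨M₁, hM₁pos, hM₁⟩ := eventually_cobounded_iff_norm.1 (hlim.eventually_ne hγ')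
  let F : ℂ → ℂ := fun u => (Φ u⁻¹)⁻¹
  -- the value at `0` is not determined by `Φ`, so it is set by hand
  let F₀ : ℂ → ℂ := Function.update F 0 0
  have hF₀ : ∀ u, u ≠ 0 → F₀ u = F u := fun u hu => Function.update_of_ne hu _ _
  have hF₀0 : F₀ 0 = 0 := Function.update_self _ _ _
  have hinv : Tendsto (fun u : ℂ => u⁻¹) (𝓝[≠] 0) (Bornology.cobounded ℂ) :=
    tendsto_inv₀_nhdsNE_zero
  have hder : HasDerivAt F₀ ((γ : ℂ)⁻¹) 0 := by
    rw [hasDerivAt_iff_tendsto_slope]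
    have h1 : Tendsto (fun u : ℂ => (Φ u⁻¹ / u⁻¹)⁻¹) (𝓝[≠] 0) (𝓝 (γ : ℂ)⁻¹) :=
      (hlim.comp hinv).inv₀ hγ'
    refine h1.congr' ?_
    filter_upwards [self_mem_nhdsWithin] with u hu
    have hu : u ≠ 0 := hu
    rw [slope_def_field, hF₀ u hu, hF₀0]
    simp only [F, sub_zero]
    field_simp
  have hdiff : ∀ᶠ u in 𝓝[≠] (0 : ℂ), DifferentiableAt ℂ F₀ u := by
    have hlarge : ∀ᶠ z in Bornology.cobounded ℂ, max M₀ M₁ < ‖z‖ :=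
      eventually_cobounded_iff_norm.2 ⟨max M₀ M₁, lt_max_of_lt_right hM₁pos, fun z hz => hz⟩
    filter_upwards [hinv.eventually hlarge, self_mem_nhdsWithin] with u hu hne
    have hne : u ≠ 0 := hne
    have h1 : DifferentiableAt ℂ Φ u⁻¹ := hΦ.holomorphic.differentiableAt
      (isClosed_closure.isOpen_compl.mem_nhds (hext _ ((le_max_left _ _).trans_lt hu)))
    have h0 : Φ u⁻¹ ≠ 0 := fun h => hM₁ _ ((le_max_right _ _).trans_lt hu) (by rw [h, zero_div])
    have h2 : DifferentiableAt ℂ F u :=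
      (h1.comp u (differentiableAt_inv hne)).inv h0
    refine h2.congr_of_eventuallyEq ?_
    filter_upwards [isOpen_ne.mem_nhds hne] with v hv using hF₀ v hv
  have han : AnalyticAt ℂ F₀ 0 :=
    Complex.analyticAt_of_differentiable_on_punctured_nhds_of_continuousAt
    hdiff hder.continuousAt
  have hle : 𝓝 (F₀ 0) ≤ map F₀ (𝓝 0) := by
    refine han.eventually_constant_or_nhds_le_map_nhds.resolve_left fun h => ?_
    have h1 : HasDerivAt F₀ 0 0 := (hasDerivAt_const (0 : ℂ) (F₀ 0)).congr_of_eventuallyEq h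
    exact inv_ne_zero hγ' (hder.unique h1)
  rw [Filter.tendsto_def]
  intro s hs
  obtain ⟨M, hM, hMs⟩ := eventually_cobounded_iff_norm.1 hs
  let M' := max M (max M₀ 1)
  have hM' : 0 < M' := lt_max_of_lt_left hM
  have hnear : F₀ '' Metric.ball 0 M'⁻¹ ∈ 𝓝 (0 : ℂ) := by
    have := hle (image_mem_map (Metric.ball_mem_nhds 0 (inv_pos.2 hM')))
    rwa [hF₀0] at this
  have hpre : ∀ᶠ w in Bornology.cobounded ℂ, w⁻¹ ∈ F₀ '' Metric.ball 0 M'⁻¹ :=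
    (tendsto_inv₀_cobounded (α := ℂ)).eventually hnear
  have hne : ∀ᶠ w in Bornology.cobounded ℂ, w ≠ 0 :=
    eventually_cobounded_iff_norm.2 ⟨1, one_pos, fun z hz h => by simp [h] at hz; linarith⟩
  filter_upwards [hpre, hne] with w hw hw0
  obtain ⟨u, hu, huw⟩ := hw
  have hu0 : u ≠ 0 := by
    rintro rfl
    rw [hF₀0] at huw
    exact inv_ne_zero hw0 huw.symm
  rw [hF₀ u hu0] at huw
  have hΦu : Φ u⁻¹ = w := inv_injective huw
  have hnorm : M' < ‖u⁻¹‖ := by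
    rw [mem_ball_zero_iff] at hu
    rw [norm_inv]
    exact (lt_inv_comm₀ (norm_pos_iff.2 hu0) hM').1 hu
  have hψw : ψ w = u⁻¹ := by
    rw [← hΦu]
    exact hψ _ (hext _ (((le_max_left _ _).trans (le_max_right _ _)).trans_lt hnorm))
  rw [mem_preimage, hψw]
  exact hMs _ ((le_max_left _ _).trans_lt hnorm)

theorem IsExteriorConformalMap.exists_inverse {G : Set ℂ} {Φ : ℂ → ℂ}
    (hGb : Bornology.IsBounded G) (hΦ : IsExteriorConformalMap G Φ) :
    ∃ ψ : ℂ → ℂ, IsExteriorInverse G Φ ψ := by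
  have hΩ : IsOpen (closure G)ᶜ := isClosed_closure.isOpen_compl
  obtain ⟨-, -, ψ, hψd, hψ⟩ := hΦ.bijective.injOn.exists_holomorphic_inverse hΩ hΦ.holomorphic
  rw [hΦ.bijective.image_eq] at hψd
  have hsurj : ∀ w : ℂ, 1 < ‖w‖ → ∃ z ∉ closure G, Φ z = w := fun w hw =>
    hΦ.bijective.surjOn hw
  have hright : ∀ w : ℂ, 1 < ‖w‖ → Φ (ψ w) = w := by
    intro w hw
    obtain ⟨z, hz, rfl⟩ := hsurj w hw
    rw [hψ z hz]
  have hinj : InjOn ψ {w | 1 < ‖w‖} := fun a ha b hb h => by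
    rw [← hright a ha, h, hright b hb]
  have hψt := hΦ.tendsto_inverse hGb hψ
  obtain ⟨γ, hγ, hlim⟩ := hΦ.normalized
  have hγ' : (γ : ℂ) ≠ 0 := by exact_mod_cast hγ.ne'
  refine ⟨ψ, hΦ.holomorphic, fun z hz => hΦ.bijective.mapsTo hz, hψd, ?_, hψ, hright,
    (hinj.exists_holomorphic_inverse isOpen_one_lt_norm hψd).2.1, ?_, hψt, (γ : ℂ)⁻¹,
    inv_ne_zero hγ', ?_⟩
  · intro w hw
    obtain ⟨z, hz, rfl⟩ := hsurj w hw
    rwa [hψ z hz]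
  · rw [← tendsto_norm_atTop_iff_cobounded]
    have h1 : Tendsto (fun z : ℂ => ‖Φ z / z‖ * ‖z‖) (Bornology.cobounded ℂ) atTop :=
      Tendsto.pos_mul_atTop (norm_pos_iff.2 hγ') hlim.norm tendsto_norm_cobounded_atTop
    refine h1.congr' ?_
    refine eventually_cobounded_iff_norm.2 ⟨1, one_pos, fun z hz => ?_⟩
    have hz0 : ‖z‖ ≠ 0 := by linarith
    simp only [norm_div, div_mul_cancel₀ _ hz0]
  · have h1 : Tendsto (fun w => (Φ (ψ w) / ψ w)⁻¹) (Bornology.cobounded ℂ) (𝓝 (γ : ℂ)⁻¹) :=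
      (hlim.comp hψt).inv₀ hγ'
    refine h1.congr' (eventually_cobounded_iff_norm.2 ⟨1, one_pos, fun w hw => ?_⟩)
    rw [hright w hw, inv_div]

/-- The domains `G` (for `ρ ≤ 1`) and `G_ρ` (for `ρ > 1`). -/
noncomputable def filledDomain (G : Set ℂ) (Φ : ℂ → ℂ) (ρ : ℝ) : Set ℂ :=
  open Classical in if ρ ≤ 1 then G else levelInterior G Φ ρ

/-- The compact set bounded by the level curve `|Φ| = ρ`, which for `ρ = 1` is `closure G`. -/
def filledCompact (G : Set ℂ) (Φ : ℂ → ℂ) (ρ : ℝ) : Set ℂ :=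
  closure G ∪ {z : ℂ | z ∉ closure G ∧ ‖Φ z‖ ≤ ρ}

/-- The part of `S` near the point `p` outside `S` is arbitrarily small and connected, and `p` is
the end point of paths in `S`. -/
structure IsAccessibleBoundaryPoint (S : Set ℂ) (p : ℂ) : Prop where
  notMem : p ∉ S
  exists_nhds : ∀ δ > 0, ∃ N ∈ 𝓝 p, N ⊆ Metric.ball p δ ∧ IsPreconnected (N ∩ S)
  exists_path : ∀ δ > 0, ∃ (q : ℂ) (γ : Path q p), ∀ t, t ≠ 1 → γ t ∈ S ∩ Metric.ball p δ

theorem IsAccessibleBoundaryPoint.mem_closure {S : Set ℂ} {p : ℂ}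
    (h : IsAccessibleBoundaryPoint S p) : p ∈ closure S := by
  rw [Metric.mem_closure_iff]
  intro δ hδ
  obtain ⟨q, γ, hγ⟩ := h.exists_path δ hδ
  have := hγ 0 (by simp)
  exact ⟨γ 0, this.1, by rw [dist_comm]; exact this.2⟩

section

variable {G : Set ℂ} {Φ ψ : ℂ → ℂ}

theorem filledDomain_of_le {ρ : ℝ} (h : ρ ≤ 1) : filledDomain G Φ ρ = G := if_pos h

theorem filledDomain_of_one_lt {ρ : ℝ} (h : 1 < ρ) :
    filledDomain G Φ ρ = levelInterior G Φ ρ := if_neg h.not_ge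

theorem mem_filledDomain_of_one_lt {ρ : ℝ} (h : 1 < ρ) {z : ℂ} :
    z ∈ filledDomain G Φ ρ ↔ z ∈ closure G ∨ (z ∉ closure G ∧ ‖Φ z‖ < ρ) := by
  rw [filledDomain_of_one_lt h]; rfl

theorem subset_filledDomain (ρ : ℝ) : G ⊆ filledDomain G Φ ρ := by
  rcases le_or_gt ρ 1 with h | h
  · rw [filledDomain_of_le h]
  · exact fun z hz => (mem_filledDomain_of_one_lt h).2 (Or.inl (subset_closure hz))

theorem filledDomain_mono {ρ ρ' : ℝ} (h : ρ ≤ ρ') :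
    filledDomain G Φ ρ ⊆ filledDomain G Φ ρ' := by
  rcases le_or_gt ρ 1 with h1 | h1
  · rw [filledDomain_of_le h1]; exact subset_filledDomain ρ'
  · intro z hz
    rw [mem_filledDomain_of_one_lt (h1.trans_le h)]
    rcases (mem_filledDomain_of_one_lt h1).1 hz with hz | hz
    · exact Or.inl hz
    · exact Or.inr ⟨hz.1, hz.2.trans_le h⟩

theorem exists_mem_filledDomain_lt {ρ : ℝ} (h : 1 < ρ) {z : ℂ} (hz : z ∈ filledDomain G Φ ρ) :
    ∃ ρ' < ρ, 1 < ρ' ∧ z ∈ filledDomain G Φ ρ' := by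
  rcases (mem_filledDomain_of_one_lt h).1 hz with hz | hz
  · obtain ⟨ρ', h1, h2⟩ := exists_between h
    exact ⟨ρ', h2, h1, (mem_filledDomain_of_one_lt h1).2 (Or.inl hz)⟩
  · obtain ⟨ρ', h1, h2⟩ := exists_between (max_lt h hz.2)
    refine ⟨ρ', h2, (le_max_left _ _).trans_lt h1, ?_⟩
    exact (mem_filledDomain_of_one_lt ((le_max_left _ _).trans_lt h1)).2
      (Or.inr ⟨hz.1, (le_max_right _ _).trans_lt h1⟩)

namespace IsExteriorInverse

theorem isOpen_levelInterior (h : IsExteriorInverse G Φ ψ) {ρ : ℝ} (hρ : 1 < ρ) :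
    IsOpen (levelInterior G Φ ρ) := by
  rw [isOpen_iff_mem_nhds]
  have hΩ : IsOpen (closure G)ᶜ := isClosed_closure.isOpen_compl
  intro z hz
  by_cases hzG : z ∈ closure G
  · obtain ⟨M, -, hM⟩ := eventually_cobounded_iff_norm.1
      (h.tendsto.eventually (eventually_cobounded_iff_norm.2
        ⟨‖z‖ + 1, by positivity, fun w hw => hw⟩))
    -- a compact part of the exterior that contains every point near `z` missing from `G_ρ`
    let C := ψ '' (Metric.closedBall 0 M \ Metric.ball 0 ρ)
    have hC : IsCompact C := by
      refine ((isCompact_closedBall 0 M).diff Metric.isOpen_ball).image_of_continuousOn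
        (h.differentiableOn.continuousOn.mono ?_)
      intro w hw
      have : ρ ≤ ‖w‖ := by simpa using hw.2
      exact hρ.trans_le this
    have hzC : z ∉ C := by
      rintro ⟨w, hw, rfl⟩
      have : ρ ≤ ‖w‖ := by simpa using hw.2
      exact h.notMem w (hρ.trans_le this) hzG
    filter_upwards [hC.isClosed.isOpen_compl.mem_nhds hzC, Metric.ball_mem_nhds z one_pos]
      with x hxC hx
    by_contra hxL
    have hxG : x ∉ closure G := fun hxG => hxL (Or.inl hxG)
    have hxρ : ρ ≤ ‖Φ x‖ := not_lt.1 fun hlt => hxL (Or.inr ⟨hxG, hlt⟩)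
    refine hxC ⟨Φ x, ⟨?_, by simpa using hxρ⟩, h.left_inv x hxG⟩
    rw [mem_closedBall_zero_iff]
    by_contra hlt
    have h1 := hM (Φ x) (not_le.1 hlt)
    rw [h.left_inv x hxG] at h1
    rw [Metric.mem_ball, dist_eq_norm] at hx
    have := norm_sub_norm_le x z
    linarith
  · have hzρ : ‖Φ z‖ < ρ := hz.elim (fun h => absurd h hzG) fun h => h.2
    have hc : ContinuousAt Φ z :=
      (h.differentiableOn_map.differentiableAt (hΩ.mem_nhds hzG)).continuousAt
    filter_upwards [hΩ.mem_nhds hzG, hc.norm.eventually_lt continuousAt_const hzρ] with x hx hx'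
    exact Or.inr ⟨hx, hx'⟩

theorem isOpen_filledDomain (h : IsExteriorInverse G Φ ψ) (hG : IsOpen G) (ρ : ℝ) :
    IsOpen (filledDomain G Φ ρ) := by
  rcases le_or_gt ρ 1 with h1 | h1
  · rwa [filledDomain_of_le h1]
  · rw [filledDomain_of_one_lt h1]; exact h.isOpen_levelInterior h1

theorem isCompact_filledCompact (h : IsExteriorInverse G Φ ψ) (hGb : Bornology.IsBounded G)
    (ρ : ℝ) : IsCompact (filledCompact G Φ ρ) := by
  have hΩ : IsOpen (closure G)ᶜ := isClosed_closure.isOpen_compl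
  refine Metric.isCompact_of_isClosed_isBounded ?_ ?_
  · rw [← isOpen_compl_iff]
    have : (filledCompact G Φ ρ)ᶜ = (closure G)ᶜ ∩ Φ ⁻¹' {w | ρ < ‖w‖} := by
      ext z
      simp only [filledCompact, mem_compl_iff, mem_union, mem_inter_iff, mem_preimage,
        mem_ofPred_eq, not_or, not_and, not_le]
      tauto
    rw [this]
    exact h.differentiableOn_map.continuousOn.isOpen_inter_preimage hΩ
      (isOpen_lt continuous_const continuous_norm)
  · obtain ⟨M, -, hM⟩ := eventually_cobounded_iff_norm.1
      (h.tendsto_map.eventually (eventually_cobounded_iff_norm.2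
        ⟨max ρ 1, by positivity, fun w hw => hw⟩))
    refine hGb.closure.union ((Metric.isBounded_closedBall (x := (0 : ℂ)) (r := M)).subset ?_)
    rintro z ⟨-, hz⟩
    rw [mem_closedBall_zero_iff]
    by_contra hlt
    have := hM z (not_le.1 hlt)
    have := le_max_left ρ 1
    linarith

theorem filledDomain_subset_filledCompact (ρ : ℝ) :
    filledDomain G Φ ρ ⊆ filledCompact G Φ ρ := by
  rcases le_or_gt ρ 1 with h1 | h1
  · rw [filledDomain_of_le h1]; exact subset_closure.trans subset_union_left
  · intro z hz
    rcases (mem_filledDomain_of_one_lt h1).1 hz with hz | hz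
    · exact Or.inl hz
    · exact Or.inr ⟨hz.1, hz.2.le⟩

theorem exists_filledDomain_subset (h : IsExteriorInverse G Φ ψ) (hGb : Bornology.IsBounded G)
    {ρ : ℝ} (hρ : 1 ≤ ρ) {W : Set ℂ} (hW : IsOpen W) (hsub : filledCompact G Φ ρ ⊆ W) :
    ∃ ρ' > ρ, filledDomain G Φ ρ' ⊆ W := by
  have hK : IsCompact (filledCompact G Φ (ρ + 1) \ W) := (h.isCompact_filledCompact hGb _).diff hW
  have hKΩ : filledCompact G Φ (ρ + 1) \ W ⊆ (closure G)ᶜ :=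
    fun z hz hzG => hz.2 (hsub (Or.inl hzG))
  rcases (filledCompact G Φ (ρ + 1) \ W).eq_empty_or_nonempty with he | hne
  · exact ⟨ρ + 1, by linarith,
      (filledDomain_subset_filledCompact _).trans (sdiff_eq_empty.1 he)⟩
  · obtain ⟨x, hx, hmin⟩ := hK.exists_isMinOn hne
      (h.differentiableOn_map.continuousOn.mono hKΩ).norm
    have hxρ : ρ < ‖Φ x‖ := by
      by_contra hle
      exact hx.2 (hsub (Or.inr ⟨hKΩ hx, not_lt.1 hle⟩))
    have hm : ρ < min ‖Φ x‖ (ρ + 1) := lt_min hxρ (by linarith)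
    refine ⟨min ‖Φ x‖ (ρ + 1), hm, fun z hz => ?_⟩
    rcases (mem_filledDomain_of_one_lt (hρ.trans_lt hm)).1 hz with hz | hz
    · exact hsub (Or.inl hz)
    · by_contra hzW
      have h1 : ‖Φ x‖ ≤ ‖Φ z‖ :=
        hmin (⟨Or.inr ⟨hz.1, hz.2.le.trans (min_le_right _ _)⟩, hzW⟩ : z ∈ _ \ W)
      have := hz.2.trans_le (min_le_left _ _)
      linarith

theorem isAccessibleBoundaryPoint (h : IsExteriorInverse G Φ ψ) {ρ : ℝ} (hρ : 1 < ρ) {p : ℂ}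
    (hpG : p ∉ closure G) (hp : ‖Φ p‖ = ρ) :
    IsAccessibleBoundaryPoint (filledDomain G Φ ρ) p := by
  have hΩ : IsOpen (closure G)ᶜ := isClosed_closure.isOpen_compl
  have hw : 1 < ‖Φ p‖ := hp ▸ hρ
  have hψc : ContinuousAt ψ (Φ p) :=
    (h.differentiableOn.differentiableAt (isOpen_one_lt_norm.mem_nhds hw)).continuousAt
  have hsmall : ∀ δ > 0, ∃ ε > 0, Metric.ball (Φ p) ε ⊆ {w | 1 < ‖w‖} ∧
      ∀ w ∈ Metric.ball (Φ p) ε, ψ w ∈ Metric.ball p δ := by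
    intro δ hδ
    have h1 : ∀ᶠ w in 𝓝 (Φ p), ψ w ∈ Metric.ball p δ := by
      refine hψc.eventually ?_
      rw [h.left_inv p hpG]
      exact Metric.ball_mem_nhds p hδ
    obtain ⟨ε, hε, hb⟩ := Metric.eventually_nhds_iff_ball.1
      (h1.and (isOpen_one_lt_norm.mem_nhds hw))
    exact ⟨ε, hε, fun w hw => (hb w hw).2, fun w hw => (hb w hw).1⟩
  refine ⟨?_, ?_, ?_⟩
  · rw [mem_filledDomain_of_one_lt hρ]
    rintro (h1 | h1)
    · exact hpG h1
    · exact h1.2.ne hp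
  · intro δ hδ
    obtain ⟨ε, hε, hb1, hb2⟩ := hsmall δ hδ
    refine ⟨(closure G)ᶜ ∩ Φ ⁻¹' Metric.ball (Φ p) ε,
      (h.differentiableOn_map.continuousOn.isOpen_inter_preimage hΩ Metric.isOpen_ball).mem_nhds
        ⟨hpG, Metric.mem_ball_self hε⟩, ?_, ?_⟩
    · rintro z ⟨hz, hzb⟩
      rw [← h.left_inv z hz]
      exact hb2 _ hzb
    · have h1 : IsPreconnected (ψ '' (Metric.ball (Φ p) ε ∩ Metric.ball 0 ρ)) :=
        ((convex_ball (Φ p) ε).inter (convex_ball 0 ρ)).isPreconnected.image ψ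
          (h.differentiableOn.continuousOn.mono (inter_subset_left.trans hb1))
      convert h1 using 1
      ext z
      constructor
      · rintro ⟨⟨hz, hzb⟩, hzS⟩
        refine ⟨Φ z, ⟨hzb, ?_⟩, h.left_inv z hz⟩
        rw [mem_ball_zero_iff]
        exact ((mem_filledDomain_of_one_lt hρ).1 hzS).elim (fun h => absurd h hz) fun h => h.2
      · rintro ⟨w, ⟨hw1, hw2⟩, rfl⟩
        have hw' : 1 < ‖w‖ := hb1 hw1
        refine ⟨⟨h.notMem w hw', ?_⟩, (mem_filledDomain_of_one_lt hρ).2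
          (Or.inr ⟨h.notMem w hw', ?_⟩)⟩
        · rw [mem_preimage, h.right_inv w hw']; exact hw1
        · rw [h.right_inv w hw']; simpa using hw2
  · intro δ hδ
    obtain ⟨ε, hε, hb1, hb2⟩ := hsmall δ hδ
    -- the radial segment in the `w`-plane that ends at `Φ p`
    let η := min (1 / 2) (ε / (2 * ρ))
    have hη : 0 < η := by positivity
    have hη1 : η ≤ 1 / 2 := min_le_left _ _
    have hηρ : η * ρ < ε := by
      calc η * ρ ≤ ε / (2 * ρ) * ρ := by gcongr; exact min_le_right _ _
        _ = ε / 2 := by field_simp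
        _ < ε := by linarith
    let w : unitInterval → ℂ := fun t => ((1 - (1 - (t : ℝ)) * η : ℝ) : ℂ) * Φ p
    have hwc : Continuous w := by fun_prop
    have hwb : ∀ t, w t ∈ Metric.ball (Φ p) ε := by
      intro t
      have ht0 := t.2.1
      have ht1 := t.2.2
      rw [Metric.mem_ball, dist_eq_norm]
      have : w t - Φ p = ((-((1 - (t : ℝ)) * η) : ℝ) : ℂ) * Φ p := by
        simp only [w]; push_cast; ring
      rw [this, norm_mul, Complex.norm_real, Real.norm_eq_abs, abs_neg, abs_of_nonneg
        (mul_nonneg (by linarith) hη.le), hp]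
      calc (1 - (t : ℝ)) * η * ρ ≤ 1 * η * ρ := by gcongr; linarith
        _ < ε := by linarith
    have hw1 : w 1 = Φ p := by simp [w]
    refine ⟨ψ (w 0), ⟨⟨fun t => ψ (w t), ?_⟩, rfl, ?_⟩, ?_⟩
    · exact h.differentiableOn.continuousOn.comp_continuous hwc fun t => hb1 (hwb t)
    · simp only [hw1, h.left_inv p hpG]
    · intro t ht
      have ht1 : (t : ℝ) < 1 := unitInterval.lt_one_iff_ne_one.2 ht
      have ht0 := t.2.1
      have h1 : 1 < ‖w t‖ := hb1 (hwb t)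
      refine ⟨(mem_filledDomain_of_one_lt hρ).2 (Or.inr ⟨h.notMem _ h1, ?_⟩), hb2 _ (hwb t)⟩
      change ‖Φ (ψ (w t))‖ < ρ
      rw [h.right_inv _ h1]
      simp only [w]
      have hlt : (1 - (t : ℝ)) * η < 1 := by nlinarith
      have hpos : 0 < (1 - (t : ℝ)) * η := mul_pos (by linarith) hη
      rw [norm_mul, Complex.norm_real, Real.norm_eq_abs, abs_of_nonneg (by linarith), hp]
      nlinarith

theorem isPreconnected_exterior (h : IsExteriorInverse G Φ ψ) {ρ : ℝ} (hρ : 1 < ρ) :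
    IsPreconnected {z | z ∉ closure G ∧ ‖Φ z‖ < ρ} := by
  have h1 : IsPreconnected {w : ℂ | 0 < w.re ∧ w.re < Real.log ρ} :=
    ((convex_halfSpace_re_gt 0).inter (convex_halfSpace_re_lt _)).isPreconnected
  have hmem : ∀ w : ℂ, 0 < w.re → 1 < ‖Complex.exp w‖ := fun w hw => by
    rw [Complex.norm_exp]; exact Real.one_lt_exp_iff.2 hw
  have h2 := h1.image (fun w => ψ (Complex.exp w)) (h.differentiableOn.continuousOn.comp
    Complex.continuous_exp.continuousOn fun w hw => hmem w hw.1)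
  convert h2 using 1
  ext z
  constructor
  · rintro ⟨hz, hzρ⟩
    have h0 := h.one_lt_norm z hz
    have hne : Φ z ≠ 0 := norm_pos_iff.1 (by linarith)
    refine ⟨Complex.log (Φ z), ⟨?_, ?_⟩, ?_⟩
    · rw [Complex.log_re]; exact Real.log_pos h0
    · rw [Complex.log_re]; exact Real.log_lt_log (by linarith) hzρ
    · simp only [Complex.exp_log hne, h.left_inv z hz]
  · rintro ⟨w, ⟨hw0, hw1⟩, rfl⟩
    refine ⟨h.notMem _ (hmem w hw0), ?_⟩
    rw [h.right_inv _ (hmem w hw0), Complex.norm_exp]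
    calc Real.exp w.re < Real.exp (Real.log ρ) := Real.exp_lt_exp.2 hw1
      _ = ρ := Real.exp_log (by linarith)

theorem exists_mem_closure_inter (h : IsExteriorInverse G Φ ψ) (hne : G.Nonempty) :
    ∃ p ∈ closure G, p ∈ closure (closure G)ᶜ := by
  have h1 : (frontier (closure G)).Nonempty := by
    refine nonempty_frontier_iff.2 ⟨hne.closure, fun h0 => ?_⟩
    have := h.notMem 2 (by norm_num)
    rw [h0] at this
    exact this (mem_univ _)
  obtain ⟨p, hp⟩ := h1
  rw [frontier_eq_closure_inter_closure, closure_closure] at hp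
  exact ⟨p, hp.1, hp.2⟩

theorem isPreconnected_filledDomain (h : IsExteriorInverse G Φ ψ) (hne : G.Nonempty)
    (hGc : IsPreconnected G) (ρ : ℝ) : IsPreconnected (filledDomain G Φ ρ) := by
  rcases le_or_gt ρ 1 with h1 | h1
  · rwa [filledDomain_of_le h1]
  obtain ⟨p, hpG, hpΩ⟩ := h.exists_mem_closure_inter hne
  have hS := h.isOpen_levelInterior h1
  set A := {z | z ∉ closure G ∧ ‖Φ z‖ < ρ}
  have hpA : p ∈ closure A := by
    rw [mem_closure_iff]
    intro o ho hpo
    obtain ⟨x, ⟨hxo, hxS⟩, hxG⟩ := mem_closure_iff.1 hpΩ (o ∩ levelInterior G Φ ρ) (ho.inter hS)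
      ⟨hpo, Or.inl hpG⟩
    exact ⟨x, hxo, hxS.resolve_left hxG⟩
  have h2 : IsPreconnected (insert p A) := (h.isPreconnected_exterior h1).subset_closure
    (subset_insert _ _) (insert_subset hpA subset_closure)
  have h3 : filledDomain G Φ ρ = closure G ∪ insert p A := by
    rw [filledDomain_of_one_lt h1]
    ext z
    simp only [levelInterior, mem_union, mem_insert_iff]
    constructor
    · tauto
    · rintro (hz | rfl | hz)
      · exact Or.inl hz
      · exact Or.inl hpG
      · exact Or.inr hz
  rw [h3]
  exact hGc.closure.union p hpG (mem_insert _ _) h2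

end IsExteriorInverse

end

/-! ### Sectors between two arcs that issue from a point -/

/-- The argument of a point of the unit circle, taken in `(0, 2π]`. -/
noncomputable def circleAngle (w : ℂ) : ℝ := Real.pi + Complex.arg (-w)

theorem circleAngle_pos (w : ℂ) : 0 < circleAngle w := by
  have := Complex.neg_pi_lt_arg (-w)
  unfold circleAngle; linarith

theorem neg_mem_slitPlane_of_norm_eq_one {w : ℂ} (hw : ‖w‖ = 1) (h1 : w ≠ 1) :
    -w ∈ Complex.slitPlane := by
  rw [Complex.mem_slitPlane_iff_arg]
  refine ⟨fun h => h1 ?_, neg_ne_zero.2 (norm_pos_iff.1 (by rw [hw]; exact one_pos))⟩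
  have h2 := Complex.norm_mul_exp_arg_mul_I (-w)
  rw [h, Complex.exp_pi_mul_I, norm_neg, hw] at h2
  push_cast at h2
  linear_combination h2

theorem circleAngle_lt_two_pi {w : ℂ} (hw : ‖w‖ = 1) (h1 : w ≠ 1) :
    circleAngle w < 2 * Real.pi := by
  have h2 := (Complex.mem_slitPlane_iff_arg.1 (neg_mem_slitPlane_of_norm_eq_one hw h1)).1
  have := lt_of_le_of_ne (Complex.arg_le_pi (-w)) h2
  unfold circleAngle; linarith

theorem exp_circleAngle {w : ℂ} (hw : ‖w‖ = 1) : Complex.exp (circleAngle w * Complex.I) = w := by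
  have h2 := Complex.norm_mul_exp_arg_mul_I (-w)
  rw [norm_neg, hw] at h2
  push_cast at h2
  rw [circleAngle, Complex.ofReal_add, add_mul, Complex.exp_add, Complex.exp_pi_mul_I]
  linear_combination -h2

theorem circleAngle_exp {τ : ℝ} (h0 : 0 < τ) (h1 : τ < 2 * Real.pi) :
    circleAngle (Complex.exp (τ * Complex.I)) = τ := by
  have h2 : -Complex.exp (τ * Complex.I) = Complex.exp ((τ - Real.pi : ℝ) * Complex.I) := by
    rw [Complex.ofReal_sub, sub_mul, Complex.exp_sub, Complex.exp_pi_mul_I, div_neg,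
      div_one]
  rw [circleAngle, h2, Complex.arg_exp_mul_I, (toIocMod_eq_self Real.two_pi_pos).2]
  · ring
  · constructor <;> linarith

theorem continuousAt_circleAngle {w : ℂ} (hw : ‖w‖ = 1) (h1 : w ≠ 1) :
    ContinuousAt circleAngle w :=
  continuousAt_const.add
    (ContinuousAt.comp (f := fun w : ℂ => -w)
      (Complex.continuousAt_arg (neg_mem_slitPlane_of_norm_eq_one hw h1)) continuousAt_neg)

/-- The point at distance `r` from `p` that divides in the ratio `s : (1 - s)` the
counterclockwise arc from the direction `u r` to the direction `v r`. -/
noncomputable def sectorPoint (p : ℂ) (u v : ℝ → ℂ) (r s : ℝ) : ℂ :=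
  p + r * (u r * Complex.exp (((s * circleAngle (v r / u r) : ℝ) : ℂ) * Complex.I))

/-- The open sector of radius `δ` at `p` swept counterclockwise from the arc `p + r * u r` to the
arc `p + r * v r`. -/
def sector (p : ℂ) (u v : ℝ → ℂ) (δ : ℝ) : Set ℂ :=
  {z | ∃ r ∈ Ioo 0 δ, ∃ s ∈ Ioo (0 : ℝ) 1, z = sectorPoint p u v r s}

/-- The unit vectors `u r` and `v r` are the directions, at distance `r` from a point, of two arcs
that issue from this point and have nothing else in common. -/
structure IsArcPair (u v : ℝ → ℂ) (δ : ℝ) : Prop where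
  continuousOn_left : ContinuousOn u (Ico 0 δ)
  continuousOn_right : ContinuousOn v (Ico 0 δ)
  norm_left : ∀ r ∈ Ico 0 δ, ‖u r‖ = 1
  norm_right : ∀ r ∈ Ico 0 δ, ‖v r‖ = 1
  ne : ∀ r ∈ Ico 0 δ, u r ≠ v r

namespace IsArcPair

variable {p : ℂ} {u v : ℝ → ℂ} {δ : ℝ}

theorem symm (h : IsArcPair u v δ) : IsArcPair v u δ :=
  ⟨h.2, h.1, h.4, h.3, fun r hr => (h.ne r hr).symm⟩

theorem norm_div (h : IsArcPair u v δ) {r : ℝ} (hr : r ∈ Ico 0 δ) : ‖v r / u r‖ = 1 := by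
  rw [_root_.norm_div, h.norm_left r hr, h.norm_right r hr, div_one]

theorem left_ne_zero (h : IsArcPair u v δ) {r : ℝ} (hr : r ∈ Ico 0 δ) : u r ≠ 0 :=
  norm_pos_iff.1 (by rw [h.norm_left r hr]; exact one_pos)

theorem div_ne_one (h : IsArcPair u v δ) {r : ℝ} (hr : r ∈ Ico 0 δ) : v r / u r ≠ 1 := fun h1 =>
  h.ne r hr ((div_eq_one_iff_eq (h.left_ne_zero hr)).1 h1).symm

theorem norm_sectorPoint_sub (h : IsArcPair u v δ) {r : ℝ} (hr : r ∈ Ico 0 δ) (s : ℝ) :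
    ‖sectorPoint p u v r s - p‖ = r := by
  rw [sectorPoint, add_sub_cancel_left, norm_mul, norm_mul, Complex.norm_exp_ofReal_mul_I,
    h.norm_left r hr, Complex.norm_real, Real.norm_of_nonneg hr.1]
  ring

theorem continuousOn_sectorPoint (h : IsArcPair u v δ) :
    ContinuousOn (fun x : ℝ × ℝ => sectorPoint p u v x.1 x.2) (Ico 0 δ ×ˢ univ) := by
  have hu : ContinuousOn (fun x : ℝ × ℝ => u x.1) (Ico 0 δ ×ˢ (univ : Set ℝ)) :=
    h.1.comp continuousOn_fst fun x hx => hx.1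
  have hv : ContinuousOn (fun x : ℝ × ℝ => v x.1) (Ico 0 δ ×ˢ (univ : Set ℝ)) :=
    h.2.comp continuousOn_fst fun x hx => hx.1
  have hq : ContinuousOn (fun x : ℝ × ℝ => circleAngle (v x.1 / u x.1))
      (Ico 0 δ ×ˢ (univ : Set ℝ)) := by
    intro x hx
    have hd : ContinuousWithinAt (fun x : ℝ × ℝ => v x.1 / u x.1) (Ico 0 δ ×ˢ univ) x :=
      (hv x hx).div (hu x hx) (h.left_ne_zero hx.1)
    exact ContinuousAt.comp_continuousWithinAt (f := fun x : ℝ × ℝ => v x.1 / u x.1)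
      (continuousAt_circleAngle (h.norm_div hx.1) (h.div_ne_one hx.1)) hd
  unfold sectorPoint
  refine continuousOn_const.add (ContinuousOn.mul (by fun_prop) (hu.mul ?_))
  refine Complex.continuous_exp.comp_continuousOn (ContinuousOn.mul ?_ continuousOn_const)
  exact Complex.continuous_ofReal.comp_continuousOn (continuousOn_snd.mul hq)

theorem isPreconnected_sector (h : IsArcPair u v δ) : IsPreconnected (sector p u v δ) := by
  have h1 : IsPreconnected (Ioo 0 δ ×ˢ Ioo (0 : ℝ) 1) := isPreconnected_Ioo.prod isPreconnected_Ioo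
  have h2 := h1.image _ ((h.continuousOn_sectorPoint (p := p)).mono
    (prod_mono Ioo_subset_Ico_self (subset_univ _)))
  convert h2 using 1
  ext z
  constructor
  · rintro ⟨r, hr, s, hs, rfl⟩
    exact ⟨(r, s), ⟨hr, hs⟩, rfl⟩
  · rintro ⟨⟨r, s⟩, ⟨hr, hs⟩, rfl⟩
    exact ⟨r, hr, s, hs, rfl⟩

theorem sector_subset_ball (h : IsArcPair u v δ) : sector p u v δ ⊆ Metric.ball p δ := by
  rintro z ⟨r, hr, s, hs, rfl⟩
  rw [Metric.mem_ball, dist_eq_norm, h.norm_sectorPoint_sub ⟨hr.1.le, hr.2⟩]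
  exact hr.2

theorem sectorPoint_ne (h : IsArcPair u v δ) {r s : ℝ} (hr : r ∈ Ioo 0 δ) (hs : s ∈ Ioo (0 : ℝ) 1)
    {r' : ℝ} (hr' : r' ∈ Ico 0 δ) :
    sectorPoint p u v r s ≠ p + r' * u r' ∧ sectorPoint p u v r s ≠ p + r' * v r' := by
  have hrI : r ∈ Ico 0 δ := ⟨hr.1.le, hr.2⟩
  have hr0 : (r : ℂ) ≠ 0 := by exact_mod_cast hr.1.ne'
  have hu0 := h.left_ne_zero hrI
  set θ := circleAngle (v r / u r) with hθ
  have hθ0 : 0 < θ := circleAngle_pos _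
  have hθ1 : θ < 2 * Real.pi := circleAngle_lt_two_pi (h.norm_div hrI) (h.div_ne_one hrI)
  have hsθ0 : 0 < s * θ := mul_pos hs.1 hθ0
  have hsθ1 : s * θ < θ := by nlinarith [hs.2]
  have hang : circleAngle (Complex.exp (((s * θ : ℝ) : ℂ) * Complex.I)) = s * θ :=
    circleAngle_exp hsθ0 (hsθ1.trans hθ1)
  have hone : circleAngle 1 = 2 * Real.pi := by
    rw [circleAngle, Complex.arg_neg_one]; ring
  have hrr : ∀ w : ℂ, ‖w‖ = 1 → sectorPoint p u v r s = p + r' * w → r = r' := by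
    intro w hw heq
    have h1 := h.norm_sectorPoint_sub (p := p) hrI s
    rw [heq, add_sub_cancel_left, norm_mul, hw, mul_one, Complex.norm_real,
      Real.norm_of_nonneg hr'.1] at h1
    exact h1.symm
  constructor
  · intro heq
    obtain rfl := hrr _ (h.norm_left r' hr') heq
    have h1 : Complex.exp (((s * θ : ℝ) : ℂ) * Complex.I) = 1 := by
      have h2 := mul_left_cancel₀ hr0 (add_left_cancel heq)
      exact mul_left_cancel₀ hu0 (h2.trans (mul_one _).symm)
    rw [h1, hone] at hang
    linarith
  · intro heq
    obtain rfl := hrr _ (h.norm_right r' hr') heq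
    have h1 : Complex.exp (((s * θ : ℝ) : ℂ) * Complex.I) = v r / u r := by
      have h2 := mul_left_cancel₀ hr0 (add_left_cancel heq)
      rw [eq_div_iff hu0, mul_comm]
      exact h2
    rw [h1, ← hθ] at hang
    linarith

theorem mem_sector_or_mem_sector (h : IsArcPair u v δ) {z : ℂ} (hz : z ∈ Metric.ball p δ)
    (hne : ∀ r ∈ Ico 0 δ, z ≠ p + r * u r ∧ z ≠ p + r * v r) :
    z ∈ sector p u v δ ∨ z ∈ sector p v u δ := by
  set r := ‖z - p‖ with hrdef
  have hrδ : r < δ := by rwa [Metric.mem_ball, dist_eq_norm] at hz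
  have hrI : r ∈ Ico 0 δ := ⟨norm_nonneg _, hrδ⟩
  have hδ : 0 < δ := (norm_nonneg _).trans_lt hrδ
  have hr0 : 0 < r := by
    refine norm_pos_iff.2 fun h0 => (hne 0 ⟨le_rfl, hδ⟩).1 ?_
    rw [sub_eq_zero.1 h0]; simp
  have hrC : (r : ℂ) ≠ 0 := by exact_mod_cast hr0.ne'
  have hrJ : r ∈ Ioo 0 δ := ⟨hr0, hrδ⟩
  set w := (z - p) / r with hw
  have hzw : z = p + r * w := by rw [hw]; field_simp; ring
  have hwn : ‖w‖ = 1 := by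
    rw [hw, _root_.norm_div, Complex.norm_real, Real.norm_of_nonneg hr0.le, ← hrdef,
      div_self hr0.ne']
  have hu0 := h.left_ne_zero hrI
  have hv0 := h.symm.left_ne_zero hrI
  have hwu : w ≠ u r := fun h1 => (hne r hrI).1 (h1 ▸ hzw)
  have hwv : w ≠ v r := fun h1 => (hne r hrI).2 (h1 ▸ hzw)
  have hnwu : ‖w / u r‖ = 1 := by rw [_root_.norm_div, hwn, h.norm_left r hrI, div_one]
  have hwu1 : w / u r ≠ 1 := fun h1 => hwu ((div_eq_one_iff_eq hu0).1 h1)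
  set θ := circleAngle (v r / u r) with hθ
  set τ := circleAngle (w / u r) with hτ
  have hθe := exp_circleAngle (h.norm_div hrI)
  have hτe := exp_circleAngle hnwu
  rw [← hθ] at hθe
  rw [← hτ] at hτe
  have hθ0 : 0 < θ := circleAngle_pos _
  have hτ0 : 0 < τ := circleAngle_pos _
  have hθ1 : θ < 2 * Real.pi := circleAngle_lt_two_pi (h.norm_div hrI) (h.div_ne_one hrI)
  have hτ1 : τ < 2 * Real.pi := circleAngle_lt_two_pi hnwu hwu1
  rcases lt_trichotomy τ θ with hlt | heq | hgt
  · refine Or.inl ⟨r, hrJ, τ / θ, ⟨by positivity, (div_lt_one hθ0).2 hlt⟩, ?_⟩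
    rw [hzw, sectorPoint, ← hθ, div_mul_cancel₀ _ hθ0.ne', hτe]
    field_simp
  · refine absurd ?_ hwv
    have h1 : w / u r = v r / u r := by rw [← hτe, ← hθe, heq]
    exact (div_left_inj' hu0).1 h1
  · have h1 : circleAngle (u r / v r) = 2 * Real.pi - θ := by
      rw [← circleAngle_exp (τ := 2 * Real.pi - θ) (by linarith) (by linarith)]
      congr 1
      rw [Complex.ofReal_sub, sub_mul, Complex.exp_sub, hθe]
      push_cast
      rw [Complex.exp_two_pi_mul_I]
      field_simp
    have h2 : 0 < 2 * Real.pi - θ := by linarith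
    refine Or.inr ⟨r, hrJ, (τ - θ) / (2 * Real.pi - θ), ⟨div_pos (by linarith) h2,
      (div_lt_one h2).2 (by linarith)⟩, ?_⟩
    rw [hzw, sectorPoint, h1, div_mul_cancel₀ _ h2.ne', Complex.ofReal_sub, sub_mul,
      Complex.exp_sub, hτe, hθe]
    field_simp

theorem left_mem_closure_sector {r : ℝ} (hr : r ∈ Ioo 0 δ) :
    p + r * u r ∈ closure (sector p u v δ) := by
  have hc : Continuous fun s : ℝ => sectorPoint p u v r s := by unfold sectorPoint; fun_prop
  have h0 : sectorPoint p u v r 0 = p + r * u r := by simp [sectorPoint]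
  rw [← h0]
  refine map_mem_closure hc (s := Ioo (0 : ℝ) 1) ?_ fun s hs => ⟨r, hr, s, hs, rfl⟩
  rw [closure_Ioo zero_ne_one]
  exact ⟨le_rfl, zero_le_one⟩

theorem right_mem_closure_sector (h : IsArcPair u v δ) {r : ℝ} (hr : r ∈ Ioo 0 δ) :
    p + r * v r ∈ closure (sector p u v δ) := by
  have hc : Continuous fun s : ℝ => sectorPoint p u v r s := by unfold sectorPoint; fun_prop
  have hrI : r ∈ Ico 0 δ := ⟨hr.1.le, hr.2⟩
  have h0 : sectorPoint p u v r 1 = p + r * v r := by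
    rw [sectorPoint, one_mul, exp_circleAngle (h.norm_div hrI),
      mul_div_cancel₀ _ (h.left_ne_zero hrI)]
  rw [← h0]
  refine map_mem_closure hc (s := Ioo (0 : ℝ) 1) ?_ fun s hs => ⟨r, hr, s, hs, rfl⟩
  rw [closure_Ioo zero_ne_one]
  exact ⟨zero_le_one, le_rfl⟩

theorem center_mem_closure_sector (h : IsArcPair u v δ) (hδ : 0 < δ) :
    p ∈ closure (sector p u v δ) := by
  rw [Metric.mem_closure_iff]
  intro ε hε
  have hr : min ε δ / 2 ∈ Ioo 0 δ := by
    have := min_le_right ε δ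
    have : 0 < min ε δ := lt_min hε hδ
    constructor <;> linarith
  refine ⟨sectorPoint p u v (min ε δ / 2) (1 / 2), ⟨_, hr, _, ⟨by norm_num, by norm_num⟩, rfl⟩, ?_⟩
  rw [dist_comm, dist_eq_norm, h.norm_sectorPoint_sub ⟨hr.1.le, hr.2⟩]
  have := min_le_left ε δ
  linarith

theorem exists_path_sector (h : IsArcPair u v δ) (hδ : 0 < δ) :
    ∃ (q : ℂ) (γ : Path q p), ∀ t, t ≠ 1 → γ t ∈ sector p u v δ := by
  let r : unitInterval → ℝ := fun t => (1 - (t : ℝ)) * (δ / 2)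
  have hr : ∀ t, r t ∈ Ico 0 δ := fun t => by
    have h0 := t.2.1
    have h1 := t.2.2
    refine ⟨mul_nonneg (by linarith) (by linarith), ?_⟩
    change (1 - (t : ℝ)) * (δ / 2) < δ
    nlinarith
  have hrc : Continuous r := by fun_prop
  refine ⟨sectorPoint p u v (r 0) (1 / 2), ⟨⟨fun t => sectorPoint p u v (r t) (1 / 2), ?_⟩, rfl, ?_⟩,
    fun t ht => ⟨r t, ⟨?_, (hr t).2⟩, 1 / 2, ⟨by norm_num, by norm_num⟩, rfl⟩⟩
  · exact (h.continuousOn_sectorPoint (p := p)).comp_continuous (f := fun t => (r t, 1 / 2))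
      (by fun_prop) fun t => ⟨hr t, mem_univ _⟩
  · simp [sectorPoint, r]
  · have ht1 : (t : ℝ) < 1 := unitInterval.lt_one_iff_ne_one.2 ht
    exact mul_pos (by linarith) (by linarith)

end IsArcPair

/-! ### The local structure of a piecewise analytic Jordan curve without cusps -/

/-- A regular analytic arc can be parametrized near its initial point by the distance to this point:
with `α s = α 0 + s * a s`, the function `s * ‖a s‖` has derivative `‖α' 0‖ > 0` at `0`, and its
local inverse is the new parameter. The direction `u` is then continuous up to the initial point. -/
theorem AnalyticAt.exists_polar_arc {α : ℝ → ℂ} (hα : AnalyticAt ℝ α 0) (hα' : deriv α 0 ≠ 0) :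
    ∃ (u : ℝ → ℂ) (r₁ ε₁ : ℝ), 0 < r₁ ∧ 0 < ε₁ ∧ ContinuousOn u (Ico 0 r₁) ∧
      (∀ r ∈ Ico 0 r₁, ‖u r‖ = 1) ∧ u 0 = deriv α 0 / ‖deriv α 0‖ ∧
      (∀ s ∈ Ico 0 ε₁, α s = α 0 + ‖α s - α 0‖ * u ‖α s - α 0‖) ∧
      ∀ ε > 0, ∃ δ > 0, ∀ r ∈ Ico 0 δ, ∃ s ∈ Ico 0 ε, α s = α 0 + r * u r := by
  obtain ⟨P, hP⟩ := hα
  set a : ℝ → ℂ := dslope α 0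
  have ha : AnalyticAt ℝ a 0 := ⟨_, hP.has_fpower_series_dslope_fslope⟩
  have ha0 : a 0 = deriv α 0 := dslope_same _ _
  have hαa : ∀ s, α s - α 0 = s * a s := fun s => by
    have := sub_smul_dslope α 0 s
    rw [sub_zero, Complex.real_smul] at this
    exact this.symm
  have ha0' : a 0 ≠ 0 := ha0 ▸ hα'
  let ϱ : ℝ → ℝ := fun s => s * ‖a s‖
  have hcd : ContDiffAt ℝ 1 ϱ 0 :=
    contDiffAt_id.mul ((ha.contDiffAt (n := 1)).norm ℝ ha0')
  have hder : HasDerivAt ϱ ‖a 0‖ 0 := by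
    have hn : HasDerivAt (fun s => ‖a s‖) (deriv (fun s => ‖a s‖) 0) 0 :=
      (((ha.contDiffAt (n := 1)).norm ℝ ha0').differentiableAt one_ne_zero).hasDerivAt
    have := (hasDerivAt_id (0 : ℝ)).mul hn
    simp only [id_eq, one_mul, zero_mul, add_zero] at this
    exact this
  have hs : HasStrictDerivAt ϱ ‖a 0‖ 0 := hcd.hasStrictDerivAt' hder one_ne_zero
  have hpos : 0 < ‖a 0‖ := norm_pos_iff.2 ha0'
  let e := (hs.hasStrictFDerivAt_equiv hpos.ne').toOpenPartialHomeomorph ϱ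
  have he : ∀ s, e s = ϱ s := fun s => rfl
  have he0s : (0 : ℝ) ∈ e.source :=
    (hs.hasStrictFDerivAt_equiv hpos.ne').mem_toOpenPartialHomeomorph_source
  have hϱ0 : ϱ 0 = 0 := by simp [ϱ]
  have he0t : (0 : ℝ) ∈ e.target := by
    have := e.map_source he0s
    rwa [he, hϱ0] at this
  have hτ0 : e.symm 0 = 0 := by
    have := e.left_inv he0s
    rwa [he, hϱ0] at this
  have hτc : ContinuousAt e.symm 0 := e.continuousAt_symm he0t
  have hgood : ∀ᶠ s in 𝓝 (0 : ℝ), ContinuousAt a s ∧ a s ≠ 0 :=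
    (ha.eventually_analyticAt.mono fun s hs => hs.continuousAt).and
      (ha.continuousAt.eventually_ne ha0')
  have hgood' : ∀ᶠ r in 𝓝 (0 : ℝ), (ContinuousAt a (e.symm r) ∧ a (e.symm r) ≠ 0) ∧ r ∈ e.target := by
    refine Filter.Eventually.and ?_ (e.open_target.mem_nhds he0t)
    refine hτc.eventually (p := fun s => ContinuousAt a s ∧ a s ≠ 0) ?_
    rwa [hτ0]
  obtain ⟨r₁, hr₁, hb⟩ := Metric.eventually_nhds_iff_ball.1 hgood'
  have hI : ∀ r ∈ Ico 0 r₁, r ∈ Metric.ball (0 : ℝ) r₁ := fun r hr => by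
    rw [Metric.mem_ball, Real.dist_eq, sub_zero, abs_of_nonneg hr.1]; exact hr.2
  obtain ⟨ε₁, hε₁, hb'⟩ := Metric.eventually_nhds_iff_ball.1
    (hgood.and (e.open_source.mem_nhds he0s))
  have hI' : ∀ s ∈ Ico 0 ε₁, s ∈ Metric.ball (0 : ℝ) ε₁ := fun r hr => by
    rw [Metric.mem_ball, Real.dist_eq, sub_zero, abs_of_nonneg hr.1]; exact hr.2
  refine ⟨fun r => a (e.symm r) / ‖a (e.symm r)‖, r₁, ε₁, hr₁, hε₁, ?_, ?_, ?_, ?_, ?_⟩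
  · intro r hr
    obtain ⟨⟨h1, h2⟩, h3⟩ := hb r (hI r hr)
    have h4 : ContinuousAt (fun r => a (e.symm r)) r := ContinuousAt.comp h1 (e.continuousAt_symm h3)
    refine (h4.div (Complex.continuous_ofReal.continuousAt.comp h4.norm) ?_).continuousWithinAt
    exact Complex.ofReal_ne_zero.2 (norm_ne_zero_iff.2 h2)
  · intro r hr
    have h2 := norm_ne_zero_iff.2 (hb r (hI r hr)).1.2
    rw [norm_div, Complex.norm_real, norm_norm, div_self h2]
  · simp only [hτ0, ha0]
  · intro s hs
    obtain ⟨⟨-, h2⟩, h3⟩ := hb' s (hI' s hs)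
    have h4 : ‖α s - α 0‖ = ϱ s := by
      rw [hαa, norm_mul, Complex.norm_real, Real.norm_of_nonneg hs.1]
    have h5 : e.symm (ϱ s) = s := e.left_inv h3
    have h6 : (‖a s‖ : ℂ) ≠ 0 := by exact_mod_cast norm_ne_zero_iff.2 h2
    rw [h4, ← sub_eq_iff_eq_add', hαa]
    simp only [h5]
    simp only [ϱ]
    push_cast
    field_simp
  · intro ε hε
    have h1 : ∀ᶠ r in 𝓝 (0 : ℝ), e.symm r < ε :=
      hτc.eventually_lt continuousAt_const (by rwa [hτ0])
    obtain ⟨δ, hδ, hbδ⟩ := Metric.eventually_nhds_iff_ball.1 (h1.and hgood')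
    refine ⟨δ, hδ, fun r hr => ?_⟩
    obtain ⟨h2, ⟨-, h3⟩, h4⟩ := hbδ r (by
      rw [Metric.mem_ball, Real.dist_eq, sub_zero, abs_of_nonneg hr.1]; exact hr.2)
    have h5 : e.symm r * ‖a (e.symm r)‖ = r := e.right_inv h4
    have h6 : 0 < ‖a (e.symm r)‖ := norm_pos_iff.2 h3
    refine ⟨e.symm r, ⟨?_, h2⟩, ?_⟩
    · by_contra hneg
      have := mul_neg_of_neg_of_pos (not_le.1 hneg) h6
      rw [h5] at this
      exact absurd hr.1 this.not_ge
    · have h7 : (‖a (e.symm r)‖ : ℂ) ≠ 0 := by exact_mod_cast h6.ne'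
      rw [← sub_eq_iff_eq_add', hαa]
      nth_rw 3 [← h5]
      push_cast
      field_simp

namespace IsPiecewiseAnalyticJordanCurveWithoutCusps

variable {Γ : Set ℂ}

/-- Near each of its points, the curve consists of two regular analytic arcs that issue from this
point in different directions. -/
theorem exists_arcs (hΓ : IsPiecewiseAnalyticJordanCurveWithoutCusps Γ) {p : ℂ} (hp : p ∈ Γ) :
    ∃ α β : ℝ → ℂ, AnalyticAt ℝ α 0 ∧ AnalyticAt ℝ β 0 ∧ α 0 = p ∧ β 0 = p ∧
      ¬ SameRay ℝ (deriv α 0) (deriv β 0) ∧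
      (∃ ε₀ > 0, ∀ s ∈ Ico 0 ε₀, α s ∈ Γ ∧ β s ∈ Γ) ∧
      ∀ ε > 0, ∃ δ > 0, Γ ∩ Metric.ball p δ ⊆ α '' Ico 0 ε ∪ β '' Ico 0 ε := by
  obtain ⟨N, σ, han, hder, hjoin, hinj, rfl, hcusp⟩ := hΓ
  have hmemΓ : ∀ i, ∀ s ∈ Icc (0 : ℝ) 1, σ i s ∈ ⋃ i, σ i '' Icc 0 1 := fun i s hs =>
    mem_iUnion.2 ⟨i, s, hs, rfl⟩
  have hloc : ∀ O : Set (Fin (N + 1) × ℝ), IsOpen O →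
      (∀ j, ∀ s ∈ Icc (0 : ℝ) 1, σ j s = p → (j, s) ∈ O) →
      ∃ δ > 0, ∀ j, ∀ s ∈ Icc (0 : ℝ) 1, σ j s ∈ Metric.ball p δ → (j, s) ∈ O := by
    intro O hO hpO
    have hC : IsCompact (((univ : Set (Fin (N + 1))) ×ˢ Icc (0 : ℝ) 1) \ O) :=
      (isCompact_univ.prod isCompact_Icc).diff hO
    have hf : ContinuousOn (fun x : Fin (N + 1) × ℝ => σ x.1 x.2)
        (((univ : Set (Fin (N + 1))) ×ˢ Icc (0 : ℝ) 1) \ O) := by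
      refine ContinuousOn.mono ?_ sdiff_subset
      rw [continuousOn_prod_of_discrete_left]
      intro i
      refine (han i).continuousOn.mono fun s hs => hs.2
    have him := (hC.image_of_continuousOn hf).isClosed
    have hpn : p ∉ (fun x : Fin (N + 1) × ℝ => σ x.1 x.2) ''
        (((univ : Set (Fin (N + 1))) ×ˢ Icc (0 : ℝ) 1) \ O) := by
      rintro ⟨⟨j, s⟩, ⟨⟨-, hs⟩, hn⟩, hjs⟩
      exact hn (hpO j s hs hjs)
    obtain ⟨δ, hδ, hb⟩ := Metric.isOpen_iff.1 him.isOpen_compl p hpn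
    refine ⟨δ, hδ, fun j s hs hjs => ?_⟩
    by_contra hn
    exact hb hjs ⟨(j, s), ⟨⟨mem_univ _, hs⟩, hn⟩, rfl⟩
  obtain ⟨i, t, ht, rfl⟩ : ∃ i, ∃ t ∈ Ico (0 : ℝ) 1, σ i t = p := by
    obtain ⟨i, t, ht, rfl⟩ := mem_iUnion.1 hp
    rcases ht.2.lt_or_eq with h | rfl
    · exact ⟨i, t, ⟨ht.1, h⟩, rfl⟩
    · exact ⟨i + 1, 0, ⟨le_rfl, one_pos⟩, (hjoin i).symm⟩
  have hpre : ∀ j, ∀ s ∈ Icc (0 : ℝ) 1, σ j s = σ i t →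
      (j = i ∧ s = t) ∨ (j + 1 = i ∧ s = 1 ∧ t = 0) := by
    intro j s hs hjs
    rcases hs.2.lt_or_eq with h | rfl
    · have := hinj (x₁ := (j, s)) (x₂ := (i, t)) ⟨mem_univ _, hs.1, h⟩ ⟨mem_univ _, ht⟩ hjs
      rw [Prod.mk.injEq] at this
      exact Or.inl this
    · rw [hjoin] at hjs
      have := hinj (x₁ := (j + 1, 0)) (x₂ := (i, t)) ⟨mem_univ _, le_rfl, one_pos⟩
        ⟨mem_univ _, ht⟩ hjs
      rw [Prod.mk.injEq] at this
      exact Or.inr ⟨this.1, rfl, this.2.symm⟩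
  have hadd : ∀ j, ∀ x ∈ Icc (0 : ℝ) 1, AnalyticAt ℝ (fun s => σ j (x + s)) 0 := fun j x hx =>
    AnalyticAt.comp (g := σ j) (by simpa using han j x hx) (analyticAt_const.add analyticAt_id)
  have hsub : ∀ j, ∀ x ∈ Icc (0 : ℝ) 1, AnalyticAt ℝ (fun s => σ j (x - s)) 0 := fun j x hx =>
    AnalyticAt.comp (g := σ j) (by simpa using han j x hx) (analyticAt_const.sub analyticAt_id)
  have hO : ∀ (j : Fin (N + 1)) (x ε : ℝ), IsOpen (({j} : Set (Fin (N + 1))) ×ˢ Metric.ball x ε) :=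
    fun j x ε => (isOpen_discrete _).prod Metric.isOpen_ball
  rcases ht.1.eq_or_lt with rfl | ht0
  · refine ⟨fun s => σ i (0 + s), fun s => σ (i - 1) (1 - s), hadd i 0 (by simp),
      hsub (i - 1) 1 (by simp), by simp, by simp [hjoin], ?_, ⟨1, one_pos, fun s hs => ?_⟩, ?_⟩
    · rw [deriv_comp_const_add, deriv_comp_const_sub]
      simpa using hcusp (i - 1)
    · exact ⟨hmemΓ _ _ ⟨by linarith [hs.1], by linarith [hs.2]⟩,
        hmemΓ _ _ ⟨by linarith [hs.2], by linarith [hs.1]⟩⟩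
    · intro ε hε
      obtain ⟨δ, hδ, hb⟩ := hloc _ ((hO i 0 ε).union (hO (i - 1) 1 ε)) (by
        intro j s hs hjs
        rcases hpre j s hs hjs with ⟨rfl, rfl⟩ | ⟨hj, rfl, -⟩
        · exact Or.inl ⟨rfl, Metric.mem_ball_self hε⟩
        · exact Or.inr ⟨eq_sub_of_add_eq hj, Metric.mem_ball_self hε⟩)
      refine ⟨δ, hδ, ?_⟩
      rintro z ⟨hz, hzb⟩
      obtain ⟨j, s, hs, rfl⟩ := mem_iUnion.1 hz
      rcases hb j s hs hzb with ⟨hj, hsb⟩ | ⟨hj, hsb⟩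
      · obtain rfl : j = i := hj
        rw [Metric.mem_ball, Real.dist_eq, abs_lt] at hsb
        exact Or.inl ⟨s, ⟨hs.1, by linarith⟩, by simp⟩
      · obtain rfl : j = i - 1 := hj
        rw [Metric.mem_ball, Real.dist_eq, abs_lt] at hsb
        exact Or.inr ⟨1 - s, ⟨by linarith [hs.2], by linarith⟩, by simp⟩
  · have htI : t ∈ Icc (0 : ℝ) 1 := ⟨ht.1, ht.2.le⟩
    refine ⟨fun s => σ i (t + s), fun s => σ i (t - s), hadd i t htI, hsub i t htI, by simp,
      by simp, ?_, ⟨min t (1 - t), lt_min ht0 (by linarith [ht.2]), fun s hs => ?_⟩, ?_⟩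
    · rw [deriv_comp_const_add, deriv_comp_const_sub, add_zero, sub_zero]
      intro h
      exact hder i t htI (eq_zero_of_sameRay_self_neg h)
    · have h1 := hs.2.trans_le (min_le_left _ _)
      have h2 := hs.2.trans_le (min_le_right _ _)
      exact ⟨hmemΓ _ _ ⟨by linarith [hs.1], by linarith [hs.2]⟩,
        hmemΓ _ _ ⟨by linarith [hs.2], by linarith [hs.1, ht.2]⟩⟩
    · intro ε hε
      obtain ⟨δ, hδ, hb⟩ := hloc _ (hO i t ε) (by
        intro j s hs hjs
        rcases hpre j s hs hjs with ⟨rfl, rfl⟩ | ⟨-, -, h0⟩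
        · exact ⟨rfl, Metric.mem_ball_self hε⟩
        · exact absurd h0 ht0.ne')
      refine ⟨δ, hδ, ?_⟩
      rintro z ⟨hz, hzb⟩
      obtain ⟨j, s, hs, rfl⟩ := mem_iUnion.1 hz
      obtain ⟨hj, hsb⟩ := hb j s hs hzb
      obtain rfl : j = i := hj
      rw [Metric.mem_ball, Real.dist_eq, abs_lt] at hsb
      rcases le_total t s with h | h
      · exact Or.inl ⟨s - t, ⟨by linarith, by linarith⟩, by simp⟩
      · exact Or.inr ⟨t - s, ⟨by linarith, by linarith⟩, by simp⟩

/-- Near each of its points `p`, the curve is the union of the arcs `p + r * u r` and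
`p + r * v r` of an arc pair. -/
theorem exists_isArcPair (hΓ : IsPiecewiseAnalyticJordanCurveWithoutCusps Γ) {p : ℂ}
    (hp : p ∈ Γ) {ε : ℝ} (hε : 0 < ε) :
    ∃ (u v : ℝ → ℂ) (δ₀ : ℝ), 0 < δ₀ ∧ δ₀ ≤ ε ∧ IsArcPair u v δ₀ ∧
      ∀ z ∈ Metric.ball p δ₀, z ∈ Γ ↔ ∃ r ∈ Ico 0 δ₀, z = p + r * u r ∨ z = p + r * v r := by
  obtain ⟨α, β, hα, hβ, hα0, hβ0, hray, ⟨ε₀, hε₀, hsub⟩, hloc⟩ := hΓ.exists_arcs hp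
  have hα' : deriv α 0 ≠ 0 := fun h => hray (h ▸ SameRay.zero_left _)
  have hβ' : deriv β 0 ≠ 0 := fun h => hray (h ▸ SameRay.zero_right _)
  obtain ⟨u, r₁, ε₁, hr₁, hε₁, huc, hun, hu0, hαu, hu⟩ := hα.exists_polar_arc hα'
  obtain ⟨v, r₂, ε₂, hr₂, hε₂, hvc, hvn, hv0, hβv, hv⟩ := hβ.exists_polar_arc hβ'
  rw [hα0] at hαu hu
  rw [hβ0] at hβv hv
  have huv : u 0 ≠ v 0 := by
    intro h
    rw [hu0, hv0] at h
    refine hray ((sameRay_iff_inv_norm_smul_eq_of_ne hα' hβ').2 ?_)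
    rw [Complex.real_smul, Complex.real_smul, Complex.ofReal_inv, Complex.ofReal_inv,
      inv_mul_eq_div, inv_mul_eq_div, h]
  have hne : ∀ᶠ r in 𝓝[≥] (0 : ℝ), u r ≠ v r := by
    have h1 : ContinuousWithinAt u (Ici 0) 0 :=
      (huc 0 ⟨le_rfl, hr₁⟩).mono_of_mem_nhdsWithin (Ico_mem_nhdsGE hr₁)
    have h2 : ContinuousWithinAt v (Ici 0) 0 :=
      (hvc 0 ⟨le_rfl, hr₂⟩).mono_of_mem_nhdsWithin (Ico_mem_nhdsGE hr₂)
    filter_upwards [(h1.sub h2).eventually_ne (sub_ne_zero.2 huv)] with r hr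
    exact sub_ne_zero.1 hr
  obtain ⟨r₃, hr₃, hb₃⟩ := mem_nhdsGE_iff_exists_Ico_subset.1 hne
  obtain ⟨δ₁, hδ₁, hloc₁⟩ := hloc (min ε₁ ε₂) (lt_min hε₁ hε₂)
  obtain ⟨δ₂, hδ₂, hu₂⟩ := hu ε₀ hε₀
  obtain ⟨δ₃, hδ₃, hv₃⟩ := hv ε₀ hε₀
  let δ := min (min r₁ r₂) (min r₃ (min δ₁ (min (min δ₂ δ₃) ε)))
  have hr₃' : (0 : ℝ) < r₃ := hr₃
  have hδ : 0 < δ := by positivity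
  have hδ1 : δ ≤ r₁ := (min_le_left _ _).trans (min_le_left _ _)
  have hδ2 : δ ≤ r₂ := (min_le_left _ _).trans (min_le_right _ _)
  have hδ3 : δ ≤ r₃ := (min_le_right _ _).trans (min_le_left _ _)
  have hδ4 : δ ≤ δ₁ := (min_le_right _ _).trans ((min_le_right _ _).trans (min_le_left _ _))
  have hδ5 : δ ≤ δ₂ := (min_le_right _ _).trans ((min_le_right _ _).trans
    ((min_le_right _ _).trans ((min_le_left _ _).trans (min_le_left _ _))))
  have hδ6 : δ ≤ δ₃ := (min_le_right _ _).trans ((min_le_right _ _).trans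
    ((min_le_right _ _).trans ((min_le_left _ _).trans (min_le_right _ _))))
  have hδ7 : δ ≤ ε := (min_le_right _ _).trans ((min_le_right _ _).trans
    ((min_le_right _ _).trans (min_le_right _ _)))
  refine ⟨u, v, δ, hδ, hδ7, ⟨huc.mono (Ico_subset_Ico_right hδ1), hvc.mono (Ico_subset_Ico_right hδ2),
    fun r hr => hun r ⟨hr.1, hr.2.trans_le hδ1⟩, fun r hr => hvn r ⟨hr.1, hr.2.trans_le hδ2⟩,
    fun r hr => hb₃ ⟨hr.1, hr.2.trans_le hδ3⟩⟩, fun z hz => ⟨fun hzΓ => ?_, ?_⟩⟩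
  · have hzn : ‖z - p‖ < δ := by rwa [Metric.mem_ball, dist_eq_norm] at hz
    rcases hloc₁ ⟨hzΓ, Metric.ball_subset_ball hδ4 hz⟩ with ⟨s, hs, rfl⟩ | ⟨s, hs, rfl⟩
    · exact ⟨_, ⟨norm_nonneg _, hzn⟩, Or.inl (hαu s ⟨hs.1, hs.2.trans_le (min_le_left _ _)⟩)⟩
    · exact ⟨_, ⟨norm_nonneg _, hzn⟩, Or.inr (hβv s ⟨hs.1, hs.2.trans_le (min_le_right _ _)⟩)⟩
  · rintro ⟨r, hr, rfl | rfl⟩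
    · obtain ⟨s, hs, h⟩ := hu₂ r ⟨hr.1, hr.2.trans_le hδ5⟩
      rw [← h]
      exact (hsub s hs).1
    · obtain ⟨s, hs, h⟩ := hv₃ r ⟨hr.1, hr.2.trans_le hδ6⟩
      rw [← h]
      exact (hsub s hs).2

theorem isPreconnected (hΓ : IsPiecewiseAnalyticJordanCurveWithoutCusps Γ) : IsPreconnected Γ := by
  obtain ⟨N, σ, han, hder, hjoin, hinj, rfl, hcusp⟩ := hΓ
  have hsymm : Std.Symm fun i j => (σ i '' Icc 0 1 ∩ σ j '' Icc 0 1).Nonempty :=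
    ⟨fun i j h => by rwa [inter_comm]⟩
  have h0 : ∀ j : Fin (N + 1), Relation.ReflTransGen
      (fun i j => (σ i '' Icc 0 1 ∩ σ j '' Icc 0 1).Nonempty) 0 j := by
    intro j
    induction j using Fin.induction with
    | zero => exact .refl
    | succ i ih =>
      refine ih.tail ⟨σ i.castSucc 1, ⟨1, by simp, rfl⟩, 0, by simp, ?_⟩
      rw [hjoin, Fin.coeSucc_eq_succ]
  exact IsPreconnected.iUnion_of_reflTransGen
    (fun i => isPreconnected_Icc.image _ (han i).continuousOn)
    fun i j => (Relation.ReflTransGen.stdSymm.symm _ _ (h0 i)).trans (h0 j)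

end IsPiecewiseAnalyticJordanCurveWithoutCusps

section

variable {G : Set ℂ}

/-- A sector between two arcs of the boundary lies in the domain or in its exterior. -/
theorem IsPiecewiseAnalyticJordanDomain.sector_subset (hG : IsPiecewiseAnalyticJordanDomain G)
    {p : ℂ} {u v : ℝ → ℂ} {δ : ℝ} (hpair : IsArcPair u v δ)
    (hΓ : ∀ z ∈ Metric.ball p δ, z ∈ frontier G ↔
      ∃ r ∈ Ico 0 δ, z = p + r * u r ∨ z = p + r * v r) :
    sector p u v δ ⊆ G ∨ sector p u v δ ⊆ (closure G)ᶜ := by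
  refine isPreconnected_iff_subset_of_disjoint.1 (hpair.isPreconnected_sector (p := p)) G
    (closure G)ᶜ hG.isOpen isClosed_closure.isOpen_compl ?_ ?_
  · intro z hz
    by_contra hzn
    rw [mem_union, not_or, mem_compl_iff, not_not] at hzn
    have hzf : z ∈ frontier G := by rw [hG.isOpen.frontier_eq]; exact ⟨hzn.2, hzn.1⟩
    obtain ⟨r', hr', h⟩ := (hΓ z (hpair.sector_subset_ball hz)).1 hzf
    obtain ⟨r, hr, s, hs, rfl⟩ := hz
    exact h.elim (hpair.sectorPoint_ne hr hs hr').1 (hpair.sectorPoint_ne hr hs hr').2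
  · rw [eq_empty_iff_forall_notMem]
    rintro x ⟨-, hx1, hx2⟩
    exact hx2 (subset_closure hx1)

/-- A ball around a boundary point, without the boundary, is the union of two connected sets each of
which has the whole boundary in the ball in its closure. So the boundary points that are limits of
the exterior form a subset that is open in the boundary; it is also closed and not empty, hence it
is the whole boundary, since the boundary is connected. -/
theorem IsPiecewiseAnalyticJordanDomain.mem_closure_exterior
    (hG : IsPiecewiseAnalyticJordanDomain G) (hne : (frontier (closure G)).Nonempty) {p : ℂ}
    (hp : p ∈ frontier G) : p ∈ closure (closure G)ᶜ := by
  have hfr : frontier G = closure G \ G := hG.isOpen.frontier_eq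
  have hlocal : ∀ p ∈ frontier G, p ∈ closure (closure G)ᶜ →
      ∃ δ > 0, ∀ q ∈ frontier G ∩ Metric.ball p δ, q ∈ closure (closure G)ᶜ := by
    intro p hp hpΩ
    obtain ⟨u, v, δ, hδ, -, hpair, hΓ⟩ := hG.boundary.exists_isArcPair hp one_pos
    refine ⟨δ, hδ, ?_⟩
    have hcl : ∀ u v : ℝ → ℂ, IsArcPair u v δ → (∀ z ∈ Metric.ball p δ, z ∈ frontier G ↔
        ∃ r ∈ Ico 0 δ, z = p + r * u r ∨ z = p + r * v r) →
        (sector p u v δ ∩ (closure G)ᶜ).Nonempty →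
        ∀ q ∈ frontier G ∩ Metric.ball p δ, q ∈ closure (closure G)ᶜ := by
      rintro u v hpair hΓ ⟨x, hxs, hxΩ⟩ q ⟨hq, hqb⟩
      have hsub := (hG.sector_subset hpair hΓ).resolve_left fun h => hxΩ (subset_closure (h hxs))
      refine closure_mono hsub ?_
      obtain ⟨r, hr, h⟩ := (hΓ q hqb).1 hq
      rcases hr.1.eq_or_lt with rfl | hr0
      · have : q = p := by rcases h with rfl | rfl <;> simp
        rw [this]
        exact hpair.center_mem_closure_sector hδ
      · rcases h with rfl | rfl
        · exact IsArcPair.left_mem_closure_sector ⟨hr0, hr.2⟩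
        · exact hpair.right_mem_closure_sector ⟨hr0, hr.2⟩
    obtain ⟨x, hxb, hxΩ⟩ := mem_closure_iff.1 hpΩ _ Metric.isOpen_ball (Metric.mem_ball_self hδ)
    have hxf : x ∉ frontier G := fun h => hxΩ (hfr ▸ h).1
    rcases hpair.mem_sector_or_mem_sector hxb fun r hr =>
      ⟨fun h => hxf ((hΓ x hxb).2 ⟨r, hr, Or.inl h⟩),
        fun h => hxf ((hΓ x hxb).2 ⟨r, hr, Or.inr h⟩)⟩ with h | h
    · exact hcl u v hpair hΓ ⟨x, h, hxΩ⟩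
    · exact hcl v u hpair.symm (fun z hz => (hΓ z hz).trans (by simp only [or_comm])) ⟨x, h, hxΩ⟩
  by_contra hpn
  choose! δ hδ hb using hlocal
  have h1 := hG.boundary.isPreconnected
    (⋃ q ∈ frontier G ∩ closure (closure G)ᶜ, Metric.ball q (δ q)) (closure (closure G)ᶜ)ᶜ
    (isOpen_biUnion fun _ _ => Metric.isOpen_ball) isClosed_closure.isOpen_compl ?_ ?_
    ⟨p, hp, hpn⟩
  · obtain ⟨x, hx, hx1, hx2⟩ := h1
    obtain ⟨q, hq, hxq⟩ := mem_iUnion₂.1 hx1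
    exact hx2 (hb q hq.1 hq.2 x ⟨hx, hxq⟩)
  · intro x hx
    by_cases hxΩ : x ∈ closure (closure G)ᶜ
    · exact Or.inl (mem_iUnion₂.2 ⟨x, ⟨hx, hxΩ⟩, Metric.mem_ball_self (hδ x hx hxΩ)⟩)
    · exact Or.inr hxΩ
  · obtain ⟨q, hq⟩ := hne
    rw [frontier_eq_closure_inter_closure, closure_closure] at hq
    have hqf : q ∈ frontier G := by
      rw [frontier_eq_closure_inter_closure]
      exact ⟨hq.1, closure_mono (compl_subset_compl.2 subset_closure) hq.2⟩
    exact ⟨q, hqf, mem_iUnion₂.2 ⟨q, ⟨hqf, hq.2⟩, Metric.mem_ball_self (hδ q hqf hq.2)⟩⟩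

/-- Near a boundary point, the domain is one of the two sectors cut out by the boundary, the other
one being contained in the exterior. -/
theorem IsPiecewiseAnalyticJordanDomain.isAccessibleBoundaryPoint
    (hG : IsPiecewiseAnalyticJordanDomain G) (hne : (frontier (closure G)).Nonempty) {p : ℂ}
    (hp : p ∈ frontier G) : IsAccessibleBoundaryPoint G p := by
  have hfr : frontier G = closure G \ G := hG.isOpen.frontier_eq
  have hpΩ := hG.mem_closure_exterior hne hp
  have hpG : p ∈ closure G := (hfr ▸ hp).1
  have hmain : ∀ ε > 0, ∃ δ > 0, δ ≤ ε ∧ ∃ u v : ℝ → ℂ, IsArcPair u v δ ∧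
      Metric.ball p δ ∩ G = sector p u v δ := by
    intro ε hε
    obtain ⟨u, v, δ, hδ, hδε, hpair, hΓ⟩ := hG.boundary.exists_isArcPair hp hε
    have hΓ' : ∀ z ∈ Metric.ball p δ, z ∈ frontier G ↔
        ∃ r ∈ Ico 0 δ, z = p + r * v r ∨ z = p + r * u r := fun z hz =>
      (hΓ z hz).trans (by simp only [or_comm])
    refine ⟨δ, hδ, hδε, ?_⟩
    have hcov : ∀ z ∈ Metric.ball p δ, z ∉ frontier G →
        z ∈ sector p u v δ ∨ z ∈ sector p v u δ := fun z hz hzf =>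
      hpair.mem_sector_or_mem_sector hz fun r hr =>
        ⟨fun h => hzf ((hΓ z hz).2 ⟨r, hr, Or.inl h⟩), fun h => hzf ((hΓ z hz).2 ⟨r, hr, Or.inr h⟩)⟩
    have hnG : ∀ z ∈ G, z ∉ frontier G := fun z hz h => (hfr ▸ h).2 hz
    obtain ⟨x, hxb, hxG⟩ := mem_closure_iff.1 hpG _ Metric.isOpen_ball (Metric.mem_ball_self hδ)
    obtain ⟨y, hyb, hyΩ⟩ := mem_closure_iff.1 hpΩ _ Metric.isOpen_ball (Metric.mem_ball_self hδ)
    have hyf : y ∉ frontier G := fun h => hyΩ (hfr ▸ h).1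
    rcases hG.sector_subset hpair hΓ with h1 | h1
    · have hyv := (hcov y hyb hyf).resolve_left fun h => hyΩ (subset_closure (h1 h))
      have h2 := (hG.sector_subset hpair.symm hΓ').resolve_left
        fun h => hyΩ (subset_closure (h hyv))
      refine ⟨u, v, hpair, subset_antisymm ?_ (subset_inter hpair.sector_subset_ball h1)⟩
      rintro z ⟨hzb, hzG⟩
      exact (hcov z hzb (hnG z hzG)).resolve_right fun h => h2 h (subset_closure hzG)
    · have hxv := (hcov x hxb (hnG x hxG)).resolve_left fun h => h1 h (subset_closure hxG)
      have h2 := (hG.sector_subset hpair.symm hΓ').resolve_right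
        fun h => h hxv (subset_closure hxG)
      refine ⟨v, u, hpair.symm, subset_antisymm ?_ (subset_inter hpair.symm.sector_subset_ball h2)⟩
      rintro z ⟨hzb, hzG⟩
      exact (hcov z hzb (hnG z hzG)).resolve_left fun h => h1 h (subset_closure hzG)
  refine ⟨(hfr ▸ hp).2, fun ε hε => ?_, fun ε hε => ?_⟩
  · obtain ⟨δ, hδ, hδε, u, v, hpair, heq⟩ := hmain ε hε
    exact ⟨Metric.ball p δ, Metric.ball_mem_nhds p hδ, Metric.ball_subset_ball hδε,
      heq ▸ hpair.isPreconnected_sector⟩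
  · obtain ⟨δ, hδ, hδε, u, v, hpair, heq⟩ := hmain ε hε
    obtain ⟨q, γ, hγ⟩ := hpair.exists_path_sector (p := p) hδ
    refine ⟨q, γ, fun t ht => ?_⟩
    have := hγ t ht
    rw [← heq] at this
    exact ⟨this.2, Metric.ball_subset_ball hδε this.1⟩

end

/-! ### Branches of fractional powers -/

namespace IsPowerBranch

variable {a : ℂ} {k m : ℕ} {φ φ' : ℂ → ℂ} {V : Set ℂ}

theorem mono (h : IsPowerBranch a k m φ V) {W : Set ℂ} (hW : W ⊆ V) : IsPowerBranch a k m φ W :=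
  ⟨h.1.mono hW, fun z hz => h.2 z (hW hz)⟩

theorem ne_zero (h : IsPowerBranch a k m φ V) (hm : 0 < m) {z : ℂ} (hz : z ∈ V) : φ z ≠ 0 := by
  intro h0
  have := h.2 z hz
  rw [h0, zero_pow hm.ne', zero_mul] at this
  exact zero_ne_one this

theorem ne_center (h : IsPowerBranch a k m φ V) (hk : 0 < k) {z : ℂ} (hz : z ∈ V) : z ≠ a := by
  rintro rfl
  have := h.2 z hz
  rw [sub_self, zero_pow hk.ne', mul_zero] at this
  exact zero_ne_one this

theorem hasDerivAt (h : IsPowerBranch a k m φ V) (hV : IsOpen V) (hk : 0 < k) (hm : 0 < m) {z : ℂ}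
    (hz : z ∈ V) : HasDerivAt φ (-(k / m : ℂ) * (φ z / (z - a))) z := by
  have hd := (h.1.differentiableAt (hV.mem_nhds hz)).hasDerivAt
  have h1 : HasDerivAt (fun z => φ z ^ m * (z - a) ^ k)
      ((m * φ z ^ (m - 1) * deriv φ z) * (z - a) ^ k +
        φ z ^ m * (k * (z - a) ^ (k - 1) * 1)) z :=
    (hd.pow m).mul (((hasDerivAt_id z).sub_const a).pow k)
  have h2 : HasDerivAt (fun z => φ z ^ m * (z - a) ^ k) 0 z := by
    refine (hasDerivAt_const z (1 : ℂ)).congr_of_eventuallyEq ?_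
    filter_upwards [hV.mem_nhds hz] with w hw using h.2 w hw
  have h3 := h1.unique h2
  have hza : z - a ≠ 0 := sub_ne_zero.2 (h.ne_center hk hz)
  have hm0 : (m : ℂ) ≠ 0 := by exact_mod_cast hm.ne'
  have h5 := h.2 z hz
  have hkz : (z - a) ^ (k - 1) * (z - a) = (z - a) ^ k := pow_sub_one_mul hk.ne' _
  have hmz : φ z ^ (m - 1) * φ z = φ z ^ m := pow_sub_one_mul hm.ne' _
  have h6 : (φ z ^ m * (z - a) ^ k) * (m * deriv φ z * (z - a) + k * φ z) = 0 := by
    rw [← hkz, ← hmz] at h3 ⊢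
    linear_combination φ z * (z - a) * h3
  rw [h5, one_mul] at h6
  have h7 : deriv φ z = -(k / m : ℂ) * (φ z / (z - a)) := by
    rw [neg_mul, div_mul_div_comm, ← neg_div, eq_div_iff (mul_ne_zero hm0 hza)]
    linear_combination h6
  rwa [h7] at hd

/-- Two branches on a connected open set differ by a constant factor, since both solve
`φ' = -(k / m) * φ / (z - a)`. -/
theorem exists_eq_const_mul (h : IsPowerBranch a k m φ V) (h' : IsPowerBranch a k m φ' V)
    (hV : IsOpen V) (hVc : IsPreconnected V) (hk : 0 < k) (hm : 0 < m) :
    ∃ ω : ℂ, ∀ z ∈ V, φ z = ω * φ' z := by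
  rcases V.eq_empty_or_nonempty with rfl | ⟨x, hx⟩
  · exact ⟨0, fun z hz => hz.elim⟩
  have hq : ∀ z ∈ V, HasDerivAt (fun z => φ z / φ' z) 0 z := by
    intro z hz
    have h0 := h'.ne_zero hm hz
    have h1 := (h.hasDerivAt hV hk hm hz).div (h'.hasDerivAt hV hk hm hz) h0
    have h2 : (-(k / m : ℂ) * (φ z / (z - a)) * φ' z - φ z * (-(k / m : ℂ) * (φ' z / (z - a)))) /
        φ' z ^ 2 = 0 := by
      rw [div_eq_zero_iff]
      left
      ring
    rw [h2] at h1
    exact h1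
  refine ⟨φ x / φ' x, fun z hz => ?_⟩
  have := hV.is_const_of_deriv_eq_zero hVc
    (fun w hw => (hq w hw).differentiableAt.differentiableWithinAt) (fun w hw => (hq w hw).deriv)
    hz hx
  rw [← this, div_mul_cancel₀ _ (h'.ne_zero hm hz)]

end IsPowerBranch

/-- With `exp b = p - a`, the branch near `p` of `C * (z - a) ^ (-k / m)` given by the branch of
`log (z - a)` that takes the value `b` at `p`. -/
noncomputable def powerGerm (a : ℂ) (k m : ℕ) (C p b : ℂ) (z : ℂ) : ℂ :=
  C * Complex.exp (-(k / m : ℂ) * (b + Complex.log ((z - a) / (p - a))))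

theorem div_mem_slitPlane {a p z : ℂ} (hz : z ∈ Metric.ball p (dist p a)) :
    (z - a) / (p - a) ∈ Complex.slitPlane := by
  have hpa : p - a ≠ 0 := by
    intro h
    rw [sub_eq_zero.1 h, dist_self, Metric.ball_zero] at hz
    exact hz
  have h1 : (z - a) / (p - a) = 1 + (z - p) / (p - a) := by field_simp; ring
  rw [h1]
  apply Complex.mem_slitPlane_of_norm_lt_one
  rw [norm_div, div_lt_one (norm_pos_iff.2 hpa), ← dist_eq_norm, ← dist_eq_norm]
  exact hz

theorem exp_add_log {a p b z : ℂ} (hpa : p ≠ a) (hza : z ≠ a) (hb : Complex.exp b = p - a) :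
    Complex.exp (b + Complex.log ((z - a) / (p - a))) = z - a := by
  have h1 := sub_ne_zero.2 hpa
  rw [Complex.exp_add, hb, Complex.exp_log (div_ne_zero (sub_ne_zero.2 hza) h1)]
  field_simp

theorem isPowerBranch_powerGerm {a : ℂ} {k m : ℕ} {C p b : ℂ} (hm : 0 < m) (hC : C ^ m = 1)
    (hb : Complex.exp b = p - a) :
    IsPowerBranch a k m (powerGerm a k m C p b) (Metric.ball p (dist p a)) := by
  have hpa : p ≠ a := fun h => Complex.exp_ne_zero b (hb.trans (sub_eq_zero.2 h))
  refine ⟨?_, fun z hz => ?_⟩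
  · intro z hz
    have h1 := div_mem_slitPlane hz
    unfold powerGerm
    have h2 : DifferentiableAt ℂ (fun z => Complex.log ((z - a) / (p - a))) z :=
      DifferentiableAt.clog (by fun_prop) h1
    exact (((h2.const_add _).const_mul _).cexp.const_mul _).differentiableWithinAt
  · have hza : z ≠ a := by
      rintro rfl
      rw [Metric.mem_ball, dist_comm] at hz
      exact lt_irrefl _ hz
    have hm0 : (m : ℂ) ≠ 0 := by exact_mod_cast hm.ne'
    have h1 := exp_add_log hpa hza hb
    set L := b + Complex.log ((z - a) / (p - a)) with hL
    rw [powerGerm, ← hL, mul_pow, hC, one_mul, ← Complex.exp_nat_mul, ← h1, ← Complex.exp_nat_mul,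
      ← Complex.exp_add, ← Complex.exp_zero]
    congr 1
    field_simp
    ring

theorem exists_isPowerBranch_ball {a p : ℂ} (hpa : p ≠ a) (k : ℕ) {m : ℕ} (hm : 0 < m) :
    ∃ φ, IsPowerBranch a k m φ (Metric.ball p (dist p a)) :=
  ⟨_, isPowerBranch_powerGerm hm (one_pow m) (Complex.exp_log (sub_ne_zero.2 hpa))⟩

/-! ### Analytic continuation along paths -/

/-- Analytic continuations along a path that agree at one parameter agree at all parameters of a
connected open set. -/
theorem eventuallyEq_of_continuation {γ : C(unitInterval, ℂ)} {J : Set unitInterval}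
    (hJo : IsOpen J) (hJ : IsPreconnected J) {t₀ : unitInterval} (h₀ : t₀ ∈ J)
    {g g' : unitInterval → ℂ → ℂ} (hg : ∀ t ∈ J, AnalyticAt ℂ (g t) (γ t))
    (hg' : ∀ t ∈ J, AnalyticAt ℂ (g' t) (γ t))
    (hgc : ∀ t ∈ J, ∀ᶠ s in 𝓝 t, g s =ᶠ[𝓝 (γ s)] g t)
    (hgc' : ∀ t ∈ J, ∀ᶠ s in 𝓝 t, g' s =ᶠ[𝓝 (γ s)] g' t)
    (hstart : g t₀ =ᶠ[𝓝 (γ t₀)] g' t₀) : ∀ t ∈ J, g t =ᶠ[𝓝 (γ t)] g' t := by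
  have key : J ⊆ {t | t ∈ J ∧ g t =ᶠ[𝓝 (γ t)] g' t} := by
    refine hJ.subset_of_closure_inter_subset ?_ ⟨t₀, h₀, h₀, hstart⟩ ?_
    · rw [isOpen_iff_mem_nhds]
      rintro t ⟨htJ, ht⟩
      filter_upwards [hgc t htJ, hgc' t htJ, hJo.mem_nhds htJ,
        γ.continuous.continuousAt.eventually ht.eventuallyEq_nhds] with s h1 h2 h3 h4
      exact ⟨h3, h1.trans (h4.trans h2.symm)⟩
    · rintro t ⟨htc, htJ⟩
      refine ⟨htJ, ?_⟩
      obtain ⟨ε, hε, hb⟩ := Metric.eventually_nhds_iff_ball.1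
        ((hg t htJ).eventually_analyticAt.and (hg' t htJ).eventually_analyticAt)
      have h1 : ∀ᶠ s in 𝓝 t, γ s ∈ Metric.ball (γ t) ε :=
        γ.continuous.continuousAt.eventually (Metric.ball_mem_nhds _ hε)
      obtain ⟨s, ⟨h2, h3, h4⟩, hsJ, h5⟩ := mem_closure_iff_nhds.1 htc _
        (h1.and ((hgc t htJ).and (hgc' t htJ)))
      have h6 := AnalyticOnNhd.eqOn_of_preconnected_of_eventuallyEq (fun z hz => (hb z hz).1)
        (fun z hz => (hb z hz).2) Metric.isPreconnected_ball h2 (h3.symm.trans (h5.trans h4))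
      exact h6.eventuallyEq_of_mem (Metric.ball_mem_nhds _ hε)
  exact fun t ht => (key ht).2

/-- A branch of a fractional power can be continued along every path that avoids its branch point:
the logarithm lifts the path. -/
theorem IsPowerBranch.exists_continuation {a : ℂ} {k m : ℕ} {φ : ℂ → ℂ} {G : Set ℂ}
    (hφ : IsPowerBranch a k m φ G) (hG : IsOpen G) (hk : 0 < k) (hm : 0 < m)
    {γ : C(unitInterval, ℂ)} (hγ0 : γ 0 ∈ G) (hγ : ∀ t, γ t ≠ a) :
    ∃ b, IsContinuationAlong φ γ b ∧
      ∀ t, IsPowerBranch a k m (b t) (Metric.ball (γ t) (dist (γ t) a)) := by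
  let γ' : C(unitInterval, {z : ℂ // z ≠ 0}) :=
    ⟨fun t => ⟨γ t - a, sub_ne_zero.2 (hγ t)⟩, by fun_prop⟩
  obtain ⟨l, hl, -⟩ := Complex.isCoveringMap_exp.exists_path_lifts γ'
    (Complex.log (γ 0 - a)) (Subtype.ext (Complex.exp_log (sub_ne_zero.2 (hγ 0))).symm)
  have hexp : ∀ t, Complex.exp (l t) = γ t - a := fun t => congrArg Subtype.val (congrFun hl t)
  have hm0 : (m : ℂ) ≠ 0 := by exact_mod_cast hm.ne'
  set C : ℂ := φ (γ 0) * Complex.exp ((k / m : ℂ) * l 0) with hCdef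
  have hC : C ^ m = 1 := by
    rw [hCdef, mul_pow, ← Complex.exp_nat_mul, ← hφ.2 _ hγ0, ← hexp 0, ← Complex.exp_nat_mul]
    congr 2
    field_simp
  have hpb : ∀ t, IsPowerBranch a k m (powerGerm a k m C (γ t) (l t))
      (Metric.ball (γ t) (dist (γ t) a)) := fun t => isPowerBranch_powerGerm hm hC (hexp t)
  have hpos : ∀ t, 0 < dist (γ t) a := fun t => dist_pos.2 (hγ t)
  refine ⟨fun t => powerGerm a k m C (γ t) (l t), ⟨?_, fun t => ?_, fun t => ?_⟩, hpb⟩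
  · obtain ⟨ε, hε, hb⟩ := Metric.isOpen_iff.1 (hG.inter Metric.isOpen_ball) (γ 0)
      ⟨hγ0, Metric.mem_ball_self (hpos 0)⟩
    obtain ⟨ω, hω⟩ := ((hpb 0).mono (hb.trans inter_subset_right)).exists_eq_const_mul
      (hφ.mono (hb.trans inter_subset_left)) Metric.isOpen_ball Metric.isPreconnected_ball hk hm
    have h1 := hω _ (Metric.mem_ball_self hε)
    have h2 : powerGerm a k m C (γ 0) (l 0) (γ 0) = φ (γ 0) := by
      rw [powerGerm, div_self (sub_ne_zero.2 (hγ 0)), Complex.log_one, add_zero, hCdef, mul_assoc,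
        ← Complex.exp_add]
      simp
    have hω1 : ω = 1 := by
      rw [h2] at h1
      exact (mul_right_cancel₀ (hφ.ne_zero hm hγ0) (h1.symm.trans (one_mul _).symm))
    filter_upwards [Metric.ball_mem_nhds _ hε] with w hw
    rw [hω w hw, hω1, one_mul]
  · exact (hpb t).1.analyticAt (Metric.ball_mem_nhds _ (hpos t))
  · -- near `(t, γ t)` the two logarithms are close to each other, hence equal
    let D : unitInterval × ℂ → ℂ := fun x => (l x.1 + Complex.log ((x.2 - a) / (γ x.1 - a))) -
      (l t + Complex.log ((x.2 - a) / (γ t - a)))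
    have hD0 : D (t, γ t) = 0 := by simp [D]
    have hDc : ContinuousAt D (t, γ t) := by
      have h1 : (γ t - a) / (γ t - a) ∈ Complex.slitPlane := by
        rw [div_self (sub_ne_zero.2 (hγ t))]; exact Complex.one_mem_slitPlane
      have hγc : ContinuousAt (fun x : unitInterval × ℂ => γ x.1 - a) (t, γ t) := by fun_prop
      have hzc : ContinuousAt (fun x : unitInterval × ℂ => x.2 - a) (t, γ t) := by fun_prop
      have hlc : ContinuousAt (fun x : unitInterval × ℂ => l x.1) (t, γ t) := by fun_prop
      exact (hlc.add ((hzc.div hγc (sub_ne_zero.2 (hγ t))).clog h1)).sub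
        (continuousAt_const.add ((hzc.div_const _).clog h1))
    have hsmall : ∀ᶠ x in 𝓝 (t, γ t), ‖D x‖ < 2 * Real.pi := by
      refine hDc.norm.eventually_lt continuousAt_const ?_
      rw [hD0, norm_zero]
      exact Real.two_pi_pos
    have hne : ∀ᶠ x : unitInterval × ℂ in 𝓝 (t, γ t), x.2 ≠ a :=
      continuousAt_snd.eventually_ne (hγ t)
    have hD : ∀ᶠ x in 𝓝 (t, γ t), D x = 0 := by
      filter_upwards [hsmall, hne] with x hx hxa
      have h1 : Complex.exp (D x) = 1 := by
        rw [Complex.exp_sub, exp_add_log (hγ _) hxa (hexp _), exp_add_log (hγ _) hxa (hexp _),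
          div_self (sub_ne_zero.2 hxa)]
      obtain ⟨n, hn⟩ := Complex.exp_eq_one_iff.1 h1
      rw [hn, norm_mul, norm_mul, norm_mul, Complex.norm_I, Complex.norm_intCast, Complex.norm_two,
        Complex.norm_real, Real.norm_of_nonneg Real.pi_pos.le, mul_one] at hx
      have h2 : |(n : ℝ)| < 1 := by
        by_contra h
        have := mul_le_mul_of_nonneg_right (not_lt.1 h) Real.two_pi_pos.le
        linarith
      have h3 : n = 0 := by
        rw [← Int.abs_lt_one_iff]
        exact_mod_cast h2
      rw [hn, h3]; simp
    have hcurve : Tendsto (fun s => (s, γ s)) (𝓝 t) (𝓝 (t, γ t)) :=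
      (continuous_id.prodMk γ.continuous).continuousAt
    filter_upwards [hcurve.eventually hD.eventually_nhds] with s hs
    have h1 : Tendsto (fun w => (s, w)) (𝓝 (γ s)) (𝓝 (s, γ s)) :=
      (Continuous.prodMk_right s).continuousAt
    filter_upwards [h1.eventually hs] with w hw
    rw [powerGerm, powerGerm, sub_eq_zero.1 hw]

theorem exists_path_avoiding {S F : Set ℂ} (hS : IsOpen S) (hSc : IsPreconnected S)
    (hF : F.Finite) {x y : ℂ} (hx : x ∈ S \ F) (hy : y ∈ S \ F) :
    ∃ γ : Path x y, ∀ t, γ t ∈ S \ F := by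
  have h1 : IsConnected (S \ F) := ⟨⟨x, hx⟩, hSc.diff_finite_of_isOpen hS hF⟩
  obtain ⟨γ, hγ⟩ := ((hS.sdiff hF.isClosed).isConnected_iff_isPathConnected.1 h1).joinedIn x hx y hy
  exact ⟨γ, hγ⟩

theorem IsAccessibleBoundaryPoint.locallyExtends {S N : Set ℂ} {p x : ℂ} {h e : ℂ → ℂ} {ε : ℝ}
    (hS : IsOpen S) (hh : DifferentiableOn ℂ h S) (he : DifferentiableOn ℂ e (Metric.ball p ε))
    (hN : N ∈ 𝓝 p) (hNb : N ⊆ Metric.ball p ε) (hNc : IsPreconnected (N ∩ S)) (hx : x ∈ N ∩ S)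
    (heq : e =ᶠ[𝓝 x] h) : LocallyExtends S h p := by
  obtain ⟨δ, hδ, hb⟩ := Metric.mem_nhds_iff.1 hN
  refine ⟨δ, hδ, e, he.mono (hb.trans hNb), ?_⟩
  have h1 : AnalyticOnNhd ℂ e (N ∩ S) := fun z hz =>
    he.analyticAt (Metric.isOpen_ball.mem_nhds (hNb hz.1))
  have h2 : AnalyticOnNhd ℂ h (N ∩ S) := fun z hz => hh.analyticAt (hS.mem_nhds hz.2)
  have h3 := h1.eqOn_of_preconnected_of_eventuallyEq h2 hNc hx heq
  exact fun z hz => h3 ⟨hb hz.2, hz.1⟩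

section Decomposition

variable {G S U : Set ℂ} {f h : ℂ → ℂ} {κ : ℕ} {z : Fin κ → ℂ} {k m : Fin κ → ℕ}
  {φ : Fin κ → ℂ → ℂ} {c : Fin κ → ℂ}

/-- The decomposition of `f` into fractional powers and a function holomorphic on `S` persists along
paths in `S`. -/
theorem eventuallyEq_sum_of_continuation (hG : IsOpen G) (hS : IsOpen S)
    (hh : DifferentiableOn ℂ h S) (hf : ∀ w ∈ G, f w = ∑ j, c j * φ j w + h w)
    {γ : C(unitInterval, ℂ)} (hγ0 : γ 0 ∈ G) {J : Set unitInterval} (hJo : IsOpen J)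
    (hJ : IsPreconnected J) (h₀ : 0 ∈ J) (hγ : ∀ t ∈ J, γ t ∈ S) {g : unitInterval → ℂ → ℂ}
    (hg : IsContinuationAlong f γ g) {b : Fin κ → unitInterval → ℂ → ℂ}
    (hb : ∀ j, IsContinuationAlong (φ j) γ (b j)) :
    ∀ t ∈ J, g t =ᶠ[𝓝 (γ t)] fun w => ∑ j, c j * b j t w + h w := by
  refine eventuallyEq_of_continuation hJo hJ h₀ (fun t _ => hg.analytic t) ?_
    (fun t _ => hg.compatible t) ?_ ?_
  · intro t ht
    refine AnalyticAt.add ?_ (hh.analyticAt (hS.mem_nhds (hγ t ht)))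
    exact Finset.analyticAt_fun_sum _ fun j _ => analyticAt_const.mul ((hb j).analytic t)
  · intro t _
    filter_upwards [eventually_all.2 fun j => (hb j).compatible t] with s hs
    filter_upwards [eventually_all.2 hs] with w hw
    simp only [hw]
  · filter_upwards [hg.start, eventually_all.2 fun j => (hb j).start, hG.mem_nhds hγ0]
      with w h1 h2 h3
    rw [h1, hf w h3]
    simp only [h2]

/-- The holomorphic part of `f` extends across a boundary point that is not a singularity: it is the
difference of the continuations of `f` and of the fractional powers. -/
theorem locallyExtends_of_notMem_range (hG : IsOpen G) (hGne : G.Nonempty) (hS : IsOpen S)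
    (hSc : IsPreconnected S) (hGS : G ⊆ S) (hSU : S ⊆ U) (hk : ∀ j, 0 < k j) (hm : ∀ j, 0 < m j)
    (hφ : ∀ j, IsPowerBranch (z j) (k j) (m j) (φ j) G)
    (hcont : ∀ γ : C(unitInterval, ℂ), IsPathFrom G (U \ range z) γ →
      ∃ g, IsContinuationAlong f γ g)
    (hh : DifferentiableOn ℂ h S) (hf : ∀ w ∈ G, f w = ∑ j, c j * φ j w + h w) {p : ℂ}
    (hp : IsAccessibleBoundaryPoint S p) (hpU : p ∈ U \ range z) : LocallyExtends S h p := by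
  have hfin : (range z).Finite := finite_range z
  obtain ⟨x₀, hx₀⟩ := hGne
  have hx₀z : x₀ ∉ range z := by
    rintro ⟨j, rfl⟩
    exact (hφ j).ne_center (hk j) hx₀ rfl
  obtain ⟨δ, hδ, hδz⟩ := Metric.isOpen_iff.1 hfin.isClosed.isOpen_compl p hpU.2
  obtain ⟨q, lam, hlam⟩ := hp.exists_path δ hδ
  have hq : q ∈ S \ range z := by
    have h1 := hlam 0 (by simp)
    rw [lam.source] at h1
    exact ⟨h1.1, hδz h1.2⟩
  obtain ⟨α, hα⟩ := exists_path_avoiding hS hSc hfin ⟨hGS hx₀, hx₀z⟩ hq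
  let γ : C(unitInterval, ℂ) := (α.trans lam).toContinuousMap
  have hγ0 : γ 0 = x₀ := (α.trans lam).source
  have hγ1 : γ 1 = p := (α.trans lam).target
  have hγS : ∀ t, t ≠ 1 → γ t ∈ S \ range z := by
    intro t ht
    change (α.trans lam) t ∈ _
    rw [Path.trans_apply]
    split_ifs with h1
    · exact hα _
    · have h2 := hlam ⟨2 * t - 1, unitInterval.two_mul_sub_one_mem_iff.2 ⟨(not_le.1 h1).le, t.2.2⟩⟩
        (fun h => ht (Subtype.ext (by
          have h3 : 2 * (t : ℝ) - 1 = 1 := congrArg Subtype.val h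
          change (t : ℝ) = 1
          linarith)))
      exact ⟨h2.1, hδz h2.2⟩
  have hγU : ∀ t, γ t ∈ U \ range z := by
    intro t
    by_cases ht : t = 1
    · rw [ht, hγ1]; exact hpU
    · exact ⟨hSU (hγS t ht).1, (hγS t ht).2⟩
  have hγ0G : γ 0 ∈ G := hγ0 ▸ hx₀
  obtain ⟨g, hg⟩ := hcont γ ⟨hγ0G, hγU⟩
  choose b hb hbp using fun j => (hφ j).exists_continuation hG (hk j) (hm j) hγ0G
    fun t h => (hγU t).2 ⟨j, h.symm⟩
  have hag := eventuallyEq_sum_of_continuation hG hS hh hf hγ0G (J := Iio 1) isOpen_Iio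
    isPreconnected_Iio (mem_Iio.2 zero_lt_one) (fun t ht => (hγS t (ne_of_lt ht)).1) hg hb
  have hea : AnalyticAt ℂ (fun w => g 1 w - ∑ j, c j * b j 1 w) p := by
    rw [← hγ1]
    exact (hg.analytic 1).sub
      (Finset.analyticAt_fun_sum _ fun j _ => analyticAt_const.mul ((hb j).analytic 1))
  obtain ⟨ε, hε, hball⟩ := Metric.eventually_nhds_iff_ball.1 hea.eventually_analyticAt
  obtain ⟨N, hN, hNb, hNc⟩ := hp.exists_nhds ε hε
  have hγN : ∀ᶠ s in 𝓝 (1 : unitInterval), γ s ∈ N :=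
    γ.continuous.continuousAt.eventually (by rw [hγ1]; exact hN)
  have hlt : (𝓝[<] (1 : unitInterval)).NeBot := nhdsLT_neBot_of_exists_lt ⟨0, zero_lt_one⟩
  have hev := (hγN.and ((hg.compatible 1).and
    (eventually_all.2 fun j => (hb j).compatible 1))).filter_mono
      (nhdsWithin_le_nhds (s := Iio (1 : unitInterval)))
  obtain ⟨s, ⟨hsN, hs1, hs2⟩, hs⟩ := (hev.and self_mem_nhdsWithin).exists
  refine IsAccessibleBoundaryPoint.locallyExtends hS hh
    (fun w hw => (hball w hw).differentiableAt.differentiableWithinAt) hN hNb hNc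
    ⟨hsN, (hγS s (ne_of_lt hs)).1⟩ ?_
  filter_upwards [hag s hs, hs1, eventually_all.2 hs2] with w h1 h2 h3
  simp only [← h3]
  rw [← h2, h1]
  ring

/-- At a pole there is one coefficient of the fractional power for which the holomorphic part of `f`
extends across the pole: the coefficient of the continuation of `f` along one path that ends near
the pole. -/
theorem exists_coefficient_of_hasRationalPole (hG : IsOpen G) (hGne : G.Nonempty) (hS : IsOpen S)
    (hSc : IsPreconnected S) (hGS : G ⊆ S) (hSU : S ⊆ U) (hk : ∀ j, 0 < k j) (hm : ∀ j, 0 < m j)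
    (hzinj : Function.Injective z)
    (hφ : ∀ j, IsPowerBranch (z j) (k j) (m j) (φ j) G)
    (hcont : ∀ γ : C(unitInterval, ℂ), IsPathFrom G (U \ range z) γ →
      ∃ g, IsContinuationAlong f γ g) (j : Fin κ)
    (hpole : HasRationalPole f G (U \ range z) (z j) (k j) (m j))
    (hp : IsAccessibleBoundaryPoint S (z j)) :
    ∃ c₀ : ℂ, ∀ (c : Fin κ → ℂ) (h : ℂ → ℂ), c j = c₀ → DifferentiableOn ℂ h S →
      (∀ w ∈ G, f w = ∑ j, c j * φ j w + h w) → LocallyExtends S h (z j) := by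
  have hfin : (range z).Finite := finite_range z
  obtain ⟨x₀, hx₀⟩ := hGne
  have hx₀z : x₀ ∉ range z := by
    rintro ⟨j, rfl⟩
    exact (hφ j).ne_center (hk j) hx₀ rfl
  obtain ⟨r, hr, hpole⟩ := hpole
  obtain ⟨δ, hδ, hδz⟩ := Metric.isOpen_iff.1
    (Metric.isOpen_ball.inter (hfin.subset (sdiff_subset (s := range z) (t := {z j}))).isClosed.isOpen_compl)
    (z j) ⟨Metric.mem_ball_self hr, fun h => h.2 rfl⟩
  obtain ⟨N, hN, hNb, hNc⟩ := hp.exists_nhds δ hδ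
  obtain ⟨x, hxN, hxS⟩ := mem_closure_iff_nhds.1 hp.mem_closure N hN
  have hxj : x ≠ z j := fun h => hp.notMem (h ▸ hxS)
  have hxz : x ∉ range z := fun h => (hδz (hNb hxN)).2 ⟨h, hxj⟩
  obtain ⟨α, hα⟩ := exists_path_avoiding hS hSc hfin ⟨hGS hx₀, hx₀z⟩ ⟨hxS, hxz⟩
  let γ : C(unitInterval, ℂ) := α.toContinuousMap
  have hγ0 : γ 0 ∈ G := by change α 0 ∈ G; rwa [α.source]
  have hγ1 : γ 1 = x := α.target
  have hγU : IsPathFrom G (U \ range z) γ := ⟨hγ0, fun t => ⟨hSU (hα t).1, (hα t).2⟩⟩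
  obtain ⟨g, hg⟩ := hcont γ hγU
  choose b hb hbp using fun i => (hφ i).exists_continuation hG (hk i) (hm i) hγ0
    fun t h => (hα t).2 ⟨i, h.symm⟩
  have hbp1 : ∀ i, IsPowerBranch (z i) (k i) (m i) (b i 1) (Metric.ball x (dist x (z i))) :=
    fun i => by have := hbp i 1; rwa [hγ1] at this
  obtain ⟨c₁, -, H, hH, V, hV, φ', hφ', hgH⟩ := hpole γ g hγU hg
    (by rw [hγ1]; exact ⟨(hδz (hNb hxN)).1, hxj⟩)
  rw [hγ1] at hV
  have hdist : ∀ i, x ∈ Metric.ball x (dist x (z i)) := fun i =>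
    Metric.mem_ball_self (dist_pos.2 fun h => hxz ⟨i, h.symm⟩)
  obtain ⟨ε, hε, hεb⟩ := Metric.mem_nhds_iff.1
    (inter_mem hV (Metric.isOpen_ball.mem_nhds (hdist j)))
  obtain ⟨ω, hω⟩ := (hφ'.mono (hεb.trans inter_subset_left)).exists_eq_const_mul
    ((hbp1 j).mono (hεb.trans inter_subset_right)) Metric.isOpen_ball Metric.isPreconnected_ball
    (hk j) (hm j)
  -- near the pole, the branches of the other powers continue to a full neighbourhood
  have hother : ∀ i, i ≠ j → ∃ β : ℂ → ℂ, DifferentiableOn ℂ β (Metric.ball (z j) δ) ∧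
      b i 1 =ᶠ[𝓝 x] β := by
    intro i hij
    have hne : z j ≠ z i := fun h => hij (hzinj h).symm
    obtain ⟨β, hβ⟩ := exists_isPowerBranch_ball hne (k i) (hm i)
    have hsub : Metric.ball (z j) δ ⊆ Metric.ball (z j) (dist (z j) (z i)) := by
      refine Metric.ball_subset_ball (not_lt.1 fun hlt => ?_)
      exact (hδz (show z i ∈ Metric.ball (z j) δ by rwa [Metric.mem_ball, dist_comm])).2
        ⟨⟨i, rfl⟩, hne.symm⟩
    obtain ⟨ε', hε', hεb'⟩ := Metric.mem_nhds_iff.1 (inter_mem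
      (Metric.isOpen_ball.mem_nhds (hsub (hNb hxN))) (Metric.isOpen_ball.mem_nhds (hdist i)))
    obtain ⟨ω', hω'⟩ := ((hbp1 i).mono (hεb'.trans inter_subset_right)).exists_eq_const_mul
      (hβ.mono (hεb'.trans inter_subset_left)) Metric.isOpen_ball Metric.isPreconnected_ball
      (hk i) (hm i)
    exact ⟨fun w => ω' * β w, (hβ.1.mono hsub).const_mul ω',
      Filter.eventuallyEq_of_mem (Metric.ball_mem_nhds x hε') hω'⟩
  choose! β hβ hbβ using hother
  refine ⟨c₁ * ω, fun c h hc hh hf => ?_⟩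
  have hag := eventuallyEq_sum_of_continuation hG hS hh hf hγ0 isOpen_univ isPreconnected_univ
    (mem_univ 0) (fun t _ => (hα t).1) hg hb 1 (mem_univ 1)
  rw [hγ1] at hag
  refine IsAccessibleBoundaryPoint.locallyExtends (x := x) (ε := δ)
    (e := fun w => H w - ∑ i ∈ Finset.univ.erase j, c i * β i w) hS hh ?_ hN hNb hNc ⟨hxN, hxS⟩ ?_
  · refine (hH.mono fun w hw => (hδz hw).1).sub (DifferentiableOn.fun_sum fun i hi => ?_)
    exact (hβ i (Finset.ne_of_mem_erase hi)).const_mul _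
  · have hbβ' : ∀ᶠ w in 𝓝 x, ∀ i, i ≠ j → b i 1 w = β i w := by
      refine eventually_all.2 fun i => ?_
      by_cases hij : i = j
      · exact Eventually.of_forall fun w h => absurd hij h
      · filter_upwards [hbβ i hij] with w hw _ using hw
    filter_upwards [hag, hbβ', Metric.ball_mem_nhds x hε] with w h1 h2 h3
    have h4 := hgH w (hεb h3).1
    rw [hω w h3, h1, ← Finset.add_sum_erase _ _ (Finset.mem_univ j), hc] at h4
    rw [Finset.sum_congr rfl fun i hi => by rw [← h2 i (Finset.ne_of_mem_erase hi)]]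
    linear_combination -h4

end Decomposition

/-! ### Extension across the level curves and the decomposition into singular parts -/

section Growth

variable {G : Set ℂ} {Φ ψ : ℂ → ℂ}

theorem isAccessibleBoundaryPoint_filledDomain (hG : IsPiecewiseAnalyticJordanDomain G)
    (hne : G.Nonempty) (hψ : IsExteriorInverse G Φ ψ) {ρ : ℝ} (hρ : 1 ≤ ρ) {p : ℂ}
    (hp : p ∈ filledCompact G Φ ρ) (hpS : p ∉ filledDomain G Φ ρ) :
    IsAccessibleBoundaryPoint (filledDomain G Φ ρ) p := by
  rcases hρ.eq_or_lt with rfl | hρ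
  · rw [filledDomain_of_le le_rfl] at hpS ⊢
    have hpG : p ∈ closure G := hp.elim id fun h =>
      absurd (hψ.one_lt_norm p h.1) (not_lt.2 h.2)
    obtain ⟨q, hq⟩ := hψ.exists_mem_closure_inter hne
    refine hG.isAccessibleBoundaryPoint ⟨q, ?_⟩ ?_
    · rw [frontier_eq_closure_inter_closure, closure_closure]; exact hq
    · rw [hG.isOpen.frontier_eq]; exact ⟨hpG, hpS⟩
  · rw [mem_filledDomain_of_one_lt hρ, not_or] at hpS
    have h1 : ‖Φ p‖ ≤ ρ := hp.elim (fun h => absurd h hpS.1) fun h => h.2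
    exact hψ.isAccessibleBoundaryPoint hρ hpS.1
      (le_antisymm h1 (not_lt.1 fun h => hpS.2 ⟨hpS.1, h⟩))

theorem eqOn_filledDomain (hGo : IsOpen G) (hGc : IsPreconnected G) (hne : G.Nonempty)
    (hψ : IsExteriorInverse G Φ ψ) {ρ : ℝ} {h h' : ℂ → ℂ}
    (hh : DifferentiableOn ℂ h (filledDomain G Φ ρ))
    (hh' : DifferentiableOn ℂ h' (filledDomain G Φ ρ)) (heq : EqOn h h' G) :
    EqOn h h' (filledDomain G Φ ρ) := by
  obtain ⟨x, hx⟩ := hne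
  have ho := hψ.isOpen_filledDomain hGo ρ
  exact (hh.analyticOnNhd ho).eqOn_of_preconnected_of_eventuallyEq (hh'.analyticOnNhd ho)
    (hψ.isPreconnected_filledDomain ⟨x, hx⟩ hGc ρ) (subset_filledDomain ρ hx)
    (heq.eventuallyEq_of_mem (hGo.mem_nhds hx))

/-- If a function on `G` extends to `G_ρ₀`, and its extensions to the domains `G_ρ` with
`ρ₀ ≤ ρ < ρ₁` extend locally across the boundary, then it extends to `G_ρ₁`: the supremum of the
levels to which it extends is attained, and it cannot be less than `ρ₁`. -/
theorem exists_extension_filledDomain (hG : IsPiecewiseAnalyticJordanDomain G) (hne : G.Nonempty)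
    (hψ : IsExteriorInverse G Φ ψ) {F : ℂ → ℂ} {ρ₀ ρ₁ : ℝ} (h1 : 1 ≤ ρ₀) (h01 : ρ₀ ≤ ρ₁)
    (h₀ : ∃ h, DifferentiableOn ℂ h (filledDomain G Φ ρ₀) ∧ EqOn h F G)
    (hloc : ∀ ρ ∈ Ico ρ₀ ρ₁, ∀ h, DifferentiableOn ℂ h (filledDomain G Φ ρ) → EqOn h F G →
      ∀ p ∈ filledCompact G Φ ρ, p ∉ filledDomain G Φ ρ →
        LocallyExtends (filledDomain G Φ ρ) h p) :
    ∃ h, DifferentiableOn ℂ h (filledDomain G Φ ρ₁) ∧ EqOn h F G := by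
  classical
  have hGc : IsPreconnected G := hG.simplyConnected.isPathConnected.isConnected.isPreconnected
  let Q : ℝ → Prop := fun ρ => ∃ h, DifferentiableOn ℂ h (filledDomain G Φ ρ) ∧ EqOn h F G
  let A : Set ℝ := {ρ | ρ ∈ Icc ρ₀ ρ₁ ∧ Q ρ}
  have hA0 : ρ₀ ∈ A := ⟨⟨le_rfl, h01⟩, h₀⟩
  have hAb : BddAbove A := ⟨ρ₁, fun ρ hρ => hρ.1.2⟩
  set s := sSup A
  have hs0 : ρ₀ ≤ s := le_csSup hAb hA0
  have hs1 : s ≤ ρ₁ := csSup_le ⟨ρ₀, hA0⟩ fun ρ hρ => hρ.1.2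
  have hsA : s ∈ A := by
    by_contra hsA
    have hlt : ∀ ρ ∈ A, ρ < s := fun ρ hρ =>
      lt_of_le_of_ne (le_csSup hAb hρ) fun h => hsA (h ▸ hρ)
    have hs : 1 < s := h1.trans_lt (hlt ρ₀ hA0)
    refine hsA ⟨⟨hs0, hs1⟩, ?_⟩
    choose! h hh hhF using fun ρ (hρ : ρ ∈ A) => hρ.2
    have hex : ∀ x ∈ filledDomain G Φ s, ∃ ρ ∈ A, x ∈ filledDomain G Φ ρ := by
      intro x hx
      obtain ⟨ρ', hρ's, -, hxρ'⟩ := exists_mem_filledDomain_lt hs hx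
      obtain ⟨ρ, hρ, hlt⟩ := exists_lt_of_lt_csSup ⟨ρ₀, hA0⟩ hρ's
      exact ⟨ρ, hρ, filledDomain_mono hlt.le hxρ'⟩
    choose! r hrA hr using hex
    have hcons : ∀ ρ ∈ A, ∀ ρ' ∈ A, ∀ x ∈ filledDomain G Φ ρ, x ∈ filledDomain G Φ ρ' →
        h ρ x = h ρ' x := by
      have main : ∀ ρ ∈ A, ∀ ρ' ∈ A, ρ ≤ ρ' → ∀ x ∈ filledDomain G Φ ρ, h ρ x = h ρ' x := by
        intro ρ hρ ρ' hρ' hle x hx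
        exact eqOn_filledDomain hG.isOpen hGc hne hψ (hh ρ hρ)
          ((hh ρ' hρ').mono (filledDomain_mono hle))
          (fun y hy => (hhF ρ hρ hy).trans (hhF ρ' hρ' hy).symm) hx
      intro ρ hρ ρ' hρ' x hx hx'
      rcases le_total ρ ρ' with hle | hle
      · exact main ρ hρ ρ' hρ' hle x hx
      · exact (main ρ' hρ' ρ hρ hle x hx').symm
    have hH : ∀ ρ ∈ A, EqOn (fun x => h (r x) x) (h ρ) (filledDomain G Φ ρ) := by
      intro ρ hρ x hx
      have hxs := filledDomain_mono (hlt ρ hρ).le hx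
      exact hcons _ (hrA x hxs) ρ hρ x (hr x hxs) hx
    refine ⟨fun x => h (r x) x, fun x hx => ?_, fun x hx => ?_⟩
    · have hn := (hψ.isOpen_filledDomain hG.isOpen (r x)).mem_nhds (hr x hx)
      exact (((hh _ (hrA x hx)).differentiableAt hn).congr_of_eventuallyEq
        ((hH _ (hrA x hx)).eventuallyEq_of_mem hn)).differentiableWithinAt
    · exact (hH ρ₀ hA0 (subset_filledDomain ρ₀ hx)).trans (hhF ρ₀ hA0 hx)
  rcases hs1.lt_or_eq with hlt | heq
  swap
  · rw [← heq]; exact hsA.2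
  exfalso
  obtain ⟨h, hh, hhF⟩ := hsA.2
  have hs : 1 ≤ s := h1.trans hs0
  obtain ⟨W, H, hWo, hSW, hTW, hHd, hHh⟩ := exists_extension_of_locallyExtends
    (T := filledCompact G Φ s \ filledDomain G Φ s) (hψ.isOpen_filledDomain hG.isOpen s) hh
    (fun p hp => (isAccessibleBoundaryPoint_filledDomain hG hne hψ hs hp.1 hp.2).mem_closure)
    fun p hp => hloc s ⟨hs0, hlt⟩ h hh hhF p hp.1 hp.2
  have hKW : filledCompact G Φ s ⊆ W := fun x hx => by
    by_cases hxS : x ∈ filledDomain G Φ s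
    · exact hSW hxS
    · exact hTW ⟨hx, hxS⟩
  obtain ⟨ρ', hρ', hsub⟩ := hψ.exists_filledDomain_subset hG.bounded hs hWo hKW
  have hmem : min ρ' ρ₁ ∈ A := by
    refine ⟨⟨hs0.trans (le_min hρ'.le hlt.le), min_le_right _ _⟩, H, ?_, fun x hx => ?_⟩
    · exact hHd.mono ((filledDomain_mono (min_le_left _ _)).trans hsub)
    · exact (hHh (subset_filledDomain s hx)).trans (hhF hx)
  exact absurd (le_csSup hAb hmem) (not_le.2 (lt_min hρ' hlt))

/-- A branch on `G` of a fractional power extends to the largest domain `G_ρ` that does not contain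
the branch point. -/
theorem IsPowerBranch.exists_extension (hG : IsPiecewiseAnalyticJordanDomain G) (hne : G.Nonempty)
    (hψ : IsExteriorInverse G Φ ψ) {a : ℂ} (ha : a ∉ closure G) {k m : ℕ} (hk : 0 < k)
    (hm : 0 < m) {φ : ℂ → ℂ} (hφ : IsPowerBranch a k m φ G) :
    ∃ h, DifferentiableOn ℂ h (filledDomain G Φ ‖Φ a‖) ∧ EqOn h φ G := by
  have hGc : IsPreconnected G := hG.simplyConnected.isPathConnected.isConnected.isPreconnected
  refine exists_extension_filledDomain hG hne hψ le_rfl (hψ.one_lt_norm a ha).le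
    ⟨φ, ?_, fun x _ => rfl⟩ ?_
  · rw [filledDomain_of_le le_rfl]; exact hφ.1
  · intro ρ hρ h hh hhφ p hp hpS
    have hna : ∀ x ∈ filledCompact G Φ ρ, x ≠ a := by
      rintro x (hx | hx) rfl
      · exact ha hx
      · exact absurd hρ.2 (not_lt.2 hx.2)
    refine locallyExtends_of_notMem_range (κ := 0) (U := {a}ᶜ) (f := φ) (z := Fin.elim0)
      (k := Fin.elim0) (m := Fin.elim0) (φ := Fin.elim0) (c := Fin.elim0) hG.isOpen hne
      (hψ.isOpen_filledDomain hG.isOpen ρ) (hψ.isPreconnected_filledDomain hne hGc ρ)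
      (subset_filledDomain ρ)
      (fun x hx => hna x (IsExteriorInverse.filledDomain_subset_filledCompact ρ hx))
      (fun j => j.elim0) (fun j => j.elim0) (fun j => j.elim0) ?_ hh ?_
      (isAccessibleBoundaryPoint_filledDomain hG hne hψ hρ.1 hp hpS) ⟨hna p hp, ?_⟩
    · intro γ hγ
      obtain ⟨b, hb, -⟩ := hφ.exists_continuation hG.isOpen hk hm hγ.1 fun t => (hγ.2 t).1
      exact ⟨b, hb⟩
    · intro w hw
      simp [hhφ hw]
    · rintro ⟨j, -⟩
      exact j.elim0

/-- On `G`, a function whose only singularities in `G_ϱ` are rational poles is the sum of multiples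
of the corresponding fractional powers and of a function holomorphic in `G_ϱ`. The proof is by
induction on the number of poles in `G_ρ`, for `ρ ≤ ϱ`: the poles of maximal level `r < ρ` lie on
the boundary of `G_r`, to which the corresponding fractional powers extend, and their coefficients
are chosen in such a way that the holomorphic part extends across these poles. -/
theorem HasOnlyRationalPoles.exists_decomposition (hG : IsPiecewiseAnalyticJordanDomain G)
    (hne : G.Nonempty) (hψ : IsExteriorInverse G Φ ψ) {f : ℂ → ℂ} (hfd : DifferentiableOn ℂ f G)
    {κ : ℕ} {z : Fin κ → ℂ} {k m : Fin κ → ℕ} {ϱ : ℝ} (hϱ : 1 < ϱ)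
    (hz : ∀ j, z j ∉ closure G) (hzinj : Function.Injective z) (hk : ∀ j, 0 < k j)
    (hm : ∀ j, 0 < m j)
    (hsing : HasOnlyRationalPoles f G (levelInterior G Φ ϱ) z k m)
    {φ : Fin κ → ℂ → ℂ} (hφ : ∀ j, IsPowerBranch (z j) (k j) (m j) (φ j) G) :
    ∃ (c : Fin κ → ℂ) (h : ℂ → ℂ), DifferentiableOn ℂ h (levelInterior G Φ ϱ) ∧
      ∀ w ∈ G, f w = ∑ j, c j * φ j w + h w := by
  classical
  have hGc : IsPreconnected G := hG.simplyConnected.isPathConnected.isConnected.isPreconnected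
  have hSU : ∀ ρ ≤ ϱ, filledDomain G Φ ρ ⊆ levelInterior G Φ ϱ := fun ρ hρ => by
    rw [← filledDomain_of_one_lt hϱ]; exact filledDomain_mono hρ
  have hTU : ∀ ρ < ϱ, filledCompact G Φ ρ ⊆ levelInterior G Φ ϱ := by
    rintro ρ hρ x (hx | hx)
    · exact Or.inl hx
    · exact Or.inr ⟨hx.1, hx.2.trans_lt hρ⟩
  have hregular : ∀ ρ, 1 ≤ ρ → ρ < ϱ → ∀ (c : Fin κ → ℂ) (h : ℂ → ℂ),
      DifferentiableOn ℂ h (filledDomain G Φ ρ) → EqOn h (fun w => f w - ∑ j, c j * φ j w) G →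
      ∀ p ∈ filledCompact G Φ ρ, p ∉ filledDomain G Φ ρ → p ∉ range z →
        LocallyExtends (filledDomain G Φ ρ) h p := by
    intro ρ h1 hρ c h hh hhf p hp hpS hpz
    refine locallyExtends_of_notMem_range (c := c) hG.isOpen hne (hψ.isOpen_filledDomain hG.isOpen ρ)
      (hψ.isPreconnected_filledDomain hne hGc ρ) (subset_filledDomain ρ) (hSU ρ hρ.le) hk hm hφ
      hsing.continues hh (fun w hw => ?_)
      (isAccessibleBoundaryPoint_filledDomain hG hne hψ h1 hp hpS) ⟨hTU ρ hρ hp, hpz⟩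
    rw [hhf hw]; ring
  have main : ∀ (n : ℕ) (ρ : ℝ), 1 ≤ ρ → ρ ≤ ϱ →
      (Finset.univ.filter fun j => ‖Φ (z j)‖ < ρ).card = n →
      ∃ c : Fin κ → ℂ, (∀ j, ρ ≤ ‖Φ (z j)‖ → c j = 0) ∧
        ∃ h, DifferentiableOn ℂ h (filledDomain G Φ ρ) ∧
          EqOn h (fun w => f w - ∑ j, c j * φ j w) G := by
    intro n
    induction n using Nat.strong_induction_on with
    | _ n ih =>
    intro ρ h1 hρ hcard
    rcases (Finset.univ.filter fun j => ‖Φ (z j)‖ < ρ).eq_empty_or_nonempty with he | hnonempty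
    · have hge : ∀ j, ρ ≤ ‖Φ (z j)‖ := fun j => not_lt.1 fun h =>
        absurd (Finset.mem_filter.2 ⟨Finset.mem_univ j, h⟩) (he ▸ Finset.notMem_empty j)
      refine ⟨fun _ => 0, fun _ _ => rfl, exists_extension_filledDomain hG hne hψ le_rfl h1
        ⟨f, ?_, fun w _ => by simp⟩ ?_⟩
      · rw [filledDomain_of_le le_rfl]; exact hfd
      · intro ρ' hρ' h hh hhf p hp hpS
        refine hregular ρ' hρ'.1 (hρ'.2.trans_le hρ) _ h hh hhf p hp hpS ?_
        rintro ⟨j, rfl⟩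
        have := hp.elim (fun h => absurd h (hz j)) fun h => h.2
        exact absurd (hge j) (not_le.2 (this.trans_lt hρ'.2))
    obtain ⟨j₀, hj₀, hmax⟩ := Finset.exists_max_image _ (fun j => ‖Φ (z j)‖) hnonempty
    rw [Finset.mem_filter] at hj₀
    set r := ‖Φ (z j₀)‖ with hr
    have hr1 : 1 < r := hψ.one_lt_norm _ (hz j₀)
    have hmax' : ∀ j, ‖Φ (z j)‖ < ρ → ‖Φ (z j)‖ ≤ r := fun j hj =>
      hmax j (Finset.mem_filter.2 ⟨Finset.mem_univ j, hj⟩)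
    obtain ⟨c, hc0, h, hh, hhf⟩ := ih _ (by
      rw [← hcard]
      refine Finset.card_lt_card ⟨?_, fun hsub => ?_⟩
      · exact Finset.monotone_filter_right _ fun j _ (hj : ‖Φ (z j)‖ < r) => hj.trans hj₀.2
      · have := hsub (Finset.mem_filter.2 hj₀)
        exact lt_irrefl _ (Finset.mem_filter.1 this).2) r hr1.le (hj₀.2.le.trans hρ) rfl
    have hrϱ : r < ϱ := hj₀.2.trans_le hρ
    have hpole : ∀ j, ‖Φ (z j)‖ = r → ∃ c₀ : ℂ, ∀ (c : Fin κ → ℂ) (h : ℂ → ℂ), c j = c₀ →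
        DifferentiableOn ℂ h (filledDomain G Φ r) → (∀ w ∈ G, f w = ∑ j, c j * φ j w + h w) →
        LocallyExtends (filledDomain G Φ r) h (z j) := fun j hj =>
      exists_coefficient_of_hasRationalPole hG.isOpen hne (hψ.isOpen_filledDomain hG.isOpen r)
        (hψ.isPreconnected_filledDomain hne hGc r) (subset_filledDomain r) (hSU r hrϱ.le) hk hm
        hzinj hφ hsing.continues j (hsing.poles j)
        (hψ.isAccessibleBoundaryPoint hr1 (hz j) hj)
    choose! c₀ hc₀ using hpole
    have hext : ∀ j, ‖Φ (z j)‖ = r → ∃ b, DifferentiableOn ℂ b (filledDomain G Φ r) ∧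
        EqOn b (φ j) G := fun j hj => by
      rw [← hj]
      exact (hφ j).exists_extension hG hne hψ (hz j) (hk j) (hm j)
    choose! b hbd hbφ using hext
    let c' : Fin κ → ℂ := fun j => if ‖Φ (z j)‖ = r then c₀ j else c j
    refine ⟨c', fun j hj => ?_, exists_extension_filledDomain hG hne hψ hr1.le hj₀.2.le
      ⟨fun w => h w - ∑ j ∈ Finset.univ.filter (fun j => ‖Φ (z j)‖ = r), c₀ j * b j w, ?_, ?_⟩ ?_⟩
    · have hne : ‖Φ (z j)‖ ≠ r := (hj₀.2.trans_le hj).ne'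
      simp only [c', if_neg hne]
      exact hc0 j (hj₀.2.le.trans hj)
    · refine hh.sub (DifferentiableOn.fun_sum fun j hj => (hbd j ?_).const_mul _)
      exact (Finset.mem_filter.1 hj).2
    · intro w hw
      have hsum : ∑ j, c' j * φ j w = ∑ j, c j * φ j w +
          ∑ j ∈ Finset.univ.filter (fun j => ‖Φ (z j)‖ = r), c₀ j * b j w := by
        rw [Finset.sum_filter, ← Finset.sum_add_distrib]
        refine Finset.sum_congr rfl fun j _ => ?_
        by_cases hj : ‖Φ (z j)‖ = r
        · simp only [c', if_pos hj]
          rw [hc0 j hj.ge, hbφ j hj hw]; ring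
        · simp only [c', if_neg hj, add_zero]
      simp only [hsum, hhf hw]
      ring
    · intro ρ' hρ' g hg hgf p hp hpS
      have hρ'1 : 1 < ρ' := hr1.trans_le hρ'.1
      by_cases hpz : p ∈ range z
      · obtain ⟨j, rfl⟩ := hpz
        have hle : ‖Φ (z j)‖ ≤ ρ' := hp.elim (fun h => absurd h (hz j)) fun h => h.2
        have hjr := hmax' j (hle.trans_lt hρ'.2)
        have hge : ρ' ≤ ‖Φ (z j)‖ := not_lt.1 fun hlt' =>
          hpS ((mem_filledDomain_of_one_lt hρ'1).2 (Or.inr ⟨hz j, hlt'⟩))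
        obtain rfl : ρ' = r := le_antisymm (hge.trans hjr) hρ'.1
        have hj : ‖Φ (z j)‖ = r := le_antisymm hle hge
        refine hc₀ j hj c' g (by simp only [c', if_pos hj]) hg fun w hw => ?_
        rw [hgf hw]; ring
      · exact hregular ρ' hρ'1.le (hρ'.2.trans_le hρ) _ g hg hgf p hp hpS hpz
  obtain ⟨c, -, h, hh, hhf⟩ := main _ ϱ hϱ.le le_rfl rfl
  rw [filledDomain_of_one_lt hϱ] at hh
  exact ⟨c, h, hh, fun w hw => by rw [hhf hw]; ring⟩

end Growth

/-! ### Cauchy's integral formula on the level curves of the exterior map -/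

/-- An integral of Cauchy type over a closed curve, parametrised by a circle, is holomorphic off the
curve. -/
theorem differentiableAt_circleIntegral_div_sub {m p : ℂ → ℂ} {R : ℝ} (hR : 0 ≤ R)
    (hm : ContinuousOn m (Metric.sphere 0 R)) (hp : ContinuousOn p (Metric.sphere 0 R)) {z : ℂ}
    (hz : ∀ w ∈ Metric.sphere (0 : ℂ) R, p w ≠ z) :
    DifferentiableAt ℂ (fun z => ∮ w in C(0, R), m w / (p w - z)) z := by
  have hmc : Continuous fun θ : ℝ => m (circleMap 0 R θ) :=
    hm.comp_continuous (continuous_circleMap 0 R) fun θ => circleMap_mem_sphere 0 hR θ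
  have hpc : Continuous fun θ : ℝ => p (circleMap 0 R θ) :=
    hp.comp_continuous (continuous_circleMap 0 R) fun θ => circleMap_mem_sphere 0 hR θ
  have hdc : Continuous fun θ : ℝ => deriv (circleMap 0 R) θ := by
    simp only [deriv_circleMap]
    exact (continuous_circleMap 0 R).mul continuous_const
  have hK : IsCompact (p '' Metric.sphere 0 R) := (isCompact_sphere 0 R).image_of_continuousOn hp
  have hzK : z ∉ p '' Metric.sphere 0 R := fun ⟨w, hw, h⟩ => hz w hw h
  obtain ⟨δ, hδ, hball⟩ := Metric.mem_nhds_iff.1 (hK.isClosed.isOpen_compl.mem_nhds hzK)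
  have hfar : ∀ θ : ℝ, ∀ x ∈ Metric.ball z (δ / 2), δ / 2 ≤ ‖p (circleMap 0 R θ) - x‖ := by
    intro θ x hx
    by_contra! hlt
    have hmem : p (circleMap 0 R θ) ∈ Metric.ball z δ := by
      rw [Metric.mem_ball] at hx ⊢
      rw [← dist_eq_norm] at hlt
      linarith [dist_triangle (p (circleMap 0 R θ)) x z]
    exact hball hmem ⟨_, circleMap_mem_sphere 0 hR θ, rfl⟩
  have hne : ∀ θ : ℝ, ∀ x ∈ Metric.ball z (δ / 2), p (circleMap 0 R θ) - x ≠ 0 := fun θ x hx h => by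
    have := hfar θ x hx
    rw [h, norm_zero] at this
    linarith
  obtain ⟨C, hC⟩ := (isCompact_sphere (0 : ℂ) R).exists_bound_of_continuousOn hm
  have hzδ : z ∈ Metric.ball z (δ / 2) := Metric.mem_ball_self (by positivity)
  have hF : ∀ x ∈ Metric.ball z (δ / 2), Continuous fun θ : ℝ =>
      deriv (circleMap 0 R) θ • (m (circleMap 0 R θ) / (p (circleMap 0 R θ) - x)) := fun x hx =>
    hdc.smul (hmc.div (hpc.sub continuous_const) fun θ => hne θ x hx)
  have hF' : Continuous fun θ : ℝ =>
      deriv (circleMap 0 R) θ • (m (circleMap 0 R θ) / (p (circleMap 0 R θ) - z) ^ 2) :=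
    hdc.smul (hmc.div ((hpc.sub continuous_const).pow 2) fun θ => pow_ne_zero 2 (hne θ z hzδ))
  have key := (intervalIntegral.hasDerivAt_integral_of_dominated_loc_of_deriv_le
    (μ := volume) (a := 0) (b := 2 * Real.pi)
    (F := fun x θ => deriv (circleMap 0 R) θ • (m (circleMap 0 R θ) / (p (circleMap 0 R θ) - x)))
    (F' := fun x θ =>
      deriv (circleMap 0 R) θ • (m (circleMap 0 R θ) / (p (circleMap 0 R θ) - x) ^ 2))
    (bound := fun _ => R * (C / (δ / 2) ^ 2))
    (Metric.ball_mem_nhds z (half_pos hδ))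
    (by filter_upwards [Metric.ball_mem_nhds z (half_pos hδ)] with x hx
        exact (hF x hx).aestronglyMeasurable)
    ((hF z hzδ).intervalIntegrable _ _) hF'.aestronglyMeasurable
    (by
      refine Eventually.of_forall fun θ _ x hx => ?_
      rw [norm_smul, deriv_circleMap, norm_mul, norm_circleMap_zero, Complex.norm_I, mul_one,
        abs_of_nonneg hR, norm_div, norm_pow]
      have h1 := hC _ (circleMap_mem_sphere 0 hR θ)
      have h2 := hfar θ x hx
      have h3 : 0 ≤ C := (norm_nonneg _).trans h1
      gcongr)
    intervalIntegrable_const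
    (by
      refine Eventually.of_forall fun θ _ x hx => ?_
      have h1 : HasDerivAt (fun x => p (circleMap 0 R θ) - x) (-1) x := by
        simpa using (hasDerivAt_id x).const_sub (p (circleMap 0 R θ))
      have h2 := ((hasDerivAt_const x (m (circleMap 0 R θ))).div h1 (hne θ x hx)).const_smul
        (deriv (circleMap 0 R) θ)
      refine h2.congr_deriv ?_
      simp)).2
  exact key.differentiableAt

/-- **Cauchy's integral formula** on an annulus, by invariance of the integral of the slope
`(M w - M w₀) / (w - w₀)` under a change of the radius. -/
theorem circleIntegral_div_sub_sub_of_annulus {M : ℂ → ℂ} {U : Set ℂ} (hU : IsOpen U)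
    (hM : DifferentiableOn ℂ M U) {r R : ℝ} (hr : 0 < r)
    (hsub : Metric.closedBall 0 R \ Metric.ball 0 r ⊆ U) {w₀ : ℂ} (h1 : r < ‖w₀‖)
    (h2 : ‖w₀‖ < R) :
    (∮ w in C(0, R), M w / (w - w₀)) - (∮ w in C(0, r), M w / (w - w₀)) =
      2 * Real.pi * Complex.I * M w₀ := by
  have hrR : r ≤ R := (h1.trans h2).le
  have hw₀ : w₀ ∈ U := hsub ⟨by simpa using h2.le, by simpa using h1.le⟩
  have hd : DifferentiableOn ℂ (dslope M w₀) U :=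
    (Complex.differentiableOn_dslope (hU.mem_nhds hw₀)).2 hM
  have heq : (∮ w in C(0, R), dslope M w₀ w) = ∮ w in C(0, r), dslope M w₀ w :=
    Complex.circleIntegral_eq_of_differentiable_on_annulus_off_countable hr hrR countable_empty
      (hd.continuousOn.mono hsub) fun w hw => hd.differentiableAt (hU.mem_nhds
        (hsub ⟨Metric.ball_subset_closedBall hw.1.1, fun h =>
          hw.1.2 (Metric.ball_subset_closedBall h)⟩))
  have hsplit : ∀ s : ℝ, 0 < s → Metric.sphere 0 s ⊆ U → ‖w₀‖ ≠ s →
      (∮ w in C(0, s), M w / (w - w₀)) =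
        (∮ w in C(0, s), dslope M w₀ w) + M w₀ * ∮ w in C(0, s), (w - w₀)⁻¹ := by
    intro s hs hsU hne
    have hne' : ∀ w ∈ Metric.sphere (0 : ℂ) s, w ≠ w₀ := by
      rintro w hw rfl
      exact hne (by simpa using hw)
    have hc : ContinuousOn (fun w => (w - w₀)⁻¹) (Metric.sphere 0 s) :=
      (continuousOn_id.sub continuousOn_const).inv₀ fun w hw => sub_ne_zero.2 (hne' w hw)
    have hi1 : CircleIntegrable (dslope M w₀) 0 s :=
      (hd.continuousOn.mono hsU).circleIntegrable hs.le
    have hi2 : CircleIntegrable (fun w => M w₀ * (w - w₀)⁻¹) 0 s :=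
      (continuousOn_const.mul hc).circleIntegrable hs.le
    rw [← circleIntegral.integral_const_mul, ← circleIntegral.integral_add hi1 hi2]
    refine circleIntegral.integral_congr hs.le fun w hw => ?_
    have := sub_ne_zero.2 (hne' w hw)
    simp only [dslope_of_ne _ (hne' w hw), slope_def_field]
    field_simp
    ring
  have hsphere : ∀ s : ℝ, r ≤ s → s ≤ R → Metric.sphere 0 s ⊆ U := by
    intro s h h' w hw
    have hws : ‖w‖ = s := by simpa using hw
    exact hsub ⟨by simpa [hws] using h', by simpa [hws] using h⟩
  have hzero : (∮ w in C(0, r), (w - w₀)⁻¹) = 0 := by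
    have hne : ∀ w ∈ Metric.closedBall (0 : ℂ) r, w - w₀ ≠ 0 := by
      intro w hw h
      rw [sub_eq_zero.1 h, mem_closedBall_zero_iff] at hw
      linarith
    exact Complex.circleIntegral_eq_zero_of_differentiable_on_off_countable hr.le countable_empty
      ((continuousOn_id.sub continuousOn_const).inv₀ hne) fun w hw =>
        (differentiableAt_id.sub_const w₀).inv (hne w (Metric.ball_subset_closedBall hw.1))
  rw [hsplit R (hr.trans_le hrR) (hsphere R hrR le_rfl) h2.ne,
    hsplit r hr (hsphere r le_rfl hrR) h1.ne', heq, hzero,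
    circleIntegral.integral_sub_inv_of_mem_ball (by simpa using h2)]
  ring

section

variable {G : Set ℂ} {Φ ψ : ℂ → ℂ}

namespace IsExteriorInverse

theorem injOn (h : IsExteriorInverse G Φ ψ) : InjOn ψ {w | 1 < ‖w‖} := fun a ha b hb hab => by
  rw [← h.right_inv a ha, hab, h.right_inv b hb]

theorem apply_ne_of_mem_sphere (h : IsExteriorInverse G Φ ψ) {R : ℝ} (hR : 1 < R) {z : ℂ}
    (hz : z ∈ closure G ∨ ‖Φ z‖ ≠ R) {w : ℂ} (hw : w ∈ Metric.sphere (0 : ℂ) R) : ψ w ≠ z := by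
  rintro rfl
  have hwR : ‖w‖ = R := by simpa using hw
  have hw1 : 1 < ‖w‖ := hwR ▸ hR
  exact hz.elim (h.notMem w hw1) fun hne => hne (by rw [h.right_inv w hw1, hwR])

theorem sphere_subset {R : ℝ} (hR : 1 < R) : Metric.sphere (0 : ℂ) R ⊆ {w | 1 < ‖w‖} := by
  intro w hw
  have hwR : ‖w‖ = R := by simpa using hw
  rwa [mem_ofPred_eq, hwR]

theorem continuousOn_deriv (h : IsExteriorInverse G Φ ψ) :
    ContinuousOn (deriv ψ) {w | 1 < ‖w‖} :=
  (h.differentiableOn.deriv isOpen_one_lt_norm).continuousOn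

theorem mapsTo_levelInterior (h : IsExteriorInverse G Φ ψ) (ϱ : ℝ) :
    MapsTo ψ {w | 1 < ‖w‖ ∧ ‖w‖ < ϱ} (levelInterior G Φ ϱ) := fun w hw =>
  Or.inr ⟨h.notMem w hw.1, by rw [h.right_inv w hw.1]; exact hw.2⟩

/-- The Cauchy integrals over two level curves differ by the value at a point between the curves.
In the coordinate `w = Φ(ζ)` the kernel `ψ'(w) / (ψ(w) - z)` has a simple pole at `Φ(z)` only. -/
theorem circleIntegral_sub_circleIntegral (h : IsExteriorInverse G Φ ψ) {f : ℂ → ℂ} {ϱ r R : ℝ}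
    (hf : DifferentiableOn ℂ f (levelInterior G Φ ϱ)) (hr : 1 < r) (hR : R < ϱ) {z : ℂ}
    (hz : z ∉ closure G) (hrz : r < ‖Φ z‖) (hzR : ‖Φ z‖ < R) :
    (∮ w in C(0, R), f (ψ w) * deriv ψ w / (ψ w - z)) -
      (∮ w in C(0, r), f (ψ w) * deriv ψ w / (ψ w - z)) = 2 * Real.pi * Complex.I * f z := by
  set w₀ := Φ z with hw₀
  have hϱ : 1 < ϱ := hr.trans (hrz.trans (hzR.trans hR))
  have hψw₀ : ψ w₀ = z := h.left_inv z hz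
  let U : Set ℂ := {w | 1 < ‖w‖ ∧ ‖w‖ < ϱ}
  have hU : IsOpen U := isOpen_one_lt_norm.inter (isOpen_lt continuous_norm continuous_const)
  have hw₀U : w₀ ∈ U := ⟨hr.trans hrz, hzR.trans hR⟩
  have hψU : DifferentiableOn ℂ ψ U := h.differentiableOn.mono fun w hw => hw.1
  have hslope : DifferentiableOn ℂ (dslope ψ w₀) U :=
    (Complex.differentiableOn_dslope (hU.mem_nhds hw₀U)).2 hψU
  have hslope0 : ∀ w ∈ U, dslope ψ w₀ w ≠ 0 := by
    intro w hw
    by_cases hww : w = w₀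
    · rw [hww, dslope_same]
      exact h.deriv_ne_zero w₀ hw₀U.1
    · rw [dslope_of_ne _ hww, slope_def_field]
      exact div_ne_zero (sub_ne_zero.2 fun he => hww (h.injOn hw.1 hw₀U.1 he)) (sub_ne_zero.2 hww)
  let M : ℂ → ℂ := fun w => f (ψ w) * deriv ψ w / dslope ψ w₀ w
  have hM : DifferentiableOn ℂ M U :=
    ((hf.comp hψU (h.mapsTo_levelInterior ϱ)).mul (hψU.deriv hU)).div hslope hslope0
  have hMw₀ : M w₀ = f z := by
    simp only [M, dslope_same, hψw₀]
    exact mul_div_cancel_right₀ _ (h.deriv_ne_zero w₀ hw₀U.1)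
  have hint : ∀ s : ℝ, 1 < s → s ≠ ‖w₀‖ →
      (∮ w in C(0, s), f (ψ w) * deriv ψ w / (ψ w - z)) = ∮ w in C(0, s), M w / (w - w₀) := by
    intro s hs hne
    refine circleIntegral.integral_congr (by linarith) fun w hw => ?_
    have hww : w ≠ w₀ := by
      rintro rfl
      exact hne (by simpa using hw.symm)
    simp only [M, dslope_of_ne _ hww, slope_def_field, hψw₀]
    have h1 : w - w₀ ≠ 0 := sub_ne_zero.2 hww
    rw [div_div, div_mul_cancel₀ _ h1]
  rw [hint R (hr.trans (hrz.trans hzR)) hzR.ne', hint r hr hrz.ne, ← hMw₀]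
  refine circleIntegral_div_sub_sub_of_annulus hU hM (one_pos.trans hr) ?_ hrz hzR
  rintro w ⟨hw1, hw2⟩
  have h1 : ‖w‖ ≤ R := by simpa using hw1
  have h2 : r ≤ ‖w‖ := by simpa using hw2
  exact ⟨hr.trans_le h2, h1.trans_lt hR⟩

/-- **Cauchy's integral formula** on a level curve of the exterior map. The difference of the two
sides extends, by a Cauchy integral over a smaller level curve, to an entire function which
vanishes at infinity. -/
theorem circleIntegral_eq (h : IsExteriorInverse G Φ ψ) (hGb : Bornology.IsBounded G) {f : ℂ → ℂ}
    {ϱ R : ℝ} (hf : DifferentiableOn ℂ f (levelInterior G Φ ϱ)) (hR1 : 1 < R) (hR : R < ϱ) {z : ℂ}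
    (hz : z ∈ levelInterior G Φ R) :
    (∮ w in C(0, R), f (ψ w) * deriv ψ w / (ψ w - z)) = 2 * Real.pi * Complex.I * f z := by
  obtain ⟨r, hr1, hrR⟩ := exists_between hR1
  have hm : ∀ s : ℝ, 1 < s → s < ϱ →
      ContinuousOn (fun w => f (ψ w) * deriv ψ w) (Metric.sphere 0 s) := by
    intro s hs hsϱ
    refine ContinuousOn.mul ?_ (h.continuousOn_deriv.mono (sphere_subset hs))
    refine hf.continuousOn.comp (h.differentiableOn.continuousOn.mono (sphere_subset hs)) ?_
    intro w hw
    exact h.mapsTo_levelInterior ϱ ⟨sphere_subset hs hw, by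
      have : ‖w‖ = s := by simpa using hw
      rwa [this]⟩
  have hψc : ∀ s : ℝ, 1 < s → ContinuousOn ψ (Metric.sphere 0 s) := fun s hs =>
    h.differentiableOn.continuousOn.mono (sphere_subset hs)
  let S : ℂ → ℂ := fun x => ∮ w in C(0, R), f (ψ w) * deriv ψ w / (ψ w - x)
  let T : ℂ → ℂ := fun x => ∮ w in C(0, r), f (ψ w) * deriv ψ w / (ψ w - x)
  let E : ℂ → ℂ := open Classical in fun x =>
    if x ∈ levelInterior G Φ R then 2 * Real.pi * Complex.I * f x - S x else -T x
  have hE1 : ∀ x ∈ levelInterior G Φ R, E x = 2 * Real.pi * Complex.I * f x - S x :=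
    fun x hx => if_pos hx
  have hE2 : ∀ x, x ∉ closure G → r < ‖Φ x‖ → E x = -T x := by
    intro x hx hrx
    by_cases hxR : x ∈ levelInterior G Φ R
    · have hlt : ‖Φ x‖ < R := hxR.elim (fun hc => absurd hc hx) fun hc => hc.2
      rw [hE1 x hxR, ← h.circleIntegral_sub_circleIntegral hf hr1 hR hx hrx hlt]
      ring
    · exact if_neg hxR
  have hΩ : IsOpen (closure G)ᶜ := isClosed_closure.isOpen_compl
  have hE : Differentiable ℂ E := by
    intro x
    by_cases hxR : x ∈ levelInterior G Φ R
    · have hx1 : x ∈ closure G ∨ ‖Φ x‖ ≠ R := hxR.imp id fun hc => hc.2.ne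
      have h1 : DifferentiableAt ℂ S x := differentiableAt_circleIntegral_div_sub (by linarith)
        (hm R hR1 hR) (hψc R hR1) fun w hw => h.apply_ne_of_mem_sphere hR1 hx1 hw
      have h2 : DifferentiableAt ℂ f x := hf.differentiableAt
        ((h.isOpen_levelInterior (hR1.trans hR)).mem_nhds
          (hxR.imp id fun hc => ⟨hc.1, hc.2.trans hR⟩))
      refine ((h2.const_mul (2 * Real.pi * Complex.I)).sub h1).congr_of_eventuallyEq ?_
      filter_upwards [(h.isOpen_levelInterior hR1).mem_nhds hxR] with y hy using hE1 y hy
    · have hxG : x ∉ closure G := fun hc => hxR (Or.inl hc)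
      have hxΦ : R ≤ ‖Φ x‖ := not_lt.1 fun hlt => hxR (Or.inr ⟨hxG, hlt⟩)
      have h1 : DifferentiableAt ℂ T x := differentiableAt_circleIntegral_div_sub (by linarith)
        (hm r hr1 (hrR.trans hR)) (hψc r hr1) fun w hw =>
          h.apply_ne_of_mem_sphere hr1 (Or.inr (hrR.trans_le hxΦ).ne') hw
      have hc : ContinuousAt Φ x :=
        (h.differentiableOn_map.differentiableAt (hΩ.mem_nhds hxG)).continuousAt
      refine h1.neg.congr_of_eventuallyEq ?_
      filter_upwards [hΩ.mem_nhds hxG, continuousAt_const.eventually_lt hc.norm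
        (hrR.trans_le hxΦ)] with y hy hy' using hE2 y hy hy'
  have hlim : Tendsto E (cocompact ℂ) (𝓝 0) := by
    rw [← Metric.cobounded_eq_cocompact]
    obtain ⟨C, hC⟩ := (isCompact_sphere (0 : ℂ) r).exists_bound_of_continuousOn
      (hm r hr1 (hrR.trans hR))
    obtain ⟨D, hD⟩ := (isCompact_sphere (0 : ℂ) r).exists_bound_of_continuousOn (hψc r hr1)
    have hfar : ∀ᶠ x in Bornology.cobounded ℂ, x ∉ closure G ∧ r < ‖Φ x‖ := by
      have h1 : ∀ᶠ x in Bornology.cobounded ℂ, x ∉ closure G := hGb.closure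
      have h2 : ∀ᶠ x in Bornology.cobounded ℂ, r < ‖Φ x‖ :=
        h.tendsto_map.eventually (eventually_cobounded_iff_norm.2 ⟨r, by linarith, fun _ hx => hx⟩)
      exact h1.and h2
    have hDlt : ∀ᶠ x in Bornology.cobounded ℂ, D < ‖x‖ :=
      tendsto_norm_cobounded_atTop.eventually (eventually_gt_atTop D)
    have hbound : Tendsto (fun x : ℂ => 2 * Real.pi * r * (C / (‖x‖ - D)))
        (Bornology.cobounded ℂ) (𝓝 0) := by
      have h1 : Tendsto (fun x : ℂ => ‖x‖ - D) (Bornology.cobounded ℂ) atTop :=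
        tendsto_atTop_add_const_right _ (-D) tendsto_norm_cobounded_atTop
      simpa using (h1.const_div_atTop C).const_mul (2 * Real.pi * r)
    refine squeeze_zero_norm' ?_ hbound
    filter_upwards [hfar, hDlt] with x hx hxD
    rw [hE2 x hx.1 hx.2, norm_neg]
    refine circleIntegral.norm_integral_le_of_norm_le_const (by linarith) fun w hw => ?_
    rw [norm_div]
    have h1 := hC w hw
    have h2 := hD w hw
    have h3 : ‖x‖ - D ≤ ‖ψ w - x‖ := by
      rw [norm_sub_rev]
      linarith [norm_sub_norm_le x (ψ w)]
    have h4 : 0 ≤ C := (norm_nonneg _).trans h1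
    have h5 : 0 < ‖x‖ - D := sub_pos.2 hxD
    gcongr
  have hzero := hE.apply_eq_of_tendsto_cocompact z hlim
  rw [hE1 z hz, sub_eq_zero] at hzero
  exact hzero.symm

end IsExteriorInverse

end

/-! ### Polynomial approximation by Faber series -/

theorem iteratedDeriv_mul_const_zero (z : ℂ) (j : ℕ) :
    iteratedDeriv j (fun u : ℂ => u * z) 0 = if j = 1 then z else 0 := by
  rcases j with _ | _ | j
  · simp
  · simp [iteratedDeriv_one]
  · have h1 : deriv (fun u : ℂ => u * z) = fun _ => z := by
      ext u
      simp
    rw [iteratedDeriv_succ', h1, iteratedDeriv_const]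
    simp

/-- The Taylor coefficients in `u` of `A(u) / (B(u) - u z)` are polynomials in `z` of at most the
corresponding degree, by the recursion obtained from Leibniz' rule for `A = (B - u z) g`. -/
theorem exists_polynomial_iteratedDeriv_div {A B : ℂ → ℂ} (hA : AnalyticAt ℂ A 0)
    (hB : AnalyticAt ℂ B 0) (hB0 : B 0 ≠ 0) (n : ℕ) :
    ∃ p : Polynomial ℂ, p.natDegree ≤ n ∧
      ∀ z, iteratedDeriv n (fun u => A u / (B u - u * z)) 0 = p.eval z := by
  induction n using Nat.strong_induction_on with
  | _ n ih =>
  choose! q hqdeg hq using ih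
  let lin : ℕ → Polynomial ℂ := fun j =>
    Polynomial.C (iteratedDeriv j B 0) - if j = 1 then Polynomial.X else 0
  let s : Polynomial ℂ := ∑ i ∈ Finset.range n, Polynomial.C (n.choose i : ℂ) * (q i * lin (n - i))
  refine ⟨Polynomial.C (B 0)⁻¹ * (Polynomial.C (iteratedDeriv n A 0) - s), ?_, fun z => ?_⟩
  · refine (Polynomial.natDegree_C_mul_le _ _).trans ((Polynomial.natDegree_sub_le _ _).trans ?_)
    rw [Polynomial.natDegree_C, Nat.zero_max]
    refine Polynomial.natDegree_sum_le_of_forall_le _ _ fun i hi => ?_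
    have hi : i < n := Finset.mem_range.1 hi
    refine (Polynomial.natDegree_C_mul_le _ _).trans (Polynomial.natDegree_mul_le.trans ?_)
    have h1 := hqdeg i hi
    have h2 : (lin (n - i)).natDegree ≤ n - i := by
      refine (Polynomial.natDegree_sub_le _ _).trans ?_
      rw [Polynomial.natDegree_C, Nat.zero_max]
      split_ifs with h
      · rw [h]; exact Polynomial.natDegree_X_le
      · simp
    omega
  · have hlin : AnalyticAt ℂ (fun u : ℂ => u * z) 0 := analyticAt_id.mul analyticAt_const
    have hden : AnalyticAt ℂ (fun u => B u - u * z) 0 := hB.sub hlin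
    have hden0 : B 0 - 0 * z ≠ 0 := by simpa using hB0
    have hg : AnalyticAt ℂ (fun u => A u / (B u - u * z)) 0 := hA.div hden hden0
    have hprod : A =ᶠ[𝓝 0] fun u => A u / (B u - u * z) * (B u - u * z) := by
      filter_upwards [hden.continuousAt.eventually_ne hden0] with u hu
      rw [div_mul_cancel₀ _ hu]
    have hcoef : ∀ j, iteratedDeriv j (fun u => B u - u * z) 0 = (lin j).eval z := by
      intro j
      rw [iteratedDeriv_fun_sub hB.contDiffAt hlin.contDiffAt, iteratedDeriv_mul_const_zero]
      simp only [lin]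
      split_ifs <;> simp
    have hleib : iteratedDeriv n A 0 =
        s.eval z + iteratedDeriv n (fun u => A u / (B u - u * z)) 0 * B 0 := by
      rw [hprod.iteratedDeriv_eq n, iteratedDeriv_fun_mul hg.contDiffAt hden.contDiffAt,
        Finset.sum_range_succ, Polynomial.eval_finsetSum]
      congr 1
      · refine Finset.sum_congr rfl fun i hi => ?_
        rw [hcoef, hq i (Finset.mem_range.1 hi) z]
        simp [mul_assoc]
      · simp
    rw [Polynomial.eval_mul, Polynomial.eval_C, Polynomial.eval_sub, Polynomial.eval_C, hleib,
      add_sub_cancel_left, mul_comm (B 0)⁻¹, mul_inv_cancel_right₀ hB0]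

/-- The error of the Taylor polynomials on the disc of radius `s / R`, for a function bounded by
`M` on the circle of radius `s`. -/
theorem norm_sum_taylor_sub_le {g : ℂ → ℂ} {s M R : ℝ} (hs : 0 < s)
    (hg : DiffContOnCl ℂ g (Metric.ball 0 s)) (hM : ∀ u ∈ Metric.sphere (0 : ℂ) s, ‖g u‖ ≤ M)
    (hR : 1 < R) {u : ℂ} (hu : ‖u‖ ≤ s / R) (N : ℕ) :
    ‖∑ n ∈ Finset.range (N + 1), (n.factorial : ℂ)⁻¹ * iteratedDeriv n g 0 * u ^ n - g u‖ ≤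
      M / (R - 1) / R ^ N := by
  have hR0 : 0 < R := one_pos.trans hR
  have hus : u ∈ Metric.ball (0 : ℂ) s := by
    rw [mem_ball_zero_iff]
    exact hu.trans_lt (div_lt_self hs hR)
  have hsum := Complex.hasSum_taylorSeries_on_ball hg.differentiableOn hus
  have hsum' : HasSum (fun n : ℕ => (n.factorial : ℂ)⁻¹ * iteratedDeriv n g 0 * u ^ n) (g u) := by
    refine hsum.congr_fun ?_
    intro n
    simp only [smul_eq_mul, sub_zero]
    ring
  have hterm : ∀ n : ℕ, ‖(n.factorial : ℂ)⁻¹ * iteratedDeriv n g 0 * u ^ n‖ ≤ M * R⁻¹ ^ n := by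
    intro n
    have h1 := Complex.norm_iteratedDeriv_le_of_forall_mem_sphere_norm_le n hs hg hM
    have hM0 : 0 ≤ M := by
      refine (norm_nonneg _).trans (hM s ?_)
      simp [abs_of_pos hs]
    rw [norm_mul, norm_mul, norm_inv, Complex.norm_natCast, norm_pow]
    have hf : (0 : ℝ) < n.factorial := by positivity
    calc (n.factorial : ℝ)⁻¹ * ‖iteratedDeriv n g 0‖ * ‖u‖ ^ n
        ≤ (n.factorial : ℝ)⁻¹ * (n.factorial * M / s ^ n) * (s / R) ^ n := by gcongr
      _ = M * R⁻¹ ^ n := by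
        rw [div_pow, inv_pow]
        field_simp
  have h := norm_sub_le_of_geometric_bound_of_hasSum (inv_lt_one_of_one_lt₀ hR) hterm hsum' (N + 1)
  refine h.trans (le_of_eq ?_)
  have h1 : R - 1 ≠ 0 := (sub_pos.2 hR).ne'
  have h2 : 1 - R⁻¹ ≠ 0 := (sub_pos.2 (inv_lt_one_of_one_lt₀ hR)).ne'
  rw [inv_pow, pow_succ]
  have h3 : 1 - R⁻¹ = (R - 1) / R := by field_simp
  rw [h3]
  field_simp

section

variable {G : Set ℂ} {Φ ψ : ℂ → ℂ}

namespace IsExteriorInverse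

/-- The exterior map in the coordinate `u = 1 / w` at infinity, and its derivative, give a kernel
`A(u) / (B(u) - u z)` which is holomorphic in `u` up to the point `0` corresponding to `∞`. -/
theorem exists_kernel_at_infinity (h : IsExteriorInverse G Φ ψ) :
    ∃ A B : ℂ → ℂ, DifferentiableOn ℂ A (Metric.ball 0 1) ∧
      DifferentiableOn ℂ B (Metric.ball 0 1) ∧ B 0 ≠ 0 ∧
      ∀ u ∈ Metric.ball (0 : ℂ) 1, u ≠ 0 → B u = u * ψ u⁻¹ ∧ A u = deriv ψ u⁻¹ := by
  obtain ⟨β, hβ, hlim⟩ := h.tendsto_div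
  let B : ℂ → ℂ := Function.update (fun u => u * ψ u⁻¹) 0 β
  have hB0 : B 0 = β := Function.update_self _ _ _
  have hBu : ∀ u, u ≠ 0 → B u = u * ψ u⁻¹ := fun u hu => Function.update_of_ne hu _ _
  have hnorm : ∀ u ∈ Metric.ball (0 : ℂ) 1, u ≠ 0 → 1 < ‖u⁻¹‖ := by
    intro u hu hu0
    rw [mem_ball_zero_iff] at hu
    rw [norm_inv]
    exact (one_lt_inv₀ (norm_pos_iff.2 hu0)).2 hu
  have hder : ∀ u ∈ Metric.ball (0 : ℂ) 1, u ≠ 0 →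
      HasDerivAt B (ψ u⁻¹ - deriv ψ u⁻¹ / u) u := by
    intro u hu hu0
    have h1 : HasDerivAt ψ (deriv ψ u⁻¹) u⁻¹ := (h.differentiableOn.differentiableAt
      (isOpen_one_lt_norm.mem_nhds (hnorm u hu hu0))).hasDerivAt
    have h2 : HasDerivAt (fun u => u * ψ u⁻¹) (1 * ψ u⁻¹ + u * (deriv ψ u⁻¹ * -(u ^ 2)⁻¹)) u :=
      (hasDerivAt_id u).mul (h1.comp u (hasDerivAt_inv hu0))
    have h3 : HasDerivAt B (1 * ψ u⁻¹ + u * (deriv ψ u⁻¹ * -(u ^ 2)⁻¹)) u := by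
      refine h2.congr_of_eventuallyEq ?_
      filter_upwards [isOpen_ne.mem_nhds hu0] with v hv using hBu v hv
    refine h3.congr_deriv ?_
    field_simp
    ring
  have hcont : ContinuousAt B 0 := by
    rw [continuousAt_update_same]
    refine (hlim.comp tendsto_inv₀_nhdsNE_zero).congr fun u => ?_
    simp [div_eq_mul_inv, mul_comm]
  have hB : DifferentiableOn ℂ B (Metric.ball 0 1) := by
    refine (Complex.differentiableOn_compl_singleton_and_continuousAt_iff
      (Metric.ball_mem_nhds 0 one_pos)).1 ⟨fun u hu => ?_, hcont⟩
    exact (hder u hu.1 hu.2).differentiableAt.differentiableWithinAt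
  refine ⟨fun u => B u - u * deriv B u, B,
    hB.sub (differentiableOn_id.mul (hB.deriv Metric.isOpen_ball)), hB, hB0 ▸ hβ,
    fun u hu hu0 => ⟨hBu u hu0, ?_⟩⟩
  simp only [(hder u hu hu0).deriv, hBu u hu0]
  field_simp
  ring

/-- **Polynomial approximation.** A function holomorphic inside the level curve `|Φ| = ϱ` is
approximated, together with its derivative, by polynomials of degree `N` on `closure G` with
an error `O(R ^ (-N))`, for all `R < ϱ`. The polynomials are partial sums of the Faber series. -/
theorem exists_polynomial_approx (h : IsExteriorInverse G Φ ψ) (hGb : Bornology.IsBounded G)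
    {f : ℂ → ℂ} {ϱ R : ℝ} (hf : DifferentiableOn ℂ f (levelInterior G Φ ϱ)) (hR1 : 1 < R)
    (hR : R < ϱ) :
    ∃ C : ℝ, ∀ N : ℕ, ∃ p : Polynomial ℂ, p.natDegree ≤ N ∧
      ∀ z ∈ closure G, ‖deriv f z - p.derivative.eval z‖ ≤ C / R ^ N := by
  -- the Cauchy integral is taken over `|Φ| = R'`, the Taylor coefficients over `|Φ| = R' / R`
  obtain ⟨R', hRR', hR'⟩ := exists_between hR
  have hR0 : 0 < R := one_pos.trans hR1
  have hR'0 : 0 < R' := hR0.trans hRR'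
  have hR'1 : 1 < R' := hR1.trans hRR'
  have hϱ : 1 < ϱ := hR1.trans hR
  set ρ₂ : ℝ := R' / R with hρ₂
  have hρ₂1 : 1 < ρ₂ := (one_lt_div hR0).2 hRR'
  have hρ₂0 : 0 < ρ₂ := one_pos.trans hρ₂1
  have hρ₂R' : ρ₂ < R' := div_lt_self hR'0 hR1
  obtain ⟨ρ₁, hρ₁1, hρ₁₂⟩ := exists_between hρ₂1
  have hρ₁0 : 0 < ρ₁ := one_pos.trans hρ₁1
  obtain ⟨A, B, hA, hB, hB0, hAB⟩ := h.exists_kernel_at_infinity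
  let g : ℂ → ℂ → ℂ := fun z u => A u / (B u - u * z)
  have h0 : Metric.ball (0 : ℂ) 1 ∈ 𝓝 0 := Metric.ball_mem_nhds 0 one_pos
  choose q hqdeg hq using
    exists_polynomial_iteratedDeriv_div (hA.analyticAt h0) (hB.analyticAt h0) hB0
  let F := filledCompact G Φ ρ₁
  have hF : IsCompact F := h.isCompact_filledCompact hGb ρ₁
  have hinv : ∀ u : ℂ, u ≠ 0 → ‖u‖ < ρ₁⁻¹ → ρ₁ < ‖u⁻¹‖ := by
    intro u hu0 hu
    rw [norm_inv]
    exact (lt_inv_comm₀ hρ₁0 (norm_pos_iff.2 hu0)).2 hu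
  have hball1 : Metric.ball (0 : ℂ) ρ₁⁻¹ ⊆ Metric.ball 0 1 :=
    Metric.ball_subset_ball (inv_le_one_of_one_le₀ hρ₁1.le)
  have hden : ∀ z ∈ F, ∀ u ∈ Metric.ball (0 : ℂ) ρ₁⁻¹, B u - u * z ≠ 0 := by
    intro z hz u hu
    by_cases hu0 : u = 0
    · simpa [hu0] using hB0
    · rw [(hAB u (hball1 hu) hu0).1, ← mul_sub]
      have hlt := hinv u hu0 (by simpa using hu)
      have h1 : 1 < ‖u⁻¹‖ := hρ₁1.trans hlt
      refine mul_ne_zero hu0 (sub_ne_zero.2 ?_)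
      rintro rfl
      rcases hz with hz | hz
      · exact h.notMem _ h1 hz
      · exact (h.right_inv _ h1 ▸ hz.2).not_gt hlt
  have hg : ∀ z ∈ F, DifferentiableOn ℂ (g z) (Metric.ball 0 ρ₁⁻¹) := fun z hz =>
    (hA.mono hball1).div ((hB.mono hball1).sub (differentiableOn_id.mul_const z)) (hden z hz)
  have hcl : Metric.closedBall (0 : ℂ) ρ₂⁻¹ ⊆ Metric.ball 0 ρ₁⁻¹ :=
    Metric.closedBall_subset_ball (inv_strictAnti₀ hρ₁0 hρ₁₂)
  have hgdc : ∀ z ∈ F, DiffContOnCl ℂ (g z) (Metric.ball 0 ρ₂⁻¹) := fun z hz =>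
    ((hg z hz).mono hcl).diffContOnCl_ball le_rfl
  obtain ⟨M, hM⟩ : ∃ M, ∀ x ∈ F ×ˢ Metric.sphere (0 : ℂ) ρ₂⁻¹, ‖g x.1 x.2‖ ≤ M := by
    refine (hF.prod (isCompact_sphere 0 _)).exists_bound_of_continuousOn
      (f := fun x : ℂ × ℂ => g x.1 x.2) ?_
    have hsnd : MapsTo Prod.snd (F ×ˢ Metric.sphere (0 : ℂ) ρ₂⁻¹) (Metric.ball (0 : ℂ) 1) :=
      fun x hx => hball1 (hcl (Metric.sphere_subset_closedBall hx.2))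
    refine (hA.continuousOn.comp continuousOn_snd hsnd).div
      ((hB.continuousOn.comp continuousOn_snd hsnd).sub
        (continuousOn_snd.mul continuousOn_fst)) fun x hx => ?_
    exact hden x.1 hx.1 x.2 (hcl (Metric.sphere_subset_closedBall hx.2))
  -- the error of the partial sums of the Faber expansion of the Cauchy kernel
  have hT : ∀ z ∈ F, ∀ w ∈ Metric.sphere (0 : ℂ) R', ∀ N : ℕ,
      ‖∑ n ∈ Finset.range (N + 1), (n.factorial : ℂ)⁻¹ * (q n).eval z * w⁻¹ ^ n - g z w⁻¹‖ ≤
        M / (R - 1) / R ^ N := by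
    intro z hz w hw N
    have hwR : ‖w‖ = R' := by simpa using hw
    have h1 := norm_sum_taylor_sub_le (inv_pos.2 hρ₂0) (hgdc z hz) (fun u hu => hM (z, u) ⟨hz, hu⟩)
      hR1 (u := w⁻¹) (by rw [norm_inv, hwR, hρ₂, inv_div, div_div_cancel_left' hR0.ne']) N
    simpa only [g, hq] using h1
  let m : ℂ → ℂ := fun w => f (ψ w) * w⁻¹
  have hwne : ∀ w ∈ Metric.sphere (0 : ℂ) R', w ≠ 0 := by
    rintro w hw rfl
    have : (0 : ℝ) = R' := by simpa using hw
    exact hR'0.ne this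
  have hm : ContinuousOn m (Metric.sphere 0 R') := by
    refine ContinuousOn.mul ?_ (continuousOn_id.inv₀ hwne)
    refine hf.continuousOn.comp (h.differentiableOn.continuousOn.mono (sphere_subset hR'1)) ?_
    intro w hw
    exact h.mapsTo_levelInterior ϱ ⟨sphere_subset hR'1 hw, by
      have : ‖w‖ = R' := by simpa using hw
      rwa [this]⟩
  obtain ⟨D, hD⟩ := (isCompact_sphere (0 : ℂ) R').exists_bound_of_continuousOn hm
  have hD0 : 0 ≤ D := (norm_nonneg _).trans (hD R' (by simp [abs_of_pos hR'0]))
  have h2πI : 2 * (Real.pi : ℂ) * Complex.I ≠ 0 := by simp [Real.pi_ne_zero]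
  have hpow : ∀ n : ℕ, ContinuousOn (fun w : ℂ => m w * w⁻¹ ^ n) (Metric.sphere 0 R') := fun n =>
    hm.mul ((continuousOn_id.inv₀ hwne).pow n)
  let a : ℕ → ℂ := fun n => (2 * Real.pi * Complex.I)⁻¹ * ∮ w in C(0, R'), m w * w⁻¹ ^ n
  let P : ℕ → Polynomial ℂ := fun N => ∑ n ∈ Finset.range (N + 1),
    Polynomial.C (a n * (n.factorial : ℂ)⁻¹) * q n
  have hP : ∀ N z, (P N).eval z = (2 * Real.pi * Complex.I)⁻¹ * ∮ w in C(0, R'),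
      m w * ∑ n ∈ Finset.range (N + 1), (n.factorial : ℂ)⁻¹ * (q n).eval z * w⁻¹ ^ n := by
    intro N z
    have h1 : (∮ w in C(0, R'),
        m w * ∑ n ∈ Finset.range (N + 1), (n.factorial : ℂ)⁻¹ * (q n).eval z * w⁻¹ ^ n) =
        ∑ n ∈ Finset.range (N + 1), (n.factorial : ℂ)⁻¹ * (q n).eval z *
          ∮ w in C(0, R'), m w * w⁻¹ ^ n := by
      simp only [← circleIntegral.integral_const_mul]
      rw [← circleIntegral.integral_fun_sum]
      · refine circleIntegral.integral_congr hR'0.le fun w _ => ?_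
        simp only [Finset.mul_sum]
        exact Finset.sum_congr rfl fun n _ => by ring
      · exact fun n _ => (continuousOn_const.mul (hpow n)).circleIntegrable hR'0.le
    rw [h1, Polynomial.eval_finsetSum, Finset.mul_sum]
    refine Finset.sum_congr rfl fun n _ => ?_
    simp only [a, Polynomial.eval_mul, Polynomial.eval_C]
    ring
  have hPdeg : ∀ N, (P N).natDegree ≤ N := fun N =>
    Polynomial.natDegree_sum_le_of_forall_le _ _ fun n hn =>
      (Polynomial.natDegree_C_mul_le _ _).trans
        ((hqdeg n).trans (Nat.lt_succ_iff.1 (Finset.mem_range.1 hn)))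
  have hrep : ∀ z ∈ F, f z = (2 * Real.pi * Complex.I)⁻¹ * ∮ w in C(0, R'), m w * g z w⁻¹ := by
    intro z hz
    have hzR' : z ∈ levelInterior G Φ R' :=
      hz.imp id fun hc => ⟨hc.1, hc.2.trans_lt (hρ₁₂.trans hρ₂R')⟩
    rw [eq_inv_mul_iff_mul_eq₀ h2πI, ← h.circleIntegral_eq hGb hf hR'1 hR' hzR']
    refine circleIntegral.integral_congr hR'0.le fun w hw => ?_
    have hwR : ‖w‖ = R' := by simpa using hw
    have hw0 := hwne w hw
    have hwi : w⁻¹ ∈ Metric.ball (0 : ℂ) 1 := by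
      rw [mem_ball_zero_iff, norm_inv, hwR]
      exact inv_lt_one_of_one_lt₀ hR'1
    obtain ⟨e1, e2⟩ := hAB w⁻¹ hwi (inv_ne_zero hw0)
    rw [inv_inv] at e1 e2
    simp only [m, g, e1, e2, ← mul_sub]
    field_simp
  have herr : ∀ N, ∀ z ∈ F, ‖f z - (P N).eval z‖ ≤ R' * (D * (M / (R - 1) / R ^ N)) := by
    intro N z hz
    have hgc : ContinuousOn (fun w => m w * g z w⁻¹) (Metric.sphere 0 R') := by
      refine hm.mul ((hg z hz).continuousOn.comp (continuousOn_id.inv₀ hwne) fun w hw => ?_)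
      have hwR : ‖w‖ = R' := by simpa using hw
      rw [mem_ball_zero_iff, norm_inv, hwR]
      exact inv_strictAnti₀ hρ₁0 (hρ₁₂.trans hρ₂R')
    have hsc : ContinuousOn (fun w => m w *
        ∑ n ∈ Finset.range (N + 1), (n.factorial : ℂ)⁻¹ * (q n).eval z * w⁻¹ ^ n)
        (Metric.sphere 0 R') :=
      hm.mul (continuousOn_finsetSum _ fun n _ =>
        continuousOn_const.mul ((continuousOn_id.inv₀ hwne).pow n))
    rw [hrep z hz, hP, ← mul_sub, ← circleIntegral.integral_sub (hgc.circleIntegrable hR'0.le)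
      (hsc.circleIntegrable hR'0.le)]
    have hb := circleIntegral.norm_two_pi_i_inv_smul_integral_le_of_norm_le_const hR'0.le
      (f := fun w => m w * g z w⁻¹ - m w *
        ∑ n ∈ Finset.range (N + 1), (n.factorial : ℂ)⁻¹ * (q n).eval z * w⁻¹ ^ n)
      (C := D * (M / (R - 1) / R ^ N)) (c := 0) fun w hw => by
        rw [← mul_sub, norm_mul, norm_sub_rev (g z w⁻¹)]
        exact mul_le_mul (hD w hw) (hT z hz w hw N) (norm_nonneg _) hD0
    simpa only [smul_eq_mul] using hb
  obtain ⟨δ, hδ, hδF⟩ := (hGb.isCompact_closure).exists_cthickening_subset_open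
    (h.isOpen_levelInterior hρ₁1) fun z hz => Or.inl hz
  refine ⟨R' * (D * (M / (R - 1))) / δ, fun N => ⟨P N, hPdeg N, fun z hz => ?_⟩⟩
  have hsub : Metric.closedBall z δ ⊆ levelInterior G Φ ρ₁ :=
    (Metric.closedBall_subset_cthickening hz δ).trans hδF
  have hsub' : levelInterior G Φ ρ₁ ⊆ levelInterior G Φ ϱ := fun x hx =>
    hx.imp id fun hc => ⟨hc.1, hc.2.trans (hρ₁₂.trans (hρ₂R'.trans hR'))⟩
  have hfz : DifferentiableAt ℂ f z :=
    hf.differentiableAt ((h.isOpen_levelInterior hϱ).mem_nhds (Or.inl hz))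
  have hdc : DiffContOnCl ℂ (fun x => f x - (P N).eval x) (Metric.ball z δ) :=
    (((hf.mono (hsub.trans hsub')).sub (P N).differentiable.differentiableOn)).diffContOnCl_ball
      le_rfl
  have hb := Complex.norm_deriv_le_of_forall_mem_sphere_norm_le hδ hdc fun x hx =>
    herr N x ((hsub (Metric.sphere_subset_closedBall hx)).imp id fun hc => ⟨hc.1, hc.2.le⟩)
  rw [deriv_fun_sub hfz (P N).differentiableAt, Polynomial.deriv] at hb
  refine hb.trans (le_of_eq ?_)
  ring

end IsExteriorInverse

end

/-! ### The Bergman kernel as the derivative of the interior conformal map -/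

/-- The area mean value property on a disc, for functions continuous up to the boundary: the circle
averages in polar coordinates are all equal to the value at the centre. -/
theorem DiffContOnCl.setIntegral_ball_zero {F : ℂ → ℂ} {s : ℝ} (hs : 0 < s)
    (hF : DiffContOnCl ℂ F (Metric.ball 0 s)) :
    ∫ w in Metric.ball 0 s, F w = (Real.pi * s ^ 2 : ℝ) * F 0 := by
  have hcont : ContinuousOn F (Metric.closedBall 0 s) := by
    rw [← closure_ball (0 : ℂ) hs.ne']
    exact hF.continuousOn
  have hsymm : ∀ p : ℝ × ℝ, Complex.polarCoord.symm p = circleMap 0 p.1 p.2 := by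
    intro p
    rw [Complex.polarCoord_symm_apply, circleMap, zero_add, Complex.exp_mul_I]
    push_cast
    rfl
  have hcm : Continuous fun p : ℝ × ℝ => circleMap 0 p.1 p.2 := by
    unfold circleMap
    fun_prop
  let g : ℝ × ℝ → ℂ := fun p => p.1 • F (circleMap 0 p.1 p.2)
  have hgc : ContinuousOn g (Icc 0 s ×ˢ Icc (-Real.pi) Real.pi) := by
    refine continuousOn_fst.smul (hcont.comp hcm.continuousOn fun p hp => ?_)
    rw [mem_closedBall_zero_iff, norm_circleMap_zero, abs_of_nonneg hp.1.1]
    exact hp.1.2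
  have hgi : IntegrableOn g (Ioo 0 s ×ˢ Ioo (-Real.pi) Real.pi) :=
    (hgc.integrableOn_compact (isCompact_Icc.prod isCompact_Icc)).mono_set
      (prod_mono Ioo_subset_Icc_self Ioo_subset_Icc_self)
  have hcircle : ∀ t ∈ Ioo 0 s,
      ∫ θ in Ioo (-Real.pi) Real.pi, g (t, θ) = t • ((2 * Real.pi) • F 0) := by
    intro t ht
    have hsub : Metric.ball (0 : ℂ) |t| ⊆ Metric.ball 0 s := by
      rw [abs_of_pos ht.1]
      exact Metric.ball_subset_ball ht.2.le
    have havg := DiffContOnCl.circleAverage (hF.mono hsub)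
    rw [Real.circleAverage_def, inv_smul_eq_iff₀ (by positivity)] at havg
    have hper : Function.Periodic (fun θ => F (circleMap 0 t θ)) (2 * Real.pi) := fun θ => by
      simp only [periodic_circleMap 0 t θ]
    have hshift := hper.intervalIntegral_add_eq (-Real.pi) 0
    rw [zero_add, havg, show -Real.pi + 2 * Real.pi = Real.pi by ring] at hshift
    simp only [g, integral_smul]
    rw [← integral_Ioc_eq_integral_Ioo, ← intervalIntegral.integral_of_le (by linarith [Real.pi_pos]),
      hshift]
  have hpolar := Complex.integral_comp_polarCoord_symm ((Metric.ball (0 : ℂ) s).indicator F)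
  rw [integral_indicator Metric.isOpen_ball.measurableSet] at hpolar
  rw [← hpolar]
  have hmeas : MeasurableSet (Ioo 0 s ×ˢ Ioo (-Real.pi) Real.pi) :=
    measurableSet_Ioo.prod measurableSet_Ioo
  have hind : ∫ p in polarCoord.target,
      p.1 • (Metric.ball (0 : ℂ) s).indicator F (Complex.polarCoord.symm p) =
      ∫ p in polarCoord.target, (Ioo 0 s ×ˢ Ioo (-Real.pi) Real.pi).indicator g p := by
    refine setIntegral_congr_fun polarCoord.open_target.measurableSet fun p hp => ?_
    have hp1 : 0 < p.1 := hp.1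
    by_cases hps : p.1 < s
    · have h1 : p ∈ Ioo 0 s ×ˢ Ioo (-Real.pi) Real.pi := ⟨⟨hp1, hps⟩, hp.2⟩
      have h2 : circleMap 0 p.1 p.2 ∈ Metric.ball (0 : ℂ) s := by
        rwa [mem_ball_zero_iff, norm_circleMap_zero, abs_of_pos hp1]
      simp only [hsymm, indicator_of_mem h1, indicator_of_mem h2, g]
    · have h1 : p ∉ Ioo 0 s ×ˢ Ioo (-Real.pi) Real.pi := fun h => hps h.1.2
      have h2 : circleMap 0 p.1 p.2 ∉ Metric.ball (0 : ℂ) s := by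
        rwa [mem_ball_zero_iff, norm_circleMap_zero, abs_of_pos hp1]
      simp only [hsymm, indicator_of_notMem h1, indicator_of_notMem h2, smul_zero]
  have hsub : Ioo 0 s ×ˢ Ioo (-Real.pi) Real.pi ⊆ polarCoord.target :=
    prod_mono Ioo_subset_Ioi_self subset_rfl
  rw [hind, setIntegral_indicator hmeas, inter_eq_self_of_subset_right hsub,
    Measure.volume_eq_prod, setIntegral_prod g hgi, setIntegral_congr_fun measurableSet_Ioo hcircle,
    integral_smul_const, ← integral_Ioc_eq_integral_Ioo, ← intervalIntegral.integral_of_le hs.le,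
    integral_id]
  simp only [Complex.real_smul]
  push_cast
  ring

/-- The area mean value property on a disc, for integrable holomorphic functions, by exhaustion with
smaller discs. -/
theorem DifferentiableOn.setIntegral_ball_zero {F : ℂ → ℂ} {r : ℝ} (hr : 0 < r)
    (hF : DifferentiableOn ℂ F (Metric.ball 0 r)) (hFi : IntegrableOn F (Metric.ball 0 r)) :
    ∫ w in Metric.ball 0 r, F w = (Real.pi * r ^ 2 : ℝ) * F 0 := by
  obtain ⟨s, hsmono, hs, hslim⟩ := exists_seq_strictMono_tendsto' hr
  have hU : (⋃ n, Metric.ball (0 : ℂ) (s n)) = Metric.ball 0 r := by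
    ext w
    simp only [mem_iUnion, mem_ball_zero_iff]
    constructor
    · rintro ⟨n, hn⟩
      exact hn.trans (hs n).2
    · intro hw
      exact (hslim.eventually (lt_mem_nhds hw)).exists
  have hlim := tendsto_setIntegral_of_monotone (f := F) (μ := volume)
    (s := fun n => Metric.ball (0 : ℂ) (s n))
    (fun n => Metric.isOpen_ball.measurableSet)
    (fun a b hab => Metric.ball_subset_ball (hsmono.monotone hab)) (by rwa [hU])
  rw [hU] at hlim
  refine tendsto_nhds_unique hlim ?_
  have heq : ∀ n, ∫ w in Metric.ball 0 (s n), F w = (Real.pi * s n ^ 2 : ℝ) * F 0 := fun n =>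
    ((hF.mono (Metric.closedBall_subset_ball (hs n).2)).diffContOnCl_ball
      le_rfl).setIntegral_ball_zero (hs n).1
  simp only [heq]
  exact ((Complex.continuous_ofReal.tendsto _).comp
    ((hslim.pow 2).const_mul Real.pi)).mul_const (F 0)

theorem MeasureTheory.MemLp.integrable_mul_conj {μ : Measure ℂ} {f g : ℂ → ℂ} (hf : MemLp f 2 μ)
    (hg : MemLp g 2 μ) : Integrable (fun z => f z * (starRingEnd ℂ) (g z)) μ :=
  hf.integrable_mul hg.star

theorem abs_det_restrictScalars_toSpanSingleton (a : ℂ) :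
    |((ContinuousLinearMap.toSpanSingleton ℂ a).restrictScalars ℝ : ℂ →L[ℝ] ℂ).det| = ‖a‖ ^ 2 := by
  simp [ContinuousLinearMap.det, LinearMap.det_restrictScalars, Algebra.norm_complex_eq,
    Complex.normSq_eq_norm_sq]

theorem DifferentiableOn.memLp_two_of_bounded {G : Set ℂ} (hG : IsOpen G)
    (hGb : Bornology.IsBounded G) {f : ℂ → ℂ} (hf : DifferentiableOn ℂ f G) {C : ℝ}
    (hC : ∀ z ∈ G, ‖f z‖ ≤ C) : MemLp f 2 (volume.restrict G) := by
  have : IsFiniteMeasure (volume.restrict G) := ⟨by simpa using hGb.measure_lt_top⟩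
  refine MemLp.of_bound (hf.continuousOn.aestronglyMeasurable hG.measurableSet) C ?_
  exact (ae_restrict_iff' hG.measurableSet).2 (Eventually.of_forall hC)

namespace IsInteriorConformalMap

variable {G : Set ℂ} {z₀ : ℂ} {r₀ : ℝ} {f₀ : ℂ → ℂ}

theorem radius_pos (h : IsInteriorConformalMap G z₀ r₀ f₀) (hz₀ : z₀ ∈ G) : 0 < r₀ :=
  Metric.pos_of_mem_ball (h.bijective.mapsTo hz₀)

theorem hasFDerivWithinAt (h : IsInteriorConformalMap G z₀ r₀ f₀) (hG : IsOpen G) :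
    ∀ z ∈ G, HasFDerivWithinAt f₀
      ((ContinuousLinearMap.toSpanSingleton ℂ (deriv f₀ z)).restrictScalars ℝ : ℂ →L[ℝ] ℂ) G z :=
  fun _ hz => ((h.holomorphic.differentiableAt
    (hG.mem_nhds hz)).hasDerivAt.hasFDerivAt.restrictScalars ℝ).hasFDerivWithinAt

/-- The derivative of a conformal map onto a disc is square integrable: the integral of `|f₀'|²` is
the area of the disc. -/
theorem memLp_deriv (h : IsInteriorConformalMap G z₀ r₀ f₀) (hG : IsOpen G) :
    MemLp (deriv f₀) 2 (volume.restrict G) := by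
  have hmeas : AEStronglyMeasurable (deriv f₀) (volume.restrict G) :=
    (h.holomorphic.deriv hG).continuousOn.aestronglyMeasurable hG.measurableSet
  rw [memLp_two_iff_integrable_sq_norm hmeas]
  have h1 : IntegrableOn (fun _ : ℂ => (1 : ℝ)) (f₀ '' G) := by
    rw [h.bijective.image_eq]
    exact integrableOn_const (hs := Metric.isBounded_ball.measure_lt_top.ne)
  rw [integrableOn_image_iff_integrableOn_abs_det_fderiv_smul volume hG.measurableSet
    (h.hasFDerivWithinAt hG) h.bijective.injOn] at h1
  simpa only [abs_det_restrictScalars_toSpanSingleton, smul_eq_mul,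
    mul_one, IntegrableOn] using h1

/-- Up to the factor `π r₀²`, the derivative `f₀'` reproduces the values at `z₀`: by the
substitution `w = f₀(z)`, this is the mean value property on the disc. -/
theorem integral_mul_conj_deriv (h : IsInteriorConformalMap G z₀ r₀ f₀) (hG : IsOpen G)
    (hz₀ : z₀ ∈ G) {g : ℂ → ℂ} (hg : DifferentiableOn ℂ g G)
    (hg2 : MemLp g 2 (volume.restrict G)) :
    ∫ z in G, g z * (starRingEnd ℂ) (deriv f₀ z) = (Real.pi * r₀ ^ 2 : ℝ) * g z₀ := by
  obtain ⟨-, hne, ψ, hψ, hψf⟩ := h.bijective.injOn.exists_holomorphic_inverse hG h.holomorphic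
  have himg := h.bijective.image_eq
  have hmaps : MapsTo ψ (f₀ '' G) G := by
    rintro _ ⟨z, hz, rfl⟩
    rwa [hψf z hz]
  let F : ℂ → ℂ := fun w => g (ψ w) / deriv f₀ (ψ w)
  have hF : DifferentiableOn ℂ F (f₀ '' G) :=
    (hg.comp hψ hmaps).div ((h.holomorphic.deriv hG).comp hψ hmaps) fun w hw => hne _ (hmaps hw)
  have hpull : EqOn (fun z => |((ContinuousLinearMap.toSpanSingleton ℂ
      (deriv f₀ z)).restrictScalars ℝ : ℂ →L[ℝ] ℂ).det| • F (f₀ z))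
      (fun z => g z * (starRingEnd ℂ) (deriv f₀ z)) G := by
    intro z hz
    have h1 := hne z hz
    simp only [abs_det_restrictScalars_toSpanSingleton, F, hψf z hz,
      Complex.real_smul, Complex.ofReal_pow]
    rw [← Complex.conj_mul']
    field_simp
  have hFi : IntegrableOn F (f₀ '' G) := by
    rw [integrableOn_image_iff_integrableOn_abs_det_fderiv_smul volume hG.measurableSet
      (h.hasFDerivWithinAt hG) h.bijective.injOn, integrableOn_congr_fun hpull hG.measurableSet]
    exact hg2.integrable_mul_conj (h.memLp_deriv hG)
  have hint := integral_image_eq_integral_abs_det_fderiv_smul volume hG.measurableSet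
    (h.hasFDerivWithinAt hG) h.bijective.injOn F
  rw [setIntegral_congr_fun hG.measurableSet hpull] at hint
  rw [← hint]
  rw [himg] at hF hFi ⊢
  rw [hF.setIntegral_ball_zero (h.radius_pos hz₀) hFi]
  have hψ0 : ψ 0 = z₀ := by rw [← h.map_base, hψf z₀ hz₀]
  simp only [F, hψ0, h.deriv_base, div_one]

/-- The Bergman kernel `K(·, z₀)` is `f₀' / (π r₀²)`: both reproduce the values at `z₀`, so their
difference is orthogonal to itself. -/
theorem bergmanKernel_ae_eq (h : IsInteriorConformalMap G z₀ r₀ f₀) (hG : IsOpen G)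
    (hz₀ : z₀ ∈ G) {K : ℂ → ℂ} (hK : IsBergmanKernel G z₀ K) :
    K =ᵐ[volume.restrict G] fun z => ((Real.pi * r₀ ^ 2 : ℝ) : ℂ)⁻¹ * deriv f₀ z := by
  set a : ℝ := Real.pi * r₀ ^ 2 with ha
  have ha0 : (a : ℂ) ≠ 0 := by
    have := h.radius_pos hz₀
    exact_mod_cast (by positivity : a ≠ 0)
  let D : ℂ → ℂ := fun z => K z - (a : ℂ)⁻¹ * deriv f₀ z
  have hD : DifferentiableOn ℂ D G :=
    hK.holomorphic.sub ((h.holomorphic.deriv hG).const_mul _)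
  have hD2 : MemLp D 2 (volume.restrict G) := hK.memLp.sub ((h.memLp_deriv hG).const_mul _)
  have hDD : ∫ z in G, D z * (starRingEnd ℂ) (D z) = 0 := by
    have hsplit : ∀ z, D z * (starRingEnd ℂ) (D z) = D z * (starRingEnd ℂ) (K z) -
        (a : ℂ)⁻¹ * (D z * (starRingEnd ℂ) (deriv f₀ z)) := by
      intro z
      simp only [D, map_sub, map_mul, map_inv₀, Complex.conj_ofReal]
      ring
    simp only [hsplit]
    rw [integral_sub (hD2.integrable_mul_conj hK.memLp)
      ((hD2.integrable_mul_conj (h.memLp_deriv hG)).const_mul _), integral_const_mul,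
      hK.reproducing D hD hD2, h.integral_mul_conj_deriv hG hz₀ hD hD2, inv_mul_cancel_left₀ ha0,
      sub_self]
  have hsq : ∫ z in G, ‖D z‖ ^ 2 = 0 := by
    have h1 : ∀ z, D z * (starRingEnd ℂ) (D z) = ((‖D z‖ ^ 2 : ℝ) : ℂ) := fun z => by
      rw [Complex.mul_conj']
      push_cast
      rfl
    simp only [h1] at hDD
    rw [integral_complex_ofReal] at hDD
    exact_mod_cast hDD
  rw [integral_eq_zero_iff_of_nonneg (fun z => sq_nonneg _)
    ((memLp_two_iff_integrable_sq_norm hD2.1).1 hD2)] at hsq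
  filter_upwards [hsq] with z hz
  have hz : ‖D z‖ ^ 2 = 0 := hz
  exact sub_eq_zero.1 (norm_eq_zero.1 (pow_eq_zero_iff two_ne_zero |>.1 hz))

end IsInteriorConformalMap

/-! ### Best approximation by the augmented kernel polynomials -/

/-- The partial sums over the orthonormal vectors of the Gram-Schmidt process are best
approximations. Linear independence is not needed: a vector that becomes zero in the process
contributes nothing to the sum or to the span. -/
theorem norm_sub_sum_gramSchmidtNormed_le {E : Type*} [NormedAddCommGroup E]
    [InnerProductSpace ℂ E] (v : ℕ → E) (x : E) (N : ℕ) {p : E}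
    (hp : p ∈ Submodule.span ℂ (v '' Iio N)) :
    ‖x - ∑ j ∈ Finset.range N, inner ℂ (InnerProductSpace.gramSchmidtNormed ℂ v j) x •
      InnerProductSpace.gramSchmidtNormed ℂ v j‖ ≤ ‖x - p‖ := by
  set e : ℕ → E := InnerProductSpace.gramSchmidtNormed ℂ v with he
  set S : E := ∑ j ∈ Finset.range N, inner ℂ (e j) x • e j with hS
  have hspan : Submodule.span ℂ (v '' Iio N) = Submodule.span ℂ (e '' Iio N) := by
    rw [he, InnerProductSpace.span_gramSchmidtNormed, InnerProductSpace.span_gramSchmidt_Iio]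
  have hmem : ∀ j < N, e j ∈ Submodule.span ℂ (v '' Iio N) := fun j hj =>
    hspan ▸ Submodule.subset_span (mem_image_of_mem e hj)
  have hortho : ∀ i j, i ≠ j → inner ℂ (e i) (e j) = 0 := fun i j hij => by
    simp only [he, InnerProductSpace.gramSchmidtNormed, inner_smul_left, inner_smul_right,
      InnerProductSpace.gramSchmidt_orthogonal ℂ v hij, mul_zero]
  have hperp : ∀ i < N, inner ℂ (e i) (x - S) = 0 := by
    intro i hi
    rw [inner_sub_right, hS, inner_sum, Finset.sum_eq_single i]
    · by_cases h0 : e i = 0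
      · simp [h0]
      · have h1 : ‖e i‖ = 1 := InnerProductSpace.gramSchmidtNormed_unit_length' h0
        rw [inner_smul_right, inner_self_eq_norm_sq_to_K, h1]
        simp
    · intro j _ hji
      rw [inner_smul_right, hortho i j hji.symm, mul_zero]
    · exact fun h => absurd (Finset.mem_range.2 hi) h
  have hSp : S - p ∈ Submodule.span ℂ (e '' Iio N) := by
    rw [← hspan]
    exact Submodule.sub_mem _ (Submodule.sum_mem _ fun j hj =>
      Submodule.smul_mem _ _ (hmem j (Finset.mem_range.1 hj))) hp
  have hzero : inner ℂ (S - p) (x - S) = 0 := by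
    refine Submodule.span_induction (p := fun y _ => inner ℂ y (x - S) = 0) ?_ ?_ ?_ ?_ hSp
    · rintro _ ⟨j, hj, rfl⟩
      exact hperp j hj
    · exact inner_zero_left _
    · intro y y' _ _ hy hy'
      rw [inner_add_left, hy, hy', add_zero]
    · intro c y _ hy
      rw [inner_smul_left, hy, mul_zero]
  have hpyth := norm_add_sq_eq_norm_sq_add_norm_sq_of_inner_eq_zero (S - p) (x - S) hzero
  rw [sub_add_sub_cancel', ← sq, ← sq] at hpyth
  exact le_of_sq_le_sq (by nlinarith [sq_nonneg ‖S - p‖]) (norm_nonneg _)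

theorem MeasureTheory.MemLp.toLp_sum_mul {α ι : Type*} [MeasurableSpace α] {μ : Measure α}
    {f : ι → α → ℂ} (hf : ∀ i, MemLp (f i) 2 μ) (c : ι → ℂ) (s : Finset ι)
    (h : MemLp (fun z => ∑ i ∈ s, c i * f i z) 2 μ) :
    h.toLp (fun z => ∑ i ∈ s, c i * f i z) = ∑ i ∈ s, c i • (hf i).toLp (f i) := by
  classical
  induction s using Finset.induction_on with
  | empty => exact MemLp.toLp_zero _
  | insert i s hi ih =>
    have hs : MemLp (fun z => ∑ i ∈ s, c i * f i z) 2 μ :=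
      memLp_finsetSum _ fun i _ => (hf i).const_mul (c i)
    rw [Finset.sum_insert hi, ← ih hs, ← MemLp.toLp_const_smul, ← MemLp.toLp_add]
    refine (MemLp.toLp_eq_toLp_iff _ _).2 (Eventually.of_forall fun z => ?_)
    simp only [Finset.sum_insert hi]
    rfl

section

variable {G : Set ℂ} {η : ℕ → ℂ → ℂ}

theorem areaInner_eq_inner {f g : ℂ → ℂ} (hf : MemLp f 2 (volume.restrict G))
    (hg : MemLp g 2 (volume.restrict G)) :
    areaInner G f g = inner ℂ (hg.toLp g) (hf.toLp f) := by
  rw [L2.inner_def, areaInner]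
  refine integral_congr_ae ?_
  filter_upwards [hf.coeFn_toLp, hg.coeFn_toLp] with z h1 h2
  rw [h1, h2]
  rfl

theorem areaInner_self {f : ℂ → ℂ} (hf : MemLp f 2 (volume.restrict G)) :
    areaInner G f f = ((‖hf.toLp f‖ ^ 2 : ℝ) : ℂ) := by
  rw [areaInner_eq_inner hf hf, inner_self_eq_norm_sq_to_K]
  push_cast
  rfl

theorem orthogonalized_eq (G : Set ℂ) (η : ℕ → ℂ → ℂ) (j : ℕ) :
    orthogonalized G η j = fun z => η j z - ∑ i : Fin j,
      areaInner G (η j) (orthogonalized G η i) /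
        areaInner G (orthogonalized G η i) (orthogonalized G η i) * orthogonalized G η i z := by
  ext z
  rw [orthogonalized]

theorem orthogonalized_toLp (hη : ∀ j, MemLp (η j) 2 (volume.restrict G)) (j : ℕ) :
    ∃ h : MemLp (orthogonalized G η j) 2 (volume.restrict G),
      h.toLp _ = InnerProductSpace.gramSchmidt ℂ (fun i => (hη i).toLp (η i)) j := by
  induction j using Nat.strong_induction_on with
  | _ j ih =>
  have hmem : ∀ i : Fin j, MemLp (orthogonalized G η i) 2 (volume.restrict G) := fun i =>
    (ih i i.2).1
  have heq := orthogonalized_eq G η j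
  have hsum : MemLp (fun z => ∑ i : Fin j, areaInner G (η j) (orthogonalized G η i) /
      areaInner G (orthogonalized G η i) (orthogonalized G η i) * orthogonalized G η i z) 2
      (volume.restrict G) := memLp_finsetSum _ fun i _ => (hmem i).const_mul _
  have hj : MemLp (orthogonalized G η j) 2 (volume.restrict G) := by
    rw [heq]
    exact (hη j).sub hsum
  refine ⟨hj, ?_⟩
  have h1 : hj.toLp _ = (hη j).toLp _ - hsum.toLp _ := by
    rw [← MemLp.toLp_sub]
    refine (MemLp.toLp_eq_toLp_iff _ _).2 (Eventually.of_forall fun z => ?_)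
    rw [heq]
    rfl
  rw [h1, MemLp.toLp_sum_mul hmem, InnerProductSpace.gramSchmidt_def, Nat.Iio_eq_range,
    ← Fin.sum_univ_eq_sum_range (fun i => (Submodule.span ℂ
      {InnerProductSpace.gramSchmidt ℂ (fun i => (hη i).toLp (η i)) i}).starProjection
        ((hη j).toLp (η j)))]
  congr 1
  refine Finset.sum_congr rfl fun i _ => ?_
  rw [Submodule.starProjection_singleton, areaInner_eq_inner (hη j) (hmem i),
    areaInner_self (hmem i), (ih i i.2).2]
  rfl

theorem augmentedBergman_toLp (hη : ∀ j, MemLp (η j) 2 (volume.restrict G)) (j : ℕ) :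
    ∃ h : MemLp (augmentedBergman G η j) 2 (volume.restrict G),
      h.toLp _ = InnerProductSpace.gramSchmidtNormed ℂ (fun i => (hη i).toLp (η i)) j := by
  obtain ⟨h, hj⟩ := orthogonalized_toLp hη j
  have heq : augmentedBergman G η j = fun z =>
      ((‖h.toLp _‖ : ℝ) : ℂ)⁻¹ * orthogonalized G η j z := by
    ext z
    rw [augmentedBergman, areaInner_self h, Complex.ofReal_re, Real.sqrt_sq (norm_nonneg _),
      div_eq_inv_mul]
  have hm : MemLp (augmentedBergman G η j) 2 (volume.restrict G) := by
    rw [heq]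
    exact h.const_mul _
  refine ⟨hm, ?_⟩
  rw [InnerProductSpace.gramSchmidtNormed, ← hj, ← MemLp.toLp_const_smul]
  refine (MemLp.toLp_eq_toLp_iff _ _).2 (Eventually.of_forall fun z => ?_)
  rw [heq]
  rfl

theorem differentiableOn_orthogonalized (hη : ∀ j, DifferentiableOn ℂ (η j) G) (j : ℕ) :
    DifferentiableOn ℂ (orthogonalized G η j) G := by
  induction j using Nat.strong_induction_on with
  | _ j ih =>
  rw [orthogonalized_eq]
  exact (hη j).sub (DifferentiableOn.fun_sum fun i _ => (ih i i.2).const_mul _)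

/-- The augmented kernel polynomial is the best approximation of the Bergman kernel in the span of
the augmented system: by the reproducing property its coefficients are those of the orthogonal
projection of the kernel. -/
theorem IsBergmanKernel.eLpNorm_sub_augmentedKernel_le {z₀ : ℂ} {K : ℂ → ℂ}
    (hK : IsBergmanKernel G z₀ K) {κ : ℕ} {φ : Fin κ → ℂ → ℂ}
    (hd : ∀ j, DifferentiableOn ℂ (augmentedSystem φ j) G)
    (hη : ∀ j, MemLp (augmentedSystem φ j) 2 (volume.restrict G)) (n : ℕ) (a : ℕ → ℂ) :
    eLpNorm (fun w => K w - augmentedKernel G z₀ φ n w) 2 (volume.restrict G) ≤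
      eLpNorm (fun w => K w - ∑ i ∈ Finset.range (κ + n), a i * augmentedSystem φ i w) 2
        (volume.restrict G) := by
  let v : ℕ → Lp ℂ 2 (volume.restrict G) := fun i => (hη i).toLp (augmentedSystem φ i)
  choose hP hPv using augmentedBergman_toLp hη
  have hPd : ∀ j, DifferentiableOn ℂ (augmentedBergman G (augmentedSystem φ) j) G := fun j =>
    (differentiableOn_orthogonalized hd j).div_const _
  have hcoef : ∀ j, (starRingEnd ℂ) (augmentedBergman G (augmentedSystem φ) j z₀) =
      inner ℂ (InnerProductSpace.gramSchmidtNormed ℂ v j) (hK.memLp.toLp K) := by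
    intro j
    rw [← hK.reproducing _ (hPd j) (hP j), ← inner_conj_symm, ← hPv j]
    exact congrArg _ (areaInner_eq_inner (hP j) hK.memLp)
  have hkm : MemLp (augmentedKernel G z₀ φ n) 2 (volume.restrict G) :=
    memLp_finsetSum _ fun j _ => (hP j).const_mul _
  have hk : hkm.toLp _ = ∑ j ∈ Finset.range (κ + n),
      inner ℂ (InnerProductSpace.gramSchmidtNormed ℂ v j) (hK.memLp.toLp K) •
        InnerProductSpace.gramSchmidtNormed ℂ v j := by
    refine (MemLp.toLp_sum_mul hP _ _ hkm).trans (Finset.sum_congr rfl fun j _ => ?_)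
    rw [hcoef, hPv]
  have hpm : MemLp (fun w => ∑ i ∈ Finset.range (κ + n), a i * augmentedSystem φ i w) 2
      (volume.restrict G) := memLp_finsetSum _ fun j _ => (hη j).const_mul _
  have hp : hpm.toLp _ ∈ Submodule.span ℂ (v '' Iio (κ + n)) := by
    rw [MemLp.toLp_sum_mul hη]
    exact Submodule.sum_mem _ fun i hi => Submodule.smul_mem _ _
      (Submodule.subset_span (mem_image_of_mem v (Finset.mem_range.1 hi)))
  have key := norm_sub_sum_gramSchmidtNormed_le v (hK.memLp.toLp K) (κ + n) hp
  rw [← hk, ← MemLp.toLp_sub, ← MemLp.toLp_sub] at key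
  have key' := enorm_le_iff_norm_le.2 key
  rwa [Lp.enorm_toLp, Lp.enorm_toLp] at key'

end

/-! ### The rate of convergence of the augmented kernel polynomials -/

theorem IsPowerBranch.exists_norm_deriv_le {G : Set ℂ} (hG : IsOpen G) {a : ℂ}
    (ha : a ∉ closure G) {k m : ℕ} (hk : 0 < k) (hm : 0 < m) {φ : ℂ → ℂ}
    (hφ : IsPowerBranch a k m φ G) : ∃ C : ℝ, ∀ z ∈ G, ‖deriv φ z‖ ≤ C := by
  obtain ⟨δ, hδ, hball⟩ := Metric.mem_nhds_iff.1 (isClosed_closure.isOpen_compl.mem_nhds ha)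
  have hfar : ∀ z ∈ G, δ ≤ ‖z - a‖ := fun z hz => by
    by_contra! hlt
    exact hball (show z ∈ Metric.ball a δ by rwa [Metric.mem_ball, dist_eq_norm])
      (subset_closure hz)
  have hbound : ∀ z ∈ G, ‖φ z‖ ≤ max 1 (δ ^ k)⁻¹ := by
    intro z hz
    have h1 := congrArg norm (hφ.2 z hz)
    rw [norm_mul, norm_pow, norm_pow, norm_one] at h1
    have h2 : δ ^ k ≤ ‖z - a‖ ^ k := by gcongr; exact hfar z hz
    have h3 : ‖φ z‖ ^ m ≤ (δ ^ k)⁻¹ := by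
      rw [eq_inv_of_mul_eq_one_left h1]
      exact inv_anti₀ (by positivity) h2
    rcases le_total ‖φ z‖ 1 with h | h
    · exact h.trans (le_max_left _ _)
    · exact ((le_self_pow₀ h hm.ne').trans h3).trans (le_max_right _ _)
  refine ⟨‖-(k / m : ℂ)‖ * (max 1 (δ ^ k)⁻¹ / δ), fun z hz => ?_⟩
  rw [(hφ.hasDerivAt hG hk hm hz).deriv, norm_mul, norm_div]
  gcongr
  · exact hbound z hz
  · exact hfar z hz

theorem augmentedSystem_of_lt {κ : ℕ} (φ : Fin κ → ℂ → ℂ) (i : Fin κ) :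
    augmentedSystem φ i = deriv (φ i) := dif_pos i.2

theorem augmentedSystem_add {κ : ℕ} (φ : Fin κ → ℂ → ℂ) (i : ℕ) :
    augmentedSystem φ (κ + i) = fun z : ℂ => ((i : ℂ) + 1) * z ^ i := by
  rw [augmentedSystem, dif_neg (by omega), Nat.add_sub_cancel_left]
  ext z
  simp

section

variable {G : Set ℂ} {κ : ℕ} {z : Fin κ → ℂ} {k m : Fin κ → ℕ} {φ : Fin κ → ℂ → ℂ}

theorem differentiableOn_augmentedSystem (hG : IsOpen G)
    (hφ : ∀ j, IsPowerBranch (z j) (k j) (m j) (φ j) G) (i : ℕ) :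
    DifferentiableOn ℂ (augmentedSystem φ i) G := by
  rcases lt_or_ge i κ with h | h
  · rw [show i = (⟨i, h⟩ : Fin κ) from rfl, augmentedSystem_of_lt]
    exact (hφ _).1.deriv hG
  · obtain ⟨i, rfl⟩ := Nat.exists_eq_add_of_le h
    rw [augmentedSystem_add]
    fun_prop

theorem memLp_augmentedSystem (hG : IsOpen G) (hGb : Bornology.IsBounded G)
    (hz : ∀ j, z j ∉ closure G) (hk : ∀ j, 0 < k j) (hm : ∀ j, 0 < m j)
    (hφ : ∀ j, IsPowerBranch (z j) (k j) (m j) (φ j) G) (i : ℕ) :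
    MemLp (augmentedSystem φ i) 2 (volume.restrict G) := by
  have hd := differentiableOn_augmentedSystem hG hφ i
  suffices h : ∃ C : ℝ, ∀ w ∈ G, ‖augmentedSystem φ i w‖ ≤ C from
    hd.memLp_two_of_bounded hG hGb h.choose_spec
  rcases lt_or_ge i κ with h | h
  · rw [show i = (⟨i, h⟩ : Fin κ) from rfl, augmentedSystem_of_lt]
    exact (hφ _).exists_norm_deriv_le hG (hz _) (hk _) (hm _)
  · obtain ⟨i, rfl⟩ := Nat.exists_eq_add_of_le h
    rw [augmentedSystem_add]
    obtain ⟨C, hC⟩ := hGb.isCompact_closure.exists_bound_of_continuousOn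
      (f := fun w : ℂ => ((i : ℂ) + 1) * w ^ i) (by fun_prop)
    exact ⟨C, fun w hw => hC w (subset_closure hw)⟩

/-- The span of the augmented system contains the derivatives of the combinations of the singular
functions and of polynomials. -/
theorem exists_sum_augmentedSystem_eq (φ : Fin κ → ℂ → ℂ) (c : Fin κ → ℂ) {n : ℕ}
    {p : Polynomial ℂ} (hp : p.natDegree ≤ n) (s : ℂ) :
    ∃ a : ℕ → ℂ, ∀ w, ∑ i ∈ Finset.range (κ + n), a i * augmentedSystem φ i w =
      s * (∑ j, c j * deriv (φ j) w + p.derivative.eval w) := by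
  refine ⟨fun i => if h : i < κ then s * c ⟨i, h⟩ else s * p.coeff (i - κ + 1), fun w => ?_⟩
  rw [Finset.sum_range_add, mul_add]
  congr 1
  · rw [Finset.sum_range, Finset.mul_sum]
    refine Finset.sum_congr rfl fun j _ => ?_
    beta_reduce
    rw [dif_pos j.2, augmentedSystem_of_lt, mul_assoc]
  · have hdeg : p.derivative.natDegree < n + 1 :=
      (Polynomial.natDegree_derivative_le p).trans_lt (by omega)
    rw [Polynomial.eval_eq_sum_range' hdeg, Finset.sum_range_succ, Polynomial.coeff_derivative,
      Polynomial.coeff_eq_zero_of_natDegree_lt (Nat.lt_succ_of_le hp), zero_mul, zero_mul, add_zero,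
      Finset.mul_sum]
    refine Finset.sum_congr rfl fun i _ => ?_
    beta_reduce
    rw [dif_neg (by omega), augmentedSystem_add, Nat.add_sub_cancel_left,
      Polynomial.coeff_derivative]
    ring

end

theorem mainTheorem4
    (G : Set ℂ) (hG : IsPiecewiseAnalyticJordanDomain G)
    (z₀ : ℂ) (hz₀ : z₀ ∈ G)
    (r₀ : ℝ) (f₀ : ℂ → ℂ) (hf₀ : IsInteriorConformalMap G z₀ r₀ f₀)
    (Φ : ℂ → ℂ) (hΦ : IsExteriorConformalMap G Φ)
    (K : ℂ → ℂ) (hK : IsBergmanKernel G z₀ K)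
    -- the nearest `κ` singularities `z j`, their exponents `k j / m j`, and the next singularity
    (κ : ℕ) (z : Fin κ → ℂ) (k m : Fin κ → ℕ) (zNext : ℂ)
    (hz : ∀ j, z j ∉ closure G) (hzinj : Function.Injective z)
    (hk : ∀ j, 0 < k j) (hm : ∀ j, 0 < m j)
    (hzNext : zNext ∉ closure G) (hlt : ∀ j, ‖Φ (z j)‖ < ‖Φ zNext‖)
    (hsing : HasOnlyRationalPoles f₀ G (levelInterior G Φ ‖Φ zNext‖) z k m)
    -- the branches on `G` of `(1 / (z - z j)) ^ (k j / m j)` used in the augmented basis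
    (φ : Fin κ → ℂ → ℂ) (hφ : ∀ j, IsPowerBranch (z j) (k j) (m j) (φ j) G)
    (R : ℝ) (hR1 : 1 < R) (hR : R < ‖Φ zNext‖) :
    ∃ c : ℝ, 0 < c ∧ ∀ n : ℕ,
      eLpNorm (fun w => K w - augmentedKernel G z₀ φ n w) 2 (volume.restrict G)
        ≤ ENNReal.ofReal (c / R ^ n) := by
  have hGo := hG.isOpen
  obtain ⟨ψ, hψ⟩ := hΦ.exists_inverse hG.bounded
  have hϱ : 1 < ‖Φ zNext‖ := hψ.one_lt_norm zNext hzNext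
  obtain ⟨b, h, hh, hdecomp⟩ := hsing.exists_decomposition hG ⟨z₀, hz₀⟩ hψ hf₀.holomorphic hϱ hz
    hzinj hk hm hφ
  obtain ⟨C, hC⟩ := hψ.exists_polynomial_approx hG.bounded hh hR1 hR
  have hderiv : ∀ w ∈ G, deriv f₀ w = ∑ j, b j * deriv (φ j) w + deriv h w := by
    intro w hw
    have h1 : ∀ j, HasDerivAt (φ j) (deriv (φ j) w) w := fun j =>
      ((hφ j).1.differentiableAt (hGo.mem_nhds hw)).hasDerivAt
    have h2 : HasDerivAt h (deriv h w) w := (hh.differentiableAt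
      ((hψ.isOpen_levelInterior hϱ).mem_nhds (Or.inl (subset_closure hw)))).hasDerivAt
    have h3 := (HasDerivAt.fun_sum (u := Finset.univ) fun j _ => (h1 j).const_mul (b j)).add h2
    refine (h3.congr_of_eventuallyEq ?_).deriv
    filter_upwards [hGo.mem_nhds hw] with x hx using hdecomp x hx
  set s : ℂ := ((Real.pi * r₀ ^ 2 : ℝ) : ℂ)⁻¹ with hs
  have hae := hf₀.bergmanKernel_ae_eq hGo hz₀ hK
  let V : ℝ := ((volume.restrict G) univ ^ (2 : ENNReal).toReal⁻¹).toReal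
  have hV : (volume.restrict G) univ ^ (2 : ENNReal).toReal⁻¹ = ENNReal.ofReal V := by
    refine (ENNReal.ofReal_toReal (ENNReal.rpow_ne_top_of_nonneg (by simp) ?_)).symm
    simpa using hG.bounded.measure_lt_top.ne
  refine ⟨V * (‖s‖ * |C|) + 1, by positivity, fun n => ?_⟩
  obtain ⟨p, hpdeg, hp⟩ := hC n
  obtain ⟨a, ha⟩ := exists_sum_augmentedSystem_eq φ b hpdeg s
  refine (hK.eLpNorm_sub_augmentedKernel_le (differentiableOn_augmentedSystem hGo hφ)
    (memLp_augmentedSystem hGo hG.bounded hz hk hm hφ) n a).trans ?_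
  have hbound : ∀ᵐ w ∂volume.restrict G,
      ‖K w - ∑ i ∈ Finset.range (κ + n), a i * augmentedSystem φ i w‖ ≤ ‖s‖ * |C| / R ^ n := by
    filter_upwards [hae, ae_restrict_mem hGo.measurableSet] with w hKw hw
    rw [hKw, ha, ← mul_sub, norm_mul, hderiv w hw, add_sub_add_left_eq_sub, mul_div_assoc]
    gcongr
    exact (hp w (subset_closure hw)).trans (by gcongr; exact le_abs_self C)
  refine (eLpNorm_le_of_ae_bound hbound).trans ?_
  rw [hV, ← ENNReal.ofReal_mul (by positivity), ← mul_div_assoc]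
  refine ENNReal.ofReal_le_ofReal ?_
  gcongr
  linarith
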